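/- **Conventions.** Manifolds, maps, metrics and tensor fields are smooth. An almost contact metric structure $(\phi,\xi,\eta,\tilde g)$ on $\tilde M$ consists of a field of endomorphisms $\phi$, a vector field $\xi$, a one-form $\eta$ and a Riemannian metric $\tilde g$ with $\phi^2=-\mathrm{Id}+\eta\otimes\xi$, $\eta(\xi)=1$, $\phi\xi=0$, $\eta\circ\phi=0$ and $\tilde g(\phi X,\phi Y)=\tilde g(X,Y)-\eta(X)\eta(Y)$. It is cosymplectic if $\tilde\nabla\phi=0$ for the Levi-Civita connection $\tilde\nabla$ of $\tilde g$. A cosymplectic space form $\tilde M^{2m+1}(c)$ is a $(2m+1)$-dimensional cosymplectic manifold all of whose $\phi$-sectional curvatures $K(X,\phi X)$ ($X\ne0$, $X\perp\xi$) equal $c$. Let $(N_1,g_1)$ and $(N_2,g_2)$ be Riemannian manifolds of dimensions $n_1,n_2$, let $f:N_1\to(0,\infty)$ be smooth, and let $M^n=N_1\times_fN_2$ be $N_1\times N_2$ with the metric $g_1+f^2g_2$. Let $D_1,D_2$ be the distributions on $M$ tangent to $N_1,N_2$. Let $\varphi:M^n\to\tilde M^{2m+1}(c)$ be an isometric immersion,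 with second fundamental form $h$; identify tangent vectors of $M$ with their images. Call $M$ a *contact warped product submanifold* if $\xi$ is tangent to the first factor (that is, $\xi\in D_1$ along $M$) and $\phi D_1$ is orthogonal to $D_2$ (as is the case for contact CR-warped products $N_T\times_fN_\perp$). Call $\varphi$ *$D_1$-minimal* if $\sum_{i=1}^{n_1}h(e_i,e_i)=0$ for orthonormal bases $e_1,\dots,e_{n_1}$ of $D_1$ at every point. **Theorem.** Let $\varphi:M^n=N_1\times_fN_2\to\tilde M^{2m+1}(c)$ be a $D_1$-minimal isometric immersion of a contact warped product submanifold into a cosymplectic space form. Then: (i) At every point of $M$, $$\|h\|^2\ \ge\ 2n_2\Bigl(\|\nabla\ln f\|^2-\Delta\ln f+(n_1-1)\frac c4\Bigr),$$ where $\|h\|^2=\sum_{i,j}\tilde g(h(e_i,e_j),h(e_i,e_j))$ over an orthonormal basis of the tangent space of $M$, and $\nabla$ and $\Delta$ are the gradient and the Laplacian of $(N_1,g_1)$, the latter with the sign $\Delta\psi=\sum_{i=1}^{n_1}\bigl((\nabla_{e_i}e_i)\psi-e_ie_i\psi\bigr)=-\operatorname{trace}\operatorname{Hess}\psi$. (ii)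 Equality holds in (i) at every point of $M$ if and only if $N_1$, $N_2$ and $M$ are, respectively, totally geodesic, totally umbilical and minimal in $\tilde M^{2m+1}(c)$; that is, if and only if every leaf $N_1\times\{q\}$ is totally geodesic in $\tilde M$, every leaf $\{p\}\times N_2$ is totally umbilical in $\tilde M$, and $M$ is minimal in $\tilde M$. -/

import Mathlib

open Set Module Bundle
open scoped Manifold ContDiff

noncomputable section

/-! ### Riemannian geometry in a coordinate domain of a finite-dimensional vector space `E` -/

section Coordinates

variable {E : Type*} [NormedAddCommGroup E] [NormedSpace ℝ E]

/-- The Christoffel map of the Levi-Civita connection of a metric `G` given on a coordinate domain: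
`Γ_y(u, v)` is the vector with
`G_y(Γ_y(u, v), w) = (1/2) (D_u G(v, w) + D_v G(u, w) - D_w G(u, v))` for all `w`. In coordinates,
`∇_u V = D_u V + Γ(u, V)`. -/
def christoffel (G : E → E →L[ℝ] E →L[ℝ] ℝ) (y u v : E) : E :=
  (G y).inverse ((1 / 2 : ℝ) •
    (fderiv ℝ G y u v + fderiv ℝ G y v u - ((fderiv ℝ G y).flip u).flip v))

/-- The Riemann curvature tensor `R(u, v) w = ∇_u ∇_v w - ∇_v ∇_u w - ∇_[u,v] w` of the metric `G`
at the point `y` of a coordinate domain (with `u, v, w` extended as constant fields). -/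
def coordCurvature (G : E → E →L[ℝ] E →L[ℝ] ℝ) (y u v w : E) : E :=
  fderiv ℝ (fun z => christoffel G z v w) y u - fderiv ℝ (fun z => christoffel G z u w) y v
    + christoffel G y u (christoffel G y v w) - christoffel G y v (christoffel G y u w)

/-- The covariant derivative `(∇_u T) v = ∇_u (T v) - T (∇_u v)` of a field `T` of endomorphisms at
the point `y` of a coordinate domain. -/
def coordCovDerivEnd (G : E → E →L[ℝ] E →L[ℝ] ℝ) (T : E → E →L[ℝ] E) (y u v : E) : E :=
  fderiv ℝ T y u v + christoffel G y u (T y v) - T y (christoffel G y u v)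

/-- The trace of a bilinear map `B` with respect to an inner product `b`, in index notation
`b^{ij} B_{ij}`. For a `b`-orthonormal basis `e` it is `∑ i, B (e i) (e i)`. -/
def metricTrace [FiniteDimensional ℝ E] {F : Type*} [AddCommGroup F] [Module ℝ F]
    (b : E →L[ℝ] E →L[ℝ] ℝ) (B : E → E → F) : F :=
  ∑ i, ∑ j,
    ((Matrix.of fun k l => b (finBasis ℝ E k) (finBasis ℝ E l))⁻¹ i j) •
      B (finBasis ℝ E i) (finBasis ℝ E j)

end Coordinates

/-! ### Riemannian geometry on a manifold without boundary

A family of bilinear forms `g x` on the tangent spaces is written in the preferred chart at a point.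
Recall that the tangent space `TangentSpace I p` is the model space `E`, identified through the
preferred chart at `p`, so that a tensor computed at `p` in the preferred chart at `p` is a tensor
on `TangentSpace I p`. -/

section Manifold

variable {E : Type*} [NormedAddCommGroup E] [NormedSpace ℝ E]
  {H : Type*} [TopologicalSpace H] (I : ModelWithCorners ℝ E H)
  {M : Type*} [TopologicalSpace M] [ChartedSpace H M]
  {E' : Type*} [NormedAddCommGroup E'] [NormedSpace ℝ E']
  {H' : Type*} [TopologicalSpace H'] (J : ModelWithCorners ℝ E' H')
  {M' : Type*} [TopologicalSpace M'] [ChartedSpace H' M']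

/-- The metric `g` in the preferred chart at `p`: its pullback under the inverse chart. -/
def chartMetric (g : ∀ x : M, TangentSpace I x →L[ℝ] TangentSpace I x →L[ℝ] ℝ) (p : M) :
    E → E →L[ℝ] E →L[ℝ] ℝ := fun y =>
  let A : E →L[ℝ] E := mfderiv 𝓘(ℝ, E) I (extChartAt I p).symm y
  let B : E →L[ℝ] E →L[ℝ] ℝ := g ((extChartAt I p).symm y)
  let C : E →L[ℝ] E →L[ℝ] ℝ := B.bilinearComp A A
  C

/-- A field `T` of endomorphisms of the tangent spaces in the preferred chart at `p`. -/
def chartEnd (T : ∀ x : M, TangentSpace I x →L[ℝ] TangentSpace I x) (p : M) :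
    E → E →L[ℝ] E := fun y =>
  let A : E →L[ℝ] E := mfderiv 𝓘(ℝ, E) I (extChartAt I p).symm y
  let A' : E →L[ℝ] E := mfderiv I 𝓘(ℝ, E) (extChartAt I p) ((extChartAt I p).symm y)
  let B : E →L[ℝ] E := T ((extChartAt I p).symm y)
  A' ∘L B ∘L A

/-- The Riemann curvature tensor `R(u, v) w` at `p` of the metric `g`. -/
def riemannCurvature (g : ∀ x : M, TangentSpace I x →L[ℝ] TangentSpace I x →L[ℝ] ℝ) (p : M)
    (u v w : TangentSpace I p) : TangentSpace I p :=
  coordCurvature (E := E) (chartMetric I g p) (extChartAt I p p) u v w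

/-- The sectional curvature of the plane spanned by (linearly independent) `u` and `v`. -/
def sectionalCurvature (g : ∀ x : M, TangentSpace I x →L[ℝ] TangentSpace I x →L[ℝ] ℝ) (p : M)
    (u v : TangentSpace I p) : ℝ :=
  g p (riemannCurvature I g p u v v) u / (g p u u * g p v v - g p u v ^ 2)

/-- The squared length of the gradient of `ψ` at `p`. -/
def gradNormSq (g : ∀ x : M, TangentSpace I x →L[ℝ] TangentSpace I x →L[ℝ] ℝ) (ψ : M → ℝ)
    (p : M) : ℝ :=
  let b : E →L[ℝ] E →L[ℝ] ℝ := g p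
  let dψ : E →L[ℝ] ℝ := mfderiv I 𝓘(ℝ, ℝ) ψ p
  let grad : E := b.inverse dψ
  b grad grad

/-- The Laplacian with the sign convention
`Δ ψ = ∑ i, ((∇_{e_i} e_i) ψ - e_i (e_i ψ)) = - trace (Hess ψ)`. -/
def laplacian [FiniteDimensional ℝ E]
    (g : ∀ x : M, TangentSpace I x →L[ℝ] TangentSpace I x →L[ℝ] ℝ) (ψ : M → ℝ) (p : M) : ℝ :=
  let y : E := extChartAt I p p
  let ψ' : E → ℝ := fun z => ψ ((extChartAt I p).symm z)
  metricTrace (E := E) (g p) fun u v =>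
    fderiv ℝ ψ' y (christoffel (chartMetric I g p) y u v) - fderiv ℝ (fderiv ℝ ψ') y u v

variable {I} in
/-- `F` is an isometric immersion: it is smooth and its differential preserves the metrics
(hence is injective when `g` is positive definite). -/
structure IsIsometricImmersion
    (g : ∀ x : M, TangentSpace I x →L[ℝ] TangentSpace I x →L[ℝ] ℝ)
    (g' : ∀ x : M', TangentSpace J x →L[ℝ] TangentSpace J x →L[ℝ] ℝ) (F : M → M') : Prop where
  contMDiff : ContMDiff I J ∞ F
  isometric : ∀ (p : M) (u v : TangentSpace I p),
    g' (F p) (mfderiv I J F p u) (mfderiv I J F p v) = g p u v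

variable {J} in
/-- The metric on `M` induced by `F : M → M'`. -/
def inducedMetric (g' : ∀ x : M', TangentSpace J x →L[ℝ] TangentSpace J x →L[ℝ] ℝ) (F : M → M') :
    ∀ x : M, TangentSpace I x →L[ℝ] TangentSpace I x →L[ℝ] ℝ := fun x =>
  let A : E →L[ℝ] E' := mfderiv I J F x
  let B : E' →L[ℝ] E' →L[ℝ] ℝ := g' (F x)
  let C : E →L[ℝ] E →L[ℝ] ℝ := B.bilinearComp A A
  C

variable {I J}

/-- The second fundamental form at `p` of an isometric immersion `F : (M, g) → (M', g')`, by the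
Gauss formula `h(u, v) = ∇'_u (dF v) - dF (∇_u v)`, where `∇`, `∇'` are the Levi-Civita
connections of `g`, `g'`. -/
def secondFundForm (g : ∀ x : M, TangentSpace I x →L[ℝ] TangentSpace I x →L[ℝ] ℝ)
    (g' : ∀ x : M', TangentSpace J x →L[ℝ] TangentSpace J x →L[ℝ] ℝ) (F : M → M') (p : M)
    (u v : TangentSpace I p) : TangentSpace J (F p) :=
  let y : E := extChartAt I p p
  let F' : E → E' := fun z => extChartAt J (F p) (F ((extChartAt I p).symm z))
  (fderiv ℝ (fderiv ℝ F') y u v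
    + christoffel (chartMetric J g' (F p)) (F' y) (fderiv ℝ F' y u) (fderiv ℝ F' y v)
    - fderiv ℝ F' y (christoffel (chartMetric I g p) y u v) : E')

/-- The squared norm `‖h‖² = ∑ i j, g'(h(e_i, e_j), h(e_i, e_j))` at `p` of the second fundamental
form of `F`, for `e` an orthonormal basis of the tangent space at `p`. -/
def secondFundFormNormSq [FiniteDimensional ℝ E]
    (g : ∀ x : M, TangentSpace I x →L[ℝ] TangentSpace I x →L[ℝ] ℝ)
    (g' : ∀ x : M', TangentSpace J x →L[ℝ] TangentSpace J x →L[ℝ] ℝ) (F : M → M') (p : M) : ℝ :=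
  metricTrace (E := E) (g p) fun u u' => metricTrace (E := E) (g p) fun v v' =>
    g' (F p) (secondFundForm g g' F p u v) (secondFundForm g g' F p u' v')

/-- The mean curvature vector `H = (1/n) trace h` at `p`. -/
def meanCurvature [FiniteDimensional ℝ E]
    (g : ∀ x : M, TangentSpace I x →L[ℝ] TangentSpace I x →L[ℝ] ℝ)
    (g' : ∀ x : M', TangentSpace J x →L[ℝ] TangentSpace J x →L[ℝ] ℝ) (F : M → M') (p : M) :
    TangentSpace J (F p) :=
  ((finrank ℝ E : ℝ)⁻¹ • metricTrace (E := E) (F := E') (g p)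
    fun u v => secondFundForm g g' F p u v : E')

/-- `M`, with the metric induced by `F`, is totally geodesic in `(M', g')`: `h = 0`. -/
def IsTotallyGeodesic (I : ModelWithCorners ℝ E H)
    (g' : ∀ x : M', TangentSpace J x →L[ℝ] TangentSpace J x →L[ℝ] ℝ) (F : M → M') : Prop :=
  ∀ (p : M) (u v : TangentSpace I p), secondFundForm (inducedMetric I g' F) g' F p u v = 0

/-- `M`, with the metric induced by `F`, is totally umbilical in `(M', g')`:
`h(u, v) = g(u, v) H`. -/
def IsTotallyUmbilical [FiniteDimensional ℝ E] (I : ModelWithCorners ℝ E H)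
    (g' : ∀ x : M', TangentSpace J x →L[ℝ] TangentSpace J x →L[ℝ] ℝ) (F : M → M') : Prop :=
  ∀ (p : M) (u v : TangentSpace I p), secondFundForm (inducedMetric I g' F) g' F p u v =
    inducedMetric I g' F p u v • meanCurvature (inducedMetric I g' F) g' F p

/-- `M`, with the metric induced by `F`, is minimal in `(M', g')`: `H = 0`. -/
def IsMinimal [FiniteDimensional ℝ E] (I : ModelWithCorners ℝ E H)
    (g' : ∀ x : M', TangentSpace J x →L[ℝ] TangentSpace J x →L[ℝ] ℝ) (F : M → M') : Prop :=
  ∀ p : M, meanCurvature (inducedMetric I g' F) g' F p = 0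

end Manifold

/-! ### Cosymplectic space forms -/

section Cosymplectic

variable {E : Type*} [NormedAddCommGroup E] [NormedSpace ℝ E]
  {H : Type*} [TopologicalSpace H] (I : ModelWithCorners ℝ E H)
  (M : Type*) [TopologicalSpace M] [ChartedSpace H M] [IsManifold I ∞ M]

/-- An almost contact metric structure `(φ, ξ, η, g)` on a manifold. The one-form `η` is
automatically smooth, because `η = g(ξ, ·)`. -/
structure AlmostContactMetric where
  g : ContMDiffRiemannianMetric I ∞ E (fun x : M => TangentSpace I x)
  φ : ∀ x : M, TangentSpace I x →L[ℝ] TangentSpace I x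
  ξ : ∀ x : M, TangentSpace I x
  η : ∀ x : M, TangentSpace I x →L[ℝ] ℝ
  contMDiff_φ : ContMDiff I (I.prod 𝓘(ℝ, E →L[ℝ] E)) ∞
    (fun x => TotalSpace.mk' (E →L[ℝ] E)
      (E := fun x : M => TangentSpace I x →L[ℝ] TangentSpace I x) x (φ x))
  contMDiff_ξ : ContMDiff I (I.prod 𝓘(ℝ, E)) ∞
    (fun x => TotalSpace.mk' E (E := fun x : M => TangentSpace I x) x (ξ x))
  φ_φ : ∀ x (u : TangentSpace I x), φ x (φ x u) = -u + η x u • ξ x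
  η_ξ : ∀ x, η x (ξ x) = 1
  φ_ξ : ∀ x, φ x (ξ x) = 0
  η_φ : ∀ x (u : TangentSpace I x), η x (φ x u) = 0
  g_φ_φ : ∀ x (u v : TangentSpace I x),
    g.inner x (φ x u) (φ x v) = g.inner x u v - η x u * η x v

variable {I M}

/-- The structure is cosymplectic: `φ` is parallel, `(∇_u φ) v = 0` for the Levi-Civita
connection, at all points of all preferred charts. -/
def AlmostContactMetric.IsCosymplectic (S : AlmostContactMetric I M) : Prop :=
  ∀ p : M, ∀ y ∈ (extChartAt I p).target, ∀ u v : E,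
    coordCovDerivEnd (chartMetric I S.g.inner p) (chartEnd I S.φ p) y u v = 0

/-- A cosymplectic space form `M(c)`: a cosymplectic manifold all of whose `φ`-sectional curvatures
`K(u, φ u)`, for `u ≠ 0` orthogonal to `ξ`, are equal to `c`. -/
structure AlmostContactMetric.IsCosymplecticSpaceForm (S : AlmostContactMetric I M) (c : ℝ) :
    Prop where
  isCosymplectic : S.IsCosymplectic
  sectionalCurvature_eq : ∀ (p : M) (u : TangentSpace I p), S.η p u = 0 → u ≠ 0 →
    sectionalCurvature I S.g.inner p u (S.φ p u) = c

end Cosymplectic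

/-! ### Warped products -/

section Warped

variable {E₁ : Type*} [NormedAddCommGroup E₁] [NormedSpace ℝ E₁]
  {H₁ : Type*} [TopologicalSpace H₁] {I₁ : ModelWithCorners ℝ E₁ H₁}
  {N₁ : Type*} [TopologicalSpace N₁] [ChartedSpace H₁ N₁]
  {E₂ : Type*} [NormedAddCommGroup E₂] [NormedSpace ℝ E₂]
  {H₂ : Type*} [TopologicalSpace H₂] {I₂ : ModelWithCorners ℝ E₂ H₂}
  {N₂ : Type*} [TopologicalSpace N₂] [ChartedSpace H₂ N₂]
  {E : Type*} [NormedAddCommGroup E] [NormedSpace ℝ E]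
  {H : Type*} [TopologicalSpace H] {I : ModelWithCorners ℝ E H}
  {M : Type*} [TopologicalSpace M] [ChartedSpace H M]

/-- The warped product metric `g₁ + f² g₂` on `N₁ × N₂`. -/
def warpedMetric (g₁ : ∀ x : N₁, TangentSpace I₁ x →L[ℝ] TangentSpace I₁ x →L[ℝ] ℝ)
    (g₂ : ∀ x : N₂, TangentSpace I₂ x →L[ℝ] TangentSpace I₂ x →L[ℝ] ℝ) (f : N₁ → ℝ) :
    ∀ x : N₁ × N₂, TangentSpace (I₁.prod I₂) x →L[ℝ] TangentSpace (I₁.prod I₂) x →L[ℝ] ℝ :=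
  fun x =>
    let b₁ : E₁ →L[ℝ] E₁ →L[ℝ] ℝ := g₁ x.1
    let b₂ : E₂ →L[ℝ] E₂ →L[ℝ] ℝ := g₂ x.2
    (b₁.bilinearComp (ContinuousLinearMap.fst ℝ E₁ E₂) (ContinuousLinearMap.fst ℝ E₁ E₂)
      + (f x.1 ^ 2) •
        b₂.bilinearComp (ContinuousLinearMap.snd ℝ E₁ E₂) (ContinuousLinearMap.snd ℝ E₁ E₂) :
      E₁ × E₂ →L[ℝ] E₁ × E₂ →L[ℝ] ℝ)

/-- The vector `(u, v)` tangent to `N₁ × N₂` at `x`. The distributions `D₁` and `D₂` tangent to the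
factors consist of the vectors `(u, 0)` and `(0, v)`. -/
def tangentPair (x : N₁ × N₂) (u : TangentSpace I₁ x.1) (v : TangentSpace I₂ x.2) :
    TangentSpace (I₁.prod I₂) x :=
  ((u, v) : E₁ × E₂)

/-- An immersion `F` of `N₁ × N₂` is `D₁`-minimal: the trace over `D₁` of the second fundamental
form, `∑ i, h(e_i, e_i)` for an orthonormal basis `e` of `D₁`, vanishes at every point. -/
def IsD₁Minimal [FiniteDimensional ℝ E₁]
    (g₁ : ∀ x : N₁, TangentSpace I₁ x →L[ℝ] TangentSpace I₁ x →L[ℝ] ℝ)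
    (g₂ : ∀ x : N₂, TangentSpace I₂ x →L[ℝ] TangentSpace I₂ x →L[ℝ] ℝ) (f : N₁ → ℝ)
    (g : ∀ x : M, TangentSpace I x →L[ℝ] TangentSpace I x →L[ℝ] ℝ) (F : N₁ × N₂ → M) : Prop :=
  ∀ x : N₁ × N₂, metricTrace (E := E₁) (F := E) (g₁ x.1) (fun u v =>
    secondFundForm (warpedMetric g₁ g₂ f) g F x (tangentPair x u 0) (tangentPair x v 0)) = 0

/-- The splitting `D₁ ⊕ D₂` of the tangent bundle of the immersed product `N₁ × N₂` is a contact
splitting: `ξ` is tangent to the first factor, and `φ D₁` is orthogonal to `D₂`. -/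
structure IsContactSplitting (I₁ : ModelWithCorners ℝ E₁ H₁) (I₂ : ModelWithCorners ℝ E₂ H₂)
    [IsManifold I ∞ M] (S : AlmostContactMetric I M) (F : N₁ × N₂ → M) : Prop where
  ξ_mem : ∀ x : N₁ × N₂, ∃ u : TangentSpace I₁ x.1,
    mfderiv (I₁.prod I₂) I F x (tangentPair x u 0) = S.ξ (F x)
  φ_orthogonal : ∀ (x : N₁ × N₂) (u : TangentSpace I₁ x.1) (v : TangentSpace I₂ x.2),
    S.g.inner (F x) (S.φ (F x) (mfderiv (I₁.prod I₂) I F x (tangentPair x u 0)))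
      (mfderiv (I₁.prod I₂) I F x (tangentPair x 0 v)) = 0

end Warped

end

/-!
The theorem compares `‖h‖²` with the curvature of mixed planes, spanned by `u ∈ D₁` and `v ∈ D₂`.

*Intrinsic side.* In the warped product `g₁ + f² g₂`, with `ψ = ln f` and `v` of unit length, the
curvature of the pair `(u, v)` is `-(Dψ u)² - Hess ψ (u, u)`; traced over `D₁` this is
`-(‖∇ψ‖² - Δψ)`.

*Ambient side.* On a cosymplectic manifold `φ` is parallel, so it commutes with the curvature
operators and `R(·, ·)ξ = 0`. On `ξ^⊥` the curvature is therefore of Kähler type, and polarization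
recovers it from the `φ`-sectional curvatures. If `v` is orthogonal to `ξ`, `u` and `φ u`, then
`⟨R(u, v)v, u⟩ = (c / 4) (‖u‖² - η(u)²) ‖v‖²`
(`AlmostContactMetric.IsCosymplecticSpaceForm.curvature_eq`). The contact splitting provides exactly
these orthogonality relations for `u ∈ D₁`, `v ∈ D₂`, and since `ξ ∈ D₁` is a unit vector, the trace
over `D₁` is `(n₁ - 1) c / 4` for a unit vector `v`.

*Gauss equation.* Traced over `D₁`, the Gauss equation contains the term
`⟨h(v, v), ∑ h(e_i, e_i)⟩`, which vanishes by `D₁`-minimality. What remains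
(`sum_warpedSecondFundForm_mixed`) is the identity
`∑ ‖h(e_i, v)‖² = ‖∇ψ‖² - Δψ + (n₁ - 1) c / 4` for each unit vector `v ∈ D₂`. Hence
`‖h‖² = ‖h|D₁‖² + 2 n₂ (‖∇ψ‖² - Δψ + (n₁ - 1) c / 4) + ‖h|D₂‖²` (`secondFundFormNormSq_eq`), which is
the inequality, with equality if and only if `h` vanishes on `D₁ × D₁` and on `D₂ × D₂`.

*Equality.* The leaves `N₁ × {q}` are totally geodesic in the warped product, so their second
fundamental form in the ambient space is `h|D₁`. The leaves `{p} × N₂` are totally umbilical in the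
warped product, so their second fundamental form differs from `h|D₂` by a multiple of the metric.
Given `D₁`-minimality, `M` is minimal if and only if `h|D₂` is trace-free, and a leaf `{p} × N₂` with
`h|D₂` trace-free is umbilical if and only if `h|D₂ = 0`.

All local computations are carried out in the preferred charts, where a metric is a function with
values in bilinear forms on the model space.
-/

open scoped Topology

noncomputable section

-- needed for instances on nested spaces of continuous linear maps
set_option maxSynthPendingDepth 3

/-! ### Metrics on a coordinate domain: connection and curvature -/

section Levi

variable {E : Type*} [NormedAddCommGroup E] [NormedSpace ℝ E]

/-- `G` is a smooth Riemannian metric on the open subset `U` of the vector space `E`. -/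
structure IsMetricOn (G : E → E →L[ℝ] E →L[ℝ] ℝ) (U : Set E) : Prop where
  isOpen : IsOpen U
  contDiffAt : ∀ y ∈ U, ContDiffAt ℝ ∞ G y
  symm : ∀ y ∈ U, ∀ u v, G y u v = G y v u
  pos : ∀ y ∈ U, ∀ u, u ≠ 0 → 0 < G y u u

theorem isInvertible_of_pos [FiniteDimensional ℝ E] {b : E →L[ℝ] E →L[ℝ] ℝ}
    (hb : ∀ u, u ≠ 0 → 0 < b u u) : b.IsInvertible := by
  have hinj : Function.Injective b.toLinearMap := by
    rw [← LinearMap.ker_eq_bot, LinearMap.ker_eq_bot']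
    intro u hu
    by_contra h
    have h1 := hb u h
    have h2 : b u = 0 := hu
    simp [h2] at h1
  have hfin : finrank ℝ E = finrank ℝ (E →L[ℝ] ℝ) := by
    rw [← (LinearMap.toContinuousLinearMap : (E →ₗ[ℝ] ℝ) ≃ₗ[ℝ] (E →L[ℝ] ℝ)).finrank_eq]
    exact (Subspace.dual_finrank_eq (K := ℝ) (V := E)).symm
  refine ⟨(LinearEquiv.ofInjectiveOfFinrankEq b.toLinearMap hinj hfin).toContinuousLinearEquiv, ?_⟩
  ext u v
  rfl

theorem apply_inverse_of_pos [FiniteDimensional ℝ E] {b : E →L[ℝ] E →L[ℝ] ℝ}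
    (hb : ∀ u, u ≠ 0 → 0 < b u u) (l : E →L[ℝ] ℝ) : b (b.inverse l) = l := by
  have h := (isInvertible_of_pos hb).self_comp_inverse
  exact congrArg (fun T : (E →L[ℝ] ℝ) →L[ℝ] (E →L[ℝ] ℝ) => T l) h

theorem ext_of_pos {b : E →L[ℝ] E →L[ℝ] ℝ}
    (hb : ∀ u, u ≠ 0 → 0 < b u u) {u v : E} (h : ∀ w, b u w = b v w) : u = v := by
  by_contra hne
  have h1 := hb (u - v) (sub_ne_zero.2 hne)
  simp only [map_sub, sub_apply, h, sub_self, lt_irrefl] at h1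

/-- The Christoffel map bundled as a field of continuous bilinear maps. -/
def christoffelCLM (G : E → E →L[ℝ] E →L[ℝ] ℝ) (y : E) : E →L[ℝ] E →L[ℝ] E :=
  (ContinuousLinearMap.compL ℝ E (E →L[ℝ] ℝ) E (G y).inverse).comp
    ((1 / 2 : ℝ) • (fderiv ℝ G y + (fderiv ℝ G y).flip
      - ((ContinuousLinearMap.flipₗᵢ ℝ E E ℝ).toContinuousLinearEquiv :
          (E →L[ℝ] E →L[ℝ] ℝ) →L[ℝ] (E →L[ℝ] E →L[ℝ] ℝ)).comp (fderiv ℝ G y).flip))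

theorem christoffelCLM_apply (G : E → E →L[ℝ] E →L[ℝ] ℝ) (y u v : E) :
    christoffelCLM G y u v = christoffel G y u v := rfl

theorem christoffel_eq_christoffelCLM (G : E → E →L[ℝ] E →L[ℝ] ℝ) (y u v : E) :
    christoffel G y u v = christoffelCLM G y u v := rfl

theorem fderiv_apply_apply {X : Type*} [NormedAddCommGroup X] [NormedSpace ℝ X]
    {F₁ F₂ F₃ : Type*} [NormedAddCommGroup F₁] [NormedSpace ℝ F₁] [NormedAddCommGroup F₂]
    [NormedSpace ℝ F₂] [NormedAddCommGroup F₃] [NormedSpace ℝ F₃]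
    {B : X → F₁ →L[ℝ] F₂ →L[ℝ] F₃} {a : X → F₁} {b : X → F₂} {x : X}
    (hB : DifferentiableAt ℝ B x) (ha : DifferentiableAt ℝ a x) (hb : DifferentiableAt ℝ b x)
    (u : X) :
    fderiv ℝ (fun z => B z (a z) (b z)) x u =
      fderiv ℝ B x u (a x) (b x) + B x (fderiv ℝ a x u) (b x) + B x (a x) (fderiv ℝ b x u) := by
  have h := ((hB.hasFDerivAt.clm_apply ha.hasFDerivAt).clm_apply hb.hasFDerivAt).fderiv
  rw [h]
  simp only [add_apply, ContinuousLinearMap.comp_apply,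
    ContinuousLinearMap.flip_apply]
  abel

theorem fderiv_apply_const {X : Type*} [NormedAddCommGroup X] [NormedSpace ℝ X]
    {F₁ F₂ : Type*} [NormedAddCommGroup F₁] [NormedSpace ℝ F₁] [NormedAddCommGroup F₂]
    [NormedSpace ℝ F₂]
    {B : X → F₁ →L[ℝ] F₂} {x : X} (hB : DifferentiableAt ℝ B x) (u : X) (a : F₁) :
    fderiv ℝ (fun z => B z a) x u = fderiv ℝ B x u a := by
  have h := (hB.hasFDerivAt.clm_apply (hasFDerivAt_const a x)).fderiv
  rw [h]
  simp

theorem fderiv_apply_const₂ {X : Type*} [NormedAddCommGroup X] [NormedSpace ℝ X]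
    {F₁ F₂ F₃ : Type*} [NormedAddCommGroup F₁] [NormedSpace ℝ F₁] [NormedAddCommGroup F₂]
    [NormedSpace ℝ F₂] [NormedAddCommGroup F₃] [NormedSpace ℝ F₃]
    {B : X → F₁ →L[ℝ] F₂ →L[ℝ] F₃} {x : X}
    (hB : DifferentiableAt ℝ B x) (u : X) (a : F₁) (b : F₂) :
    fderiv ℝ (fun z => B z a b) x u = fderiv ℝ B x u a b := by
  rw [fderiv_apply_apply hB (differentiableAt_const a) (differentiableAt_const b)]
  simp

theorem ContDiffAt.fderiv_infty {X Y : Type*} [NormedAddCommGroup X] [NormedSpace ℝ X]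
    [NormedAddCommGroup Y] [NormedSpace ℝ Y] {f : X → Y} {x : X} (hf : ContDiffAt ℝ ∞ f x) :
    ContDiffAt ℝ ∞ (fderiv ℝ f) x :=
  hf.fderiv_right (by norm_num)

theorem ContDiffAt.differentiableAt_infty {X Y : Type*} [NormedAddCommGroup X] [NormedSpace ℝ X]
    [NormedAddCommGroup Y] [NormedSpace ℝ Y] {f : X → Y} {x : X} (hf : ContDiffAt ℝ ∞ f x) :
    DifferentiableAt ℝ f x :=
  hf.differentiableAt (by norm_num)

theorem ContDiffAt.symm_snd {X Y : Type*} [NormedAddCommGroup X] [NormedSpace ℝ X]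
    [NormedAddCommGroup Y] [NormedSpace ℝ Y] {f : X → Y} {x : X} (hf : ContDiffAt ℝ ∞ f x)
    (u v : X) : fderiv ℝ (fderiv ℝ f) x u v = fderiv ℝ (fderiv ℝ f) x v u :=
  (hf.isSymmSndFDerivAt (by simpa using WithTop.coe_le_coe.2 (le_top : (2 : ℕ∞) ≤ ⊤))) u v

namespace IsMetricOn

variable {G : E → E →L[ℝ] E →L[ℝ] ℝ} {U : Set E}

theorem mem_nhds (hG : IsMetricOn G U) {y : E} (hy : y ∈ U) : U ∈ 𝓝 y := hG.isOpen.mem_nhds hy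

theorem differentiableAt (hG : IsMetricOn G U) {y : E} (hy : y ∈ U) : DifferentiableAt ℝ G y :=
  (hG.contDiffAt y hy).differentiableAt_infty

theorem fderiv_symm (hG : IsMetricOn G U) {y : E} (hy : y ∈ U) (u v w : E) :
    fderiv ℝ G y u v w = fderiv ℝ G y u w v := by
  rw [← fderiv_apply_const₂ (hG.differentiableAt hy), ← fderiv_apply_const₂ (hG.differentiableAt hy)]
  congr 1
  apply Filter.EventuallyEq.fderiv_eq
  filter_upwards [hG.mem_nhds hy] with z hz using hG.symm z hz v w

theorem christoffel_symm (hG : IsMetricOn G U) {y : E} (hy : y ∈ U) (u v : E) :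
    christoffel G y u v = christoffel G y v u := by
  unfold christoffel
  congr 2
  ext w
  simp only [sub_apply, add_apply,
    ContinuousLinearMap.flip_apply]
  rw [hG.fderiv_symm hy w u v]
  ring

theorem christoffelCLM_symm (hG : IsMetricOn G U) {y : E} (hy : y ∈ U) (u v : E) :
    christoffelCLM G y u v = christoffelCLM G y v u := hG.christoffel_symm hy u v

variable [FiniteDimensional ℝ E]

theorem christoffel_spec (hG : IsMetricOn G U) {y : E} (hy : y ∈ U) (u v w : E) :
    G y (christoffel G y u v) w =
      (1 / 2 : ℝ) * (fderiv ℝ G y u v w + fderiv ℝ G y v u w - fderiv ℝ G y w u v) := by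
  unfold christoffel
  rw [apply_inverse_of_pos (hG.pos y hy)]
  simp

/-- The Levi-Civita connection is metric. -/
theorem fderiv_eq_christoffel (hG : IsMetricOn G U) {y : E} (hy : y ∈ U) (u v w : E) :
    fderiv ℝ G y u v w = G y (christoffel G y u v) w + G y v (christoffel G y u w) := by
  rw [hG.symm y hy v, hG.christoffel_spec hy, hG.christoffel_spec hy, hG.fderiv_symm hy u w v,
    hG.fderiv_symm hy v u w, hG.fderiv_symm hy w u v]
  ring

theorem contDiffAt_christoffelCLM (hG : IsMetricOn G U) {y : E} (hy : y ∈ U) :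
    ContDiffAt ℝ ∞ (christoffelCLM G) y := by
  have : CompleteSpace E := FiniteDimensional.complete ℝ E
  have h1 : ContDiffAt ℝ ∞ (fun z => (G z).inverse) y :=
    ((isInvertible_of_pos (hG.pos y hy)).contDiffAt_map_inverse).comp y (hG.contDiffAt y hy)
  have hd := (hG.contDiffAt y hy).fderiv_infty
  have hfl : ContDiffAt ℝ ∞ (fun z => (fderiv ℝ G z).flip) y :=
    ((ContinuousLinearMap.flipₗᵢ ℝ E E (E →L[ℝ] ℝ)).toContinuousLinearEquiv.contDiff).contDiffAt.comp
      y hd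
  unfold christoffelCLM
  refine ContDiffAt.clm_comp ?_ ?_
  · exact ((ContinuousLinearMap.compL ℝ E (E →L[ℝ] ℝ) E).contDiff (n := ∞)).contDiffAt.comp y h1
  · exact ContDiffAt.const_smul (1 / 2 : ℝ) ((hd.add hfl).sub
      ((contDiffAt_const (c := ((ContinuousLinearMap.flipₗᵢ ℝ E E ℝ).toContinuousLinearEquiv :
        (E →L[ℝ] E →L[ℝ] ℝ) →L[ℝ] (E →L[ℝ] E →L[ℝ] ℝ)))).clm_comp hfl))

theorem differentiableAt_christoffelCLM (hG : IsMetricOn G U) {y : E} (hy : y ∈ U) :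
    DifferentiableAt ℝ (christoffelCLM G) y :=
  (hG.contDiffAt_christoffelCLM hy).differentiableAt_infty

theorem coordCurvature_eq (hG : IsMetricOn G U) {y : E} (hy : y ∈ U) (u v w : E) :
    coordCurvature G y u v w =
      fderiv ℝ (christoffelCLM G) y u v w - fderiv ℝ (christoffelCLM G) y v u w
      + christoffelCLM G y u (christoffelCLM G y v w)
      - christoffelCLM G y v (christoffelCLM G y u w) := by
  unfold coordCurvature
  simp only [christoffel_eq_christoffelCLM]
  rw [fderiv_apply_const₂ (hG.differentiableAt_christoffelCLM hy),
    fderiv_apply_const₂ (hG.differentiableAt_christoffelCLM hy)]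

theorem fderiv_christoffelCLM_symm (hG : IsMetricOn G U) {y : E} (hy : y ∈ U) (u v w : E) :
    fderiv ℝ (christoffelCLM G) y u v w = fderiv ℝ (christoffelCLM G) y u w v := by
  have hd := hG.differentiableAt_christoffelCLM hy
  rw [← fderiv_apply_const₂ hd, ← fderiv_apply_const₂ hd]
  congr 1
  apply Filter.EventuallyEq.fderiv_eq
  filter_upwards [hG.mem_nhds hy] with z hz using hG.christoffelCLM_symm hz v w

/-- The first Bianchi identity. -/
theorem coordCurvature_bianchi (hG : IsMetricOn G U) {y : E} (hy : y ∈ U) (u v w : E) :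
    coordCurvature G y u v w + coordCurvature G y v w u + coordCurvature G y w u v = 0 := by
  simp only [hG.coordCurvature_eq hy]
  rw [hG.fderiv_christoffelCLM_symm hy u w v, hG.fderiv_christoffelCLM_symm hy v w u,
    hG.fderiv_christoffelCLM_symm hy w v u, hG.christoffelCLM_symm hy w v,
    hG.christoffelCLM_symm hy w u, hG.christoffelCLM_symm hy v u]
  abel

/-- The second derivative of `G(w, w)`, by the compatibility of the connection with `G`. Its symmetry
in `u` and `v` makes the curvature operators skew-adjoint. -/
theorem fderiv_fderiv_eq_christoffel (hG : IsMetricOn G U) {y : E} (hy : y ∈ U) (u v w : E) :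
    fderiv ℝ (fderiv ℝ G) y u v w w =
      2 * (G y (fderiv ℝ (christoffelCLM G) y u v w
        + christoffelCLM G y u (christoffelCLM G y v w)) w
      + G y (christoffelCLM G y v w) (christoffelCLM G y u w)) := by
  have hd := hG.differentiableAt_christoffelCLM hy
  have h2 := (hG.contDiffAt y hy).fderiv_infty.differentiableAt_infty
  have hΓ : DifferentiableAt ℝ (fun z => christoffelCLM G z v w) y := by fun_prop
  have hG2 : DifferentiableAt ℝ (fun z => fderiv ℝ G z v) y := by fun_prop
  have e1 : fderiv ℝ (fun z => fderiv ℝ G z v w w) y u = fderiv ℝ (fderiv ℝ G) y u v w w := by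
    rw [fderiv_apply_const₂ hG2, fderiv_apply_const h2]
  have e2 : fderiv ℝ (fun z => fderiv ℝ G z v w w) y u =
      fderiv ℝ (fun z => 2 * G z (christoffelCLM G z v w) w) y u := by
    congr 1
    apply Filter.EventuallyEq.fderiv_eq
    filter_upwards [hG.mem_nhds hy] with z hz
    rw [hG.fderiv_eq_christoffel hz, hG.symm z hz w, christoffelCLM_apply]
    ring
  have hGd := hG.differentiableAt hy
  rw [← e1, e2, fderiv_const_mul (by fun_prop), smul_apply,
    fderiv_apply_apply hGd hΓ (differentiableAt_const w), hG.fderiv_eq_christoffel hy,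
    fderiv_apply_const₂ hd]
  simp only [christoffel_eq_christoffelCLM, smul_eq_mul, fderiv_fun_const, Pi.zero_apply,
    zero_apply, map_zero, map_add, add_apply]
  ring

/-- The curvature operator `R(u, v)` is skew-adjoint. -/
theorem coordCurvature_apply_self (hG : IsMetricOn G U) {y : E} (hy : y ∈ U) (u v w : E) :
    G y (coordCurvature G y u v w) w = 0 := by
  have h1 := hG.fderiv_fderiv_eq_christoffel hy u v w
  have h2 := hG.fderiv_fderiv_eq_christoffel hy v u w
  rw [(hG.contDiffAt y hy).symm_snd v u] at h2
  rw [hG.coordCurvature_eq hy]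
  have h3 := hG.symm y hy (christoffelCLM G y v w) (christoffelCLM G y u w)
  simp only [map_add, map_sub, add_apply, sub_apply]
    at h1 h2 ⊢
  linarith

/-- A parallel field of endomorphisms commutes with the curvature operators: differentiate the
equation `∇T = 0` once more and use the symmetry of the second derivative of `T`. -/
theorem coordCurvature_comm (hG : IsMetricOn G U) {T : E → E →L[ℝ] E} {y : E} (hy : y ∈ U)
    (hT : ∀ z ∈ U, ContDiffAt ℝ ∞ T z)
    (hpar : ∀ z ∈ U, ∀ u v, coordCovDerivEnd G T z u v = 0) (u v w : E) :
    coordCurvature G y u v (T y w) = T y (coordCurvature G y u v w) := by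
  have hd := hG.differentiableAt_christoffelCLM hy
  have hTd := (hT y hy).differentiableAt_infty
  have hT2 := (hT y hy).fderiv_infty.differentiableAt_infty
  have first : ∀ z ∈ U, ∀ a b, fderiv ℝ T z a b =
      T z (christoffelCLM G z a b) - christoffelCLM G z a (T z b) := by
    intro z hz a b
    have h := hpar z hz a b
    unfold coordCovDerivEnd at h
    simp only [christoffel_eq_christoffelCLM] at h
    rw [← sub_eq_zero, ← h]
    abel
  have second : ∀ a b, fderiv ℝ (fderiv ℝ T) y a b w =
      fderiv ℝ T y a (christoffelCLM G y b w) + T y (fderiv ℝ (christoffelCLM G) y a b w)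
      - fderiv ℝ (christoffelCLM G) y a b (T y w) - christoffelCLM G y b (fderiv ℝ T y a w) := by
    intro a b
    have hΓ : DifferentiableAt ℝ (fun z => christoffelCLM G z b w) y := by fun_prop
    have hTw : DifferentiableAt ℝ (fun z => T z w) y := by fun_prop
    have e1 : fderiv ℝ (fun z => fderiv ℝ T z b w) y a = fderiv ℝ (fderiv ℝ T) y a b w :=
      fderiv_apply_const₂ hT2 a b w
    have e2 : fderiv ℝ (fun z => fderiv ℝ T z b w) y a =
        fderiv ℝ (fun z => T z (christoffelCLM G z b w) - christoffelCLM G z b (T z w)) y a := by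
      congr 1
      apply Filter.EventuallyEq.fderiv_eq
      filter_upwards [hG.mem_nhds hy] with z hz using first z hz b w
    rw [← e1, e2, fderiv_fun_sub (by fun_prop) (by fun_prop), sub_apply,
      fderiv_apply_apply hd (differentiableAt_const b) hTw,
      (hTd.hasFDerivAt.clm_apply hΓ.hasFDerivAt).fderiv, fderiv_apply_const hTd]
    simp only [add_apply, ContinuousLinearMap.comp_apply,
      ContinuousLinearMap.flip_apply, fderiv_apply_const₂ hd, fderiv_fun_const, Pi.zero_apply,
      zero_apply, map_zero]
    abel
  have h1 := second u v
  have h2 := second v u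
  rw [(hT y hy).symm_snd v u, h1] at h2
  simp only [first y hy, map_sub] at h2
  rw [hG.coordCurvature_eq hy, hG.coordCurvature_eq hy, ← sub_eq_zero]
  rw [← sub_eq_zero] at h2
  rw [← neg_eq_zero, ← h2]
  simp only [map_sub, map_add]
  abel

end IsMetricOn

end Levi

/-! ### Maps into a coordinate domain and the Gauss equation -/

section Along

variable {E : Type*} [NormedAddCommGroup E] [NormedSpace ℝ E]
  {X : Type*} [NormedAddCommGroup X] [NormedSpace ℝ X]

/-- `P` is a smooth map from the open set `V` to the coordinate domain `U`. -/
structure IsSmoothMapOn (P : X → E) (V : Set X) (U : Set E) : Prop where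
  isOpen : IsOpen V
  contDiffAt : ∀ y ∈ V, ContDiffAt ℝ ∞ P y
  mapsTo : MapsTo P V U

/-- The covariant derivative `∇_u (dP v)`, along the map `P` into a domain with metric `G`, of the
image under `dP` of the constant field `v`. -/
def covDerivAlong (G : E → E →L[ℝ] E →L[ℝ] ℝ) (P : X → E) (y u v : X) : E :=
  fderiv ℝ (fderiv ℝ P) y u v + christoffelCLM G (P y) (fderiv ℝ P y u) (fderiv ℝ P y v)

/-- The second fundamental form of the isometric immersion `P` in coordinates, where `W` is the
induced metric. -/
def coordSecondFundForm (W : X → X →L[ℝ] X →L[ℝ] ℝ) (G : E → E →L[ℝ] E →L[ℝ] ℝ) (P : X → E)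
    (y u v : X) : E :=
  covDerivAlong G P y u v - fderiv ℝ P y (christoffel W y u v)

namespace IsSmoothMapOn

variable {G : E → E →L[ℝ] E →L[ℝ] ℝ} {W : X → X →L[ℝ] X →L[ℝ] ℝ} {P : X → E} {V : Set X}
  {U : Set E}

theorem mem_nhds (hP : IsSmoothMapOn P V U) {y : X} (hy : y ∈ V) : V ∈ 𝓝 y :=
  hP.isOpen.mem_nhds hy

theorem covDerivAlong_symm (hP : IsSmoothMapOn P V U) (hG : IsMetricOn G U) {y : X} (hy : y ∈ V)
    (u v : X) : covDerivAlong G P y u v = covDerivAlong G P y v u := by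
  unfold covDerivAlong
  rw [(hP.contDiffAt y hy).symm_snd u v, hG.christoffelCLM_symm (hP.mapsTo hy)]

theorem differentiableAt_fderiv (hP : IsSmoothMapOn P V U) {y : X} (hy : y ∈ V) (v : X) :
    DifferentiableAt ℝ (fun z => fderiv ℝ P z v) y := by
  have := (hP.contDiffAt y hy).fderiv_infty.differentiableAt_infty
  fun_prop

theorem fderiv_fderiv_const (hP : IsSmoothMapOn P V U) {y : X} (hy : y ∈ V) (u v : X) :
    fderiv ℝ (fun z => fderiv ℝ P z v) y u = fderiv ℝ (fderiv ℝ P) y u v :=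
  fderiv_apply_const (hP.contDiffAt y hy).fderiv_infty.differentiableAt_infty u v

variable [FiniteDimensional ℝ E]

/-- The connection along `P` is metric. -/
theorem fderiv_inner (hP : IsSmoothMapOn P V U) (hG : IsMetricOn G U) {y : X} (hy : y ∈ V)
    {A B : X → E} (hA : DifferentiableAt ℝ A y) (hB : DifferentiableAt ℝ B y) (u : X) :
    fderiv ℝ (fun z => G (P z) (A z) (B z)) y u =
      G (P y) (fderiv ℝ A y u + christoffelCLM G (P y) (fderiv ℝ P y u) (A y)) (B y) +
      G (P y) (A y) (fderiv ℝ B y u + christoffelCLM G (P y) (fderiv ℝ P y u) (B y)) := by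
  have hPd := (hP.contDiffAt y hy).differentiableAt_infty
  have hGd := hG.differentiableAt (hP.mapsTo hy)
  have hGP : HasFDerivAt (fun z => G (P z)) ((fderiv ℝ G (P y)).comp (fderiv ℝ P y)) y :=
    hGd.hasFDerivAt.comp y hPd.hasFDerivAt
  rw [fderiv_apply_apply hGP.differentiableAt hA hB, hGP.fderiv, ContinuousLinearMap.comp_apply,
    hG.fderiv_eq_christoffel (hP.mapsTo hy)]
  simp only [christoffelCLM_apply, map_add, add_apply]
  ring

theorem hasFDerivAt_christoffelCLM_comp (hP : IsSmoothMapOn P V U) (hG : IsMetricOn G U) {y : X}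
    (hy : y ∈ V) : HasFDerivAt (fun z => christoffelCLM G (P z))
      ((fderiv ℝ (christoffelCLM G) (P y)).comp (fderiv ℝ P y)) y :=
  (hG.differentiableAt_christoffelCLM (hP.mapsTo hy)).hasFDerivAt.comp y
    (hP.contDiffAt y hy).differentiableAt_infty.hasFDerivAt

theorem differentiableAt_covDerivAlong (hP : IsSmoothMapOn P V U) (hG : IsMetricOn G U) {y : X}
    (hy : y ∈ V) (v w : X) : DifferentiableAt ℝ (fun z => covDerivAlong G P z v w) y := by
  have h3 := (hP.contDiffAt y hy).fderiv_infty.fderiv_infty.differentiableAt_infty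
  have h4 := (hP.hasFDerivAt_christoffelCLM_comp hG hy).differentiableAt
  have h5 := hP.differentiableAt_fderiv hy v
  have h6 := hP.differentiableAt_fderiv hy w
  unfold covDerivAlong
  exact DifferentiableAt.add (by fun_prop) ((h4.clm_apply h5).clm_apply h6)

/-- The commutator of covariant derivatives along `P` is the curvature of the target. -/
theorem covDerivAlong_comm (hP : IsSmoothMapOn P V U) (hG : IsMetricOn G U) {y : X}
    (hy : y ∈ V) (u v w : X) :
    (fderiv ℝ (fun z => covDerivAlong G P z v w) y u
        + christoffelCLM G (P y) (fderiv ℝ P y u) (covDerivAlong G P y v w))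
      - (fderiv ℝ (fun z => covDerivAlong G P z u w) y v
        + christoffelCLM G (P y) (fderiv ℝ P y v) (covDerivAlong G P y u w)) =
    coordCurvature G (P y) (fderiv ℝ P y u) (fderiv ℝ P y v) (fderiv ℝ P y w) := by
  have h2 := (hP.contDiffAt y hy).fderiv_infty
  have h3 := h2.fderiv_infty.differentiableAt_infty
  have h4 := hP.hasFDerivAt_christoffelCLM_comp hG hy
  have key : ∀ a b, fderiv ℝ (fun z => covDerivAlong G P z b w) y a =
      fderiv ℝ (fderiv ℝ (fderiv ℝ P)) y a b w
      + (fderiv ℝ (christoffelCLM G) (P y) (fderiv ℝ P y a) (fderiv ℝ P y b) (fderiv ℝ P y w)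
      + christoffelCLM G (P y) (fderiv ℝ (fderiv ℝ P) y a b) (fderiv ℝ P y w)
      + christoffelCLM G (P y) (fderiv ℝ P y b) (fderiv ℝ (fderiv ℝ P) y a w)) := by
    intro a b
    have h5 := hP.differentiableAt_fderiv hy b
    have h6 := hP.differentiableAt_fderiv hy w
    unfold covDerivAlong
    rw [fderiv_fun_add (by fun_prop) ((h4.differentiableAt.clm_apply h5).clm_apply h6),
      add_apply, fderiv_apply_const₂ h3, fderiv_apply_apply h4.differentiableAt h5 h6, h4.fderiv,
      hP.fderiv_fderiv_const hy, hP.fderiv_fderiv_const hy]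
    rfl
  rw [key, key, hG.coordCurvature_eq (hP.mapsTo hy), h2.symm_snd u v,
    (hP.contDiffAt y hy).symm_snd u v]
  simp only [covDerivAlong, map_add]
  abel

variable [FiniteDimensional ℝ X]

/-- The tangential part of `∇_u (dP v)` is given by the connection of the induced metric. -/
theorem covDerivAlong_inner (hP : IsSmoothMapOn P V U) (hG : IsMetricOn G U) (hW : IsMetricOn W V)
    (hiso : ∀ z ∈ V, ∀ u v, G (P z) (fderiv ℝ P z u) (fderiv ℝ P z v) = W z u v)
    {y : X} (hy : y ∈ V) (u v w : X) :
    G (P y) (covDerivAlong G P y u v) (fderiv ℝ P y w) = W y (christoffel W y u v) w := by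
  have key : ∀ a b c, fderiv ℝ W y a b c =
      G (P y) (covDerivAlong G P y a b) (fderiv ℝ P y c)
      + G (P y) (covDerivAlong G P y a c) (fderiv ℝ P y b) := by
    intro a b c
    rw [← fderiv_apply_const₂ (hW.differentiableAt hy)]
    have e : fderiv ℝ (fun z => W z b c) y
        = fderiv ℝ (fun z => G (P z) (fderiv ℝ P z b) (fderiv ℝ P z c)) y := by
      apply Filter.EventuallyEq.fderiv_eq
      filter_upwards [hP.mem_nhds hy] with z hz using (hiso z hz b c).symm
    rw [e, hP.fderiv_inner hG hy (hP.differentiableAt_fderiv hy b)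
      (hP.differentiableAt_fderiv hy c), hP.fderiv_fderiv_const hy, hP.fderiv_fderiv_const hy]
    rw [hG.symm _ (hP.mapsTo hy) (fderiv ℝ P y b)]
    rfl
  rw [hW.christoffel_spec hy, key, key, key, hP.covDerivAlong_symm hG hy v u,
    hP.covDerivAlong_symm hG hy w u, hP.covDerivAlong_symm hG hy w v]
  ring

/-- The second fundamental form takes values in the normal space. -/
theorem coordSecondFundForm_normal (hP : IsSmoothMapOn P V U) (hG : IsMetricOn G U)
    (hW : IsMetricOn W V)
    (hiso : ∀ z ∈ V, ∀ u v, G (P z) (fderiv ℝ P z u) (fderiv ℝ P z v) = W z u v)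
    {y : X} (hy : y ∈ V) (u v w : X) :
    G (P y) (coordSecondFundForm W G P y u v) (fderiv ℝ P y w) = 0 := by
  unfold coordSecondFundForm
  rw [map_sub, sub_apply, hP.covDerivAlong_inner hG hW hiso hy, hiso y hy, sub_self]

/-- The splitting of `∇_u (dP v)` into its normal and tangential parts is orthogonal. -/
theorem covDerivAlong_inner_covDerivAlong (hP : IsSmoothMapOn P V U) (hG : IsMetricOn G U)
    (hW : IsMetricOn W V)
    (hiso : ∀ z ∈ V, ∀ u v, G (P z) (fderiv ℝ P z u) (fderiv ℝ P z v) = W z u v)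
    {y : X} (hy : y ∈ V) (u v u' v' : X) :
    G (P y) (covDerivAlong G P y u v) (covDerivAlong G P y u' v') =
      G (P y) (coordSecondFundForm W G P y u v) (coordSecondFundForm W G P y u' v')
      + W y (christoffel W y u v) (christoffel W y u' v') := by
  have h1 := hP.coordSecondFundForm_normal hG hW hiso hy u v (christoffel W y u' v')
  have h2 := hP.coordSecondFundForm_normal hG hW hiso hy u' v' (christoffel W y u v)
  rw [hG.symm _ (hP.mapsTo hy)] at h2
  have e : ∀ a b, covDerivAlong G P y a b =
      coordSecondFundForm W G P y a b + fderiv ℝ P y (christoffel W y a b) := by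
    intro a b
    simp [coordSecondFundForm]
  rw [e u v, e u' v']
  simp only [map_add, add_apply, h1, h2, hiso y hy]
  ring

/-- A form of the Gauss equation in which the curvature of the induced metric `W` is expressed by
derivatives of its Christoffel symbols of the first kind. It is obtained by differentiating
`covDerivAlong_inner`. -/
theorem gauss_equation (hP : IsSmoothMapOn P V U) (hG : IsMetricOn G U) (hW : IsMetricOn W V)
    (hiso : ∀ z ∈ V, ∀ u v, G (P z) (fderiv ℝ P z u) (fderiv ℝ P z v) = W z u v)
    {y : X} (hy : y ∈ V) (u v : X) :
    G (P y) (coordCurvature G (P y) (fderiv ℝ P y u) (fderiv ℝ P y v) (fderiv ℝ P y v))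
        (fderiv ℝ P y u) =
      fderiv ℝ (fun z => W z (christoffel W z v v) u) y u
      - fderiv ℝ (fun z => W z (christoffel W z u v) u) y v
      - G (P y) (covDerivAlong G P y v v) (covDerivAlong G P y u u)
      + G (P y) (covDerivAlong G P y u v) (covDerivAlong G P y u v) := by
  have key : ∀ a b c, fderiv ℝ (fun z => W z (christoffel W z b v) c) y a =
      G (P y) (fderiv ℝ (fun z => covDerivAlong G P z b v) y a
        + christoffelCLM G (P y) (fderiv ℝ P y a) (covDerivAlong G P y b v)) (fderiv ℝ P y c)
      + G (P y) (covDerivAlong G P y b v) (covDerivAlong G P y a c) := by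
    intro a b c
    have e : fderiv ℝ (fun z => W z (christoffel W z b v) c) y =
        fderiv ℝ (fun z => G (P z) (covDerivAlong G P z b v) (fderiv ℝ P z c)) y := by
      apply Filter.EventuallyEq.fderiv_eq
      filter_upwards [hP.mem_nhds hy] with z hz
        using (hP.covDerivAlong_inner hG hW hiso hz b v c).symm
    rw [e, hP.fderiv_inner hG hy (hP.differentiableAt_covDerivAlong hG hy b v)
      (hP.differentiableAt_fderiv hy c), hP.fderiv_fderiv_const hy]
    rfl
  rw [key, key, ← hP.covDerivAlong_comm hG hy, hP.covDerivAlong_symm hG hy v u]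
  simp only [map_sub, sub_apply]
  ring

end IsSmoothMapOn

end Along

/-! ### Warped products in coordinates -/

section WarpedCoordinates

variable {X₁ : Type*} [NormedAddCommGroup X₁] [NormedSpace ℝ X₁]
  {X₂ : Type*} [NormedAddCommGroup X₂] [NormedSpace ℝ X₂]

/-- The warped product metric `G₁ + exp (2 ψ) G₂` on a product of coordinate domains; the warping
function is `exp ψ`. -/
def warpedCoord (G₁ : X₁ → X₁ →L[ℝ] X₁ →L[ℝ] ℝ) (G₂ : X₂ → X₂ →L[ℝ] X₂ →L[ℝ] ℝ) (ψ : X₁ → ℝ) :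
    X₁ × X₂ → X₁ × X₂ →L[ℝ] X₁ × X₂ →L[ℝ] ℝ := fun y =>
  (G₁ y.1).bilinearComp (ContinuousLinearMap.fst ℝ X₁ X₂) (ContinuousLinearMap.fst ℝ X₁ X₂)
    + Real.exp (2 * ψ y.1) •
      (G₂ y.2).bilinearComp (ContinuousLinearMap.snd ℝ X₁ X₂) (ContinuousLinearMap.snd ℝ X₁ X₂)

variable {G₁ : X₁ → X₁ →L[ℝ] X₁ →L[ℝ] ℝ} {G₂ : X₂ → X₂ →L[ℝ] X₂ →L[ℝ] ℝ} {ψ : X₁ → ℝ}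
  {V₁ : Set X₁} {V₂ : Set X₂}

theorem warpedCoord_apply (y u v : X₁ × X₂) :
    warpedCoord G₁ G₂ ψ y u v = G₁ y.1 u.1 v.1 + Real.exp (2 * ψ y.1) * G₂ y.2 u.2 v.2 := by
  simp [warpedCoord]

theorem hasFDerivAt_exp_two_mul {a : X₁} (hψ : DifferentiableAt ℝ ψ a) :
    HasFDerivAt (fun z => Real.exp (2 * ψ z)) (Real.exp (2 * ψ a) • ((2 : ℝ) • fderiv ℝ ψ a)) a :=
  (hψ.hasFDerivAt.const_mul 2).exp

variable [FiniteDimensional ℝ X₁] [FiniteDimensional ℝ X₂]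

theorem isMetricOn_warpedCoord (h₁ : IsMetricOn G₁ V₁) (h₂ : IsMetricOn G₂ V₂)
    (hψ : ∀ a ∈ V₁, ContDiffAt ℝ ∞ ψ a) :
    IsMetricOn (warpedCoord G₁ G₂ ψ) (V₁ ×ˢ V₂) where
  isOpen := h₁.isOpen.prod h₂.isOpen
  contDiffAt := by
    have hopen : IsOpen (V₁ ×ˢ V₂) := h₁.isOpen.prod h₂.isOpen
    have : ContDiffOn ℝ ∞ (warpedCoord G₁ G₂ ψ) (V₁ ×ˢ V₂) := by
      rw [contDiffOn_clm_apply]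
      intro u
      rw [contDiffOn_clm_apply]
      intro v y hy
      apply ContDiffAt.contDiffWithinAt
      simp only [warpedCoord_apply]
      have c₁ : ContDiffAt ℝ ∞ (fun z : X₁ × X₂ => G₁ z.1) y :=
        (h₁.contDiffAt y.1 hy.1).comp y contDiffAt_fst
      have c₂ : ContDiffAt ℝ ∞ (fun z : X₁ × X₂ => G₂ z.2) y :=
        (h₂.contDiffAt y.2 hy.2).comp y contDiffAt_snd
      have c₃ : ContDiffAt ℝ ∞ (fun z : X₁ × X₂ => ψ z.1) y :=
        (hψ y.1 hy.1).comp y contDiffAt_fst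
      exact ((c₁.clm_apply contDiffAt_const).clm_apply contDiffAt_const).add
        ((contDiffAt_const.mul c₃).exp.mul
          ((c₂.clm_apply contDiffAt_const).clm_apply contDiffAt_const))
    exact fun y hy => this.contDiffAt (hopen.mem_nhds hy)
  symm := by
    intro y hy u v
    rw [warpedCoord_apply, warpedCoord_apply, h₁.symm _ hy.1, h₂.symm _ hy.2]
  pos := by
    intro y hy u hu
    rw [warpedCoord_apply]
    have e := Real.exp_pos (2 * ψ y.1)
    have nn₁ : 0 ≤ G₁ y.1 u.1 u.1 := by
      by_cases h : u.1 = 0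
      · simp [h]
      · exact (h₁.pos _ hy.1 _ h).le
    by_cases h : u.2 = 0
    · have h' : u.1 ≠ 0 := fun h' => hu (Prod.ext h' h)
      have := h₁.pos _ hy.1 _ h'
      simpa [h] using this
    · have := h₂.pos _ hy.2 _ h
      positivity

theorem fderiv_warpedCoord (h₁ : IsMetricOn G₁ V₁) (h₂ : IsMetricOn G₂ V₂)
    (hψ : ∀ a ∈ V₁, ContDiffAt ℝ ∞ ψ a) {y : X₁ × X₂} (hy : y ∈ V₁ ×ˢ V₂) (u v w : X₁ × X₂) :
    fderiv ℝ (warpedCoord G₁ G₂ ψ) y u v w =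
      fderiv ℝ G₁ y.1 u.1 v.1 w.1 + Real.exp (2 * ψ y.1) *
        (2 * fderiv ℝ ψ y.1 u.1 * G₂ y.2 v.2 w.2 + fderiv ℝ G₂ y.2 u.2 v.2 w.2) := by
  have hW := isMetricOn_warpedCoord h₁ h₂ hψ
  rw [← fderiv_apply_const₂ (hW.differentiableAt hy)]
  simp only [warpedCoord_apply]
  have d₁ : HasFDerivAt (fun z : X₁ × X₂ => G₁ z.1 v.1 w.1) _ y :=
    (((h₁.differentiableAt hy.1).hasFDerivAt.clm_apply
      (hasFDerivAt_const v.1 y.1)).clm_apply (hasFDerivAt_const w.1 y.1)).comp y hasFDerivAt_fst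
  have d₂ : HasFDerivAt (fun z : X₁ × X₂ => G₂ z.2 v.2 w.2) _ y :=
    (((h₂.differentiableAt hy.2).hasFDerivAt.clm_apply
      (hasFDerivAt_const v.2 y.2)).clm_apply (hasFDerivAt_const w.2 y.2)).comp y hasFDerivAt_snd
  have d₃ : HasFDerivAt (fun z : X₁ × X₂ => Real.exp (2 * ψ z.1)) _ y :=
    (hasFDerivAt_exp_two_mul (hψ y.1 hy.1).differentiableAt_infty).comp y hasFDerivAt_fst
  rw [(d₁.fun_add (d₃.fun_mul d₂)).fderiv]
  simp
  ring

/-- The Levi-Civita connection of a warped product on pairs of vectors. -/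
theorem christoffel_warpedCoord (h₁ : IsMetricOn G₁ V₁) (h₂ : IsMetricOn G₂ V₂)
    (hψ : ∀ a ∈ V₁, ContDiffAt ℝ ∞ ψ a) {y : X₁ × X₂} (hy : y ∈ V₁ ×ˢ V₂) (u v : X₁ × X₂) :
    christoffel (warpedCoord G₁ G₂ ψ) y u v =
      (christoffel G₁ y.1 u.1 v.1
        - (Real.exp (2 * ψ y.1) * G₂ y.2 u.2 v.2) • (G₁ y.1).inverse (fderiv ℝ ψ y.1),
      christoffel G₂ y.2 u.2 v.2 + fderiv ℝ ψ y.1 u.1 • v.2 + fderiv ℝ ψ y.1 v.1 • u.2) := by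
  have hW := isMetricOn_warpedCoord h₁ h₂ hψ
  refine ext_of_pos (hW.pos y hy) fun w => ?_
  rw [hW.christoffel_spec hy, warpedCoord_apply]
  simp only [fderiv_warpedCoord h₁ h₂ hψ hy, map_add, map_sub, map_smul, add_apply, sub_apply,
    smul_apply, smul_eq_mul, h₁.christoffel_spec hy.1, h₂.christoffel_spec hy.2,
    apply_inverse_of_pos (h₁.pos _ hy.1)]
  ring

variable {E : Type*} [NormedAddCommGroup E] [NormedSpace ℝ E] [FiniteDimensional ℝ E]
  {G : E → E →L[ℝ] E →L[ℝ] ℝ} {P : X₁ × X₂ → E} {V : Set (X₁ × X₂)} {U : Set E}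

theorem IsMetricOn.mono {X : Type*} [NormedAddCommGroup X] [NormedSpace ℝ X]
    {G : X → X →L[ℝ] X →L[ℝ] ℝ} {U V : Set X} (hG : IsMetricOn G U) (hV : IsOpen V) (h : V ⊆ U) :
    IsMetricOn G V :=
  ⟨hV, fun y hy => hG.contDiffAt y (h hy), fun y hy => hG.symm y (h hy),
    fun y hy => hG.pos y (h hy)⟩

/-- The Gauss equation for a warped product, on a vector tangent to the first factor and a vector
tangent to the second. The last term is the curvature of the warped product, that is
`- Hess f (u, u) / f` for a unit vector `v`, where `f = exp ψ`. -/
theorem gauss_equation_warpedCoord (h₁ : IsMetricOn G₁ V₁) (h₂ : IsMetricOn G₂ V₂)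
    (hψ : ∀ a ∈ V₁, ContDiffAt ℝ ∞ ψ a) (hG : IsMetricOn G U) (hP : IsSmoothMapOn P V U)
    (hV : V ⊆ V₁ ×ˢ V₂)
    (hiso : ∀ z ∈ V, ∀ u v, G (P z) (fderiv ℝ P z u) (fderiv ℝ P z v) =
      warpedCoord G₁ G₂ ψ z u v)
    {y : X₁ × X₂} (hy : y ∈ V) (u : X₁) (v : X₂) :
    G (P y) (coordCurvature G (P y) (fderiv ℝ P y (u, 0)) (fderiv ℝ P y (0, v))
        (fderiv ℝ P y (0, v))) (fderiv ℝ P y (u, 0)) =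
      G (P y) (coordSecondFundForm (warpedCoord G₁ G₂ ψ) G P y (u, 0) (0, v))
          (coordSecondFundForm (warpedCoord G₁ G₂ ψ) G P y (u, 0) (0, v))
      - G (P y) (coordSecondFundForm (warpedCoord G₁ G₂ ψ) G P y (0, v) (0, v))
          (coordSecondFundForm (warpedCoord G₁ G₂ ψ) G P y (u, 0) (u, 0))
      - Real.exp (2 * ψ y.1) * G₂ y.2 v v * (fderiv ℝ ψ y.1 u ^ 2
        - (fderiv ℝ ψ y.1 (christoffel G₁ y.1 u u) - fderiv ℝ (fderiv ℝ ψ) y.1 u u)) := by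
  have hW₀ := isMetricOn_warpedCoord h₁ h₂ hψ
  have hW := hW₀.mono hP.isOpen hV
  rw [hP.gauss_equation hG hW hiso hy, hP.covDerivAlong_inner_covDerivAlong hG hW hiso hy,
    hP.covDerivAlong_inner_covDerivAlong hG hW hiso hy]
  have hy₁ : y.1 ∈ V₁ := (hV hy).1
  have hy₂ : y.2 ∈ V₂ := (hV hy).2
  -- `g(∇_v v, u) = - exp (2 ψ) G₂(v, v) Dψ(u)` and `g(∇_u v, u) = 0` near `y`
  have e₁ : fderiv ℝ (fun z => warpedCoord G₁ G₂ ψ z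
      (christoffel (warpedCoord G₁ G₂ ψ) z (0, v) (0, v)) (u, 0)) y (u, 0) =
      - (Real.exp (2 * ψ y.1) * G₂ y.2 v v * (2 * fderiv ℝ ψ y.1 u ^ 2
        + fderiv ℝ (fderiv ℝ ψ) y.1 u u)) := by
    have e : fderiv ℝ (fun z => warpedCoord G₁ G₂ ψ z
        (christoffel (warpedCoord G₁ G₂ ψ) z (0, v) (0, v)) (u, 0)) y =
        fderiv ℝ (fun z : X₁ × X₂ =>
          -(Real.exp (2 * ψ z.1) * G₂ z.2 v v * fderiv ℝ ψ z.1 u)) y := by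
      apply Filter.EventuallyEq.fderiv_eq
      filter_upwards [hP.mem_nhds hy] with z hz
      rw [hW.christoffel_spec hz]
      simp only [fderiv_warpedCoord h₁ h₂ hψ (hV hz)]
      simp
      ring
    have dψ := (hψ y.1 hy₁).differentiableAt_infty
    have d₂ : HasFDerivAt (fun z : X₁ × X₂ => G₂ z.2 v v) _ y :=
      (((h₂.differentiableAt hy₂).hasFDerivAt.clm_apply
        (hasFDerivAt_const v y.2)).clm_apply (hasFDerivAt_const v y.2)).comp y hasFDerivAt_snd
    have d₃ : HasFDerivAt (fun z : X₁ × X₂ => Real.exp (2 * ψ z.1)) _ y :=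
      (hasFDerivAt_exp_two_mul dψ).comp y hasFDerivAt_fst
    have d₄ : HasFDerivAt (fun z : X₁ × X₂ => fderiv ℝ ψ z.1 u) _ y :=
      ((hψ y.1 hy₁).fderiv_infty.differentiableAt_infty.hasFDerivAt.clm_apply
        (hasFDerivAt_const u y.1)).comp y hasFDerivAt_fst
    rw [e, ((d₃.fun_mul d₂).fun_mul d₄).fun_neg.fderiv]
    simp
    ring
  have e₂ : fderiv ℝ (fun z => warpedCoord G₁ G₂ ψ z
      (christoffel (warpedCoord G₁ G₂ ψ) z (u, 0) (0, v)) (u, 0)) y (0, v) = 0 := by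
    have e : fderiv ℝ (fun z => warpedCoord G₁ G₂ ψ z
        (christoffel (warpedCoord G₁ G₂ ψ) z (u, 0) (0, v)) (u, 0)) y =
        fderiv ℝ (fun _ : X₁ × X₂ => (0 : ℝ)) y := by
      apply Filter.EventuallyEq.fderiv_eq
      filter_upwards [hP.mem_nhds hy] with z hz
      rw [hW.christoffel_spec hz]
      simp only [fderiv_warpedCoord h₁ h₂ hψ (hV hz)]
      simp
    rw [e]
    simp
  rw [e₁, e₂]
  simp only [christoffel_warpedCoord h₁ h₂ hψ (hV hy), warpedCoord_apply]
  have z₁ : ∀ a b, christoffel G₁ a 0 b = 0 := fun a b => by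
    simp [christoffel_eq_christoffelCLM]
  have z₂ : ∀ a b, christoffel G₂ a 0 b = 0 := fun a b => by
    simp [christoffel_eq_christoffelCLM]
  have z₃ : ∀ a b, christoffel G₁ a b 0 = 0 := fun a b => by
    simp [christoffel_eq_christoffelCLM]
  simp [z₁, z₂, z₃, apply_inverse_of_pos (h₁.pos _ hy₁)]
  ring

end WarpedCoordinates

/-! ### Algebraic curvature forms -/

section Algebra

variable {V : Type*} [AddCommGroup V] [Module ℝ V]

/-- `R` has the algebraic symmetries of a Riemann curvature tensor with all indices lowered,
`R u v w z = g (R(u, v) w) z`. Linearity in the last three arguments follows. -/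
structure IsCurvatureForm (R : V → V → V → V → ℝ) : Prop where
  add_left : ∀ u u' v w z, R (u + u') v w z = R u v w z + R u' v w z
  smul_left : ∀ (t : ℝ) u v w z, R (t • u) v w z = t * R u v w z
  swap_left : ∀ u v w z, R u v w z = -R v u w z
  swap_right : ∀ u v w z, R u v w z = -R u v z w
  bianchi : ∀ u v w z, R u v w z + R v w u z + R w u v z = 0

namespace IsCurvatureForm

variable {R : V → V → V → V → ℝ}

theorem pair_symm (hR : IsCurvatureForm R) (u v w z : V) : R u v w z = R w z u v := by
  have b₁ := hR.bianchi u v w z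
  have b₂ := hR.bianchi v w z u
  have b₃ := hR.bianchi w z u v
  have b₄ := hR.bianchi z u v w
  have a₁ := hR.swap_right u v w z
  have a₂ := hR.swap_right v w u z
  have a₃ := hR.swap_right w u v z
  have a₃' := hR.swap_left w u z v
  have a₄ := hR.swap_right w z u v
  have a₅ := hR.swap_right z v w u
  have a₅' := hR.swap_left z v u w
  have a₆ := hR.swap_right z u v w
  have a₇ := hR.swap_left u w z v
  linarith

theorem add_two (hR : IsCurvatureForm R) (u v v' w z : V) :
    R u (v + v') w z = R u v w z + R u v' w z := by
  rw [hR.swap_left, hR.add_left, hR.swap_left u v, hR.swap_left u v']; ring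

theorem add_three (hR : IsCurvatureForm R) (u v w w' z : V) :
    R u v (w + w') z = R u v w z + R u v w' z := by
  rw [hR.pair_symm, hR.add_left, hR.pair_symm u v w, hR.pair_symm u v w']

theorem add_four (hR : IsCurvatureForm R) (u v w z z' : V) :
    R u v w (z + z') = R u v w z + R u v w z' := by
  rw [hR.pair_symm, hR.add_two, hR.pair_symm u v w z, hR.pair_symm u v w z']

theorem smul_four (hR : IsCurvatureForm R) (t : ℝ) (u v w z : V) :
    R u v w (t • z) = t * R u v w z := by
  rw [hR.pair_symm, hR.swap_left, hR.smul_left, hR.swap_left z, hR.pair_symm w z]; ring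

theorem neg_left (hR : IsCurvatureForm R) (u v w z : V) : R (-u) v w z = -R u v w z := by
  rw [← neg_one_smul ℝ u, hR.smul_left]; ring

theorem neg_two (hR : IsCurvatureForm R) (u v w z : V) : R u (-v) w z = -R u v w z := by
  rw [hR.swap_left, hR.neg_left, hR.swap_left u v]

theorem neg_three (hR : IsCurvatureForm R) (u v w z : V) : R u v (-w) z = -R u v w z := by
  rw [hR.pair_symm, hR.neg_left, hR.pair_symm u v]

theorem neg_four (hR : IsCurvatureForm R) (u v w z : V) : R u v w (-z) = -R u v w z := by
  rw [hR.pair_symm, hR.neg_two, hR.pair_symm u v w z]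

/-- Polarization of the biquadratic form `R u u' u' u`: summing over both signs of `(v, v')` keeps
the terms of even degree in `(v, v')`. -/
theorem polarization (hR : IsCurvatureForm R) (u u' v v' : V) :
    R (u + v) (u' + v') (u' + v') (u + v) + R (u + -v) (u' + -v') (u' + -v') (u + -v) =
      2 * R u u' u' u + 2 * R v v' v' v
      + 2 * (R v v' u' u + R v u' v' u + R v u' u' v + R u v' v' u + R u v' u' v
        + R u u' v' v) := by
  simp only [hR.add_left, hR.add_two, hR.add_three, hR.add_four, hR.neg_left, hR.neg_two,
    hR.neg_three, hR.neg_four]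
  ring

/-- A curvature form that is invariant under `J` in one pair of arguments is determined on the
subspace where `J² = -1` by its values `R u (J u) (J u) u`. The identity combines the polarizations
of these values at `(u, v)` and at `(u, J v)`. -/
theorem eq_of_invariant (hR : IsCurvatureForm R) {J : V → V} (hadd : ∀ u v, J (u + v) = J u + J v)
    (hneg : ∀ u, J (-u) = -J u)
    (hJ : ∀ u v w z, R u v (J w) (J z) = R u v w z) {u v : V} (hu : J (J u) = -u)
    (hv : J (J v) = -v) :
    32 * R u v v u =
      3 * R (u + J v) (J (u + J v)) (J (u + J v)) (u + J v)
      + 3 * R (u + -J v) (J (u + -J v)) (J (u + -J v)) (u + -J v)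
      - R (u + v) (J (u + v)) (J (u + v)) (u + v)
      - R (u + -v) (J (u + -v)) (J (u + -v)) (u + -v)
      - 4 * R u (J u) (J u) u - 4 * R v (J v) (J v) v := by
  have hJ' : ∀ a b w z, R (J a) (J b) w z = R a b w z := fun a b w z => by
    rw [hR.pair_symm, hJ, hR.pair_symm w z]
  have p₁ := hR.polarization u (J u) v (J v)
  have p₂ := hR.polarization u (J u) (J v) (-v)
  simp only [hadd, hneg, hv]
  -- the mixed terms reduce to `R u v v u`, `R u (J v) (J v) u` and `R u (J u) (J v) v`
  have e₁ : R v (J v) (J u) u = R u (J u) (J v) v := by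
    rw [hR.pair_symm, hR.swap_left, hR.swap_right u]; ring
  have e₂ : R v (J u) (J u) v = R u (J v) (J v) u := by
    rw [← hJ' v, ← hJ _ _ (J u) v, hu, hR.neg_two, hR.neg_three, hR.swap_left u (J v),
      hR.swap_right (J v) u (J v)]
  have e₃ : R v (J u) (J v) u = R u (J v) (J v) u := by
    rw [← hJ' v, hu, hR.neg_two, hR.swap_left]; ring
  have e₄ : R u (J v) (J u) v = R u (J v) (J v) u := by
    rw [← hJ _ _ (J u) v, hu, hR.neg_three, hR.swap_right]; ring
  have e₅ : R (J v) (-v) (J u) u = R u (J u) (J v) v := by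
    rw [hR.neg_two, hR.swap_left, e₁]; ring
  have e₆ : R (J v) (J u) (-v) u = R u v v u := by
    rw [hJ', hR.neg_three, hR.swap_left]; ring
  have e₇ : R (J v) (J u) (J u) (J v) = R u v v u := by
    rw [hJ', hJ, hR.swap_left, hR.swap_right]; ring
  have e₈ : R u (-v) (-v) u = R u v v u := by
    rw [hR.neg_two, hR.neg_three]; ring
  have e₉ : R u (-v) (J u) (J v) = R u v v u := by
    rw [hR.neg_two, hJ, hR.swap_right]; ring
  have e₁₀ : R u (J u) (-v) (J v) = R u (J u) (J v) v := by
    rw [hR.neg_three, hR.swap_right]; ring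
  have e₁₁ : R (J v) (-v) (-v) (J v) = R v (J v) (J v) v := by
    rw [hR.neg_two, hR.neg_three, hR.swap_left, hR.swap_right]; ring
  have e₁₂ : R u (J u) (J v) v = R u v v u + R u (J v) (J v) u := by
    have h := hR.bianchi u (J u) (J v) v
    rw [hJ', hR.swap_right u v u v, hR.swap_left (J v) u, e₄] at h
    linarith
  rw [e₁, e₂, e₃, e₄] at p₁
  rw [e₅, e₆, e₇, e₈, e₉, e₁₀, e₁₁] at p₂
  linarith

/-- The curvature of a cosymplectic space form, on a pair `u, v` with `v` orthogonal to `ξ`, `u`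
and `φ u`. -/
theorem eq_of_const_phi_sectional (hR : IsCurvatureForm R) {g : V →ₗ[ℝ] V →ₗ[ℝ] ℝ} {J : V →ₗ[ℝ] V}
    {ξ : V} {η : V →ₗ[ℝ] ℝ} {c : ℝ} (hg : ∀ u v, g u v = g v u)
    (hJJ : ∀ u, J (J u) = -u + η u • ξ) (hηξ : η ξ = 1) (hJξ : J ξ = 0) (hηJ : ∀ u, η (J u) = 0)
    (hgJ : ∀ u v, g (J u) (J v) = g u v - η u * η v)
    (hJ : ∀ u v w z, R u v (J w) (J z) = R u v w z) (hξ : ∀ u v z, R u v ξ z = 0)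
    (hc : ∀ u, η u = 0 → R u (J u) (J u) u = c * g u u ^ 2) {u v : V} (hv : η v = 0)
    (huv : g u v = 0) (hJuv : g (J u) v = 0) :
    R u v v u = c / 4 * ((g u u - η u ^ 2) * g v v) := by
  have hgξ : ∀ a, g a ξ = η a := by
    intro a
    have h := hgJ a ξ
    rw [hJξ, hηξ, map_zero] at h
    linarith
  -- the component `w` of `u` orthogonal to `ξ` has the same curvature, because `R(·, ·)ξ = 0`
  obtain ⟨w, hw⟩ : ∃ w, w = u + (-η u) • ξ := ⟨_, rfl⟩
  have hηw : η w = 0 := by rw [hw, map_add, map_smul, hηξ]; simp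
  have hJw : J w = J u := by rw [hw, map_add, map_smul, hJξ]; simp
  have hwv : g w v = 0 := by
    rw [hw, map_add, map_smul, LinearMap.add_apply, LinearMap.smul_apply, huv, hg, hgξ, hv]
    simp
  have hww : g w w = g u u - η u ^ 2 := by
    rw [hw]
    simp only [map_add, map_smul, LinearMap.add_apply, LinearMap.smul_apply, hgξ, hηξ, hg ξ u,
      smul_eq_mul]
    ring
  have hwJv : g w (J v) = 0 := by
    have h := hgJ w (J v)
    rw [hJJ v, hv, zero_smul, add_zero, map_neg, hJw, hJuv, hηw] at h
    linarith
  have hRw : R w v v w = R u v v u := by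
    have hl : ∀ a b d, R ξ a b d = 0 := fun a b d => by rw [hR.pair_symm, hξ]
    have hr : ∀ a b d, R a b d ξ = 0 := fun a b d => by rw [hR.swap_right, hξ]; simp
    rw [hw, hR.add_left, hR.add_four, hR.smul_left, hl, hR.smul_four, hr]
    ring
  have hJJw : J (J w) = -w := by rw [hJJ, hηw]; simp
  have hJJv : J (J v) = -v := by rw [hJJ, hv]; simp
  have hJvJv : g (J v) (J v) = g v v := by rw [hgJ, hv]; ring
  have key := hR.eq_of_invariant (J := J) (map_add J) (map_neg J) hJ hJJw hJJv
  rw [hc _ (by rw [map_add, hηw, hηJ]; simp), hc _ (by rw [map_add, map_neg, hηw, hηJ]; simp),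
    hc _ (by rw [map_add, hηw, hv]; simp), hc _ (by rw [map_add, map_neg, hηw, hv]; simp),
    hc _ hηw, hc _ hv] at key
  simp only [map_add, map_neg, LinearMap.add_apply, LinearMap.neg_apply, hg (J v) w, hg v w, hwv,
    hwJv, hJvJv] at key
  rw [hRw] at key
  rw [← hww]
  linarith

end IsCurvatureForm

end Algebra

/-! ### Metric traces and orthonormal bases -/

section Trace

variable {E : Type*} [NormedAddCommGroup E] [NormedSpace ℝ E] [FiniteDimensional ℝ E]
  {F : Type*} [AddCommGroup F] [Module ℝ F]

/-- The metric trace is computed by any orthonormal basis. -/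
theorem metricTrace_eq_sum {ι : Type*} [Fintype ι] [DecidableEq ι] (b : E →L[ℝ] E →L[ℝ] ℝ)
    (e : Basis ι ℝ E) (he : ∀ i j, b (e i) (e j) = if i = j then 1 else 0)
    (B : E →ₗ[ℝ] E →ₗ[ℝ] F) : metricTrace b (fun u v => B u v) = ∑ i, B (e i) (e i) := by
  classical
  set d := finBasis ℝ E
  -- `Q` is the change of basis, and orthonormality of `e` means `A = Q * Qᵀ` for the Gram matrix `A`
  set A : Matrix (Fin (finrank ℝ E)) (Fin (finrank ℝ E)) ℝ :=
    Matrix.of fun k l => b (d k) (d l) with hA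
  set Q : Matrix (Fin (finrank ℝ E)) ι ℝ := Matrix.of fun k i => e.repr (d k) i with hQ
  set Q' : Matrix ι (Fin (finrank ℝ E)) ℝ := Matrix.of fun i k => d.repr (e i) k with hQ'
  have hd : ∀ k, d k = ∑ i, Q k i • e i := fun k => (e.sum_repr (d k)).symm
  have he' : ∀ i, e i = ∑ k, Q' i k • d k := fun i => (d.sum_repr (e i)).symm
  have hAQ : A = Q * Q.transpose := by
    ext k l
    rw [hA, Matrix.of_apply, hd k, hd l]
    simp [map_sum, he, Matrix.mul_apply, mul_comm]
  have hQQ' : Q * Q' = 1 := by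
    ext k l
    have h : d k = ∑ l, (Q * Q') k l • d l := by
      conv_lhs => rw [hd k]
      simp only [he', Finset.smul_sum, smul_smul, Matrix.mul_apply, Finset.sum_smul]
      exact Finset.sum_comm
    have h2 := congrArg (fun x => d.repr x l) h
    simp only [map_sum, map_smul, Basis.repr_self, Finsupp.coe_finsetSum, Finset.sum_apply,
      Finsupp.smul_apply, smul_eq_mul, Finsupp.single_apply, mul_ite, mul_one, mul_zero,
      Finset.sum_ite_eq', Finset.mem_univ, if_true] at h2
    rw [← h2, Matrix.one_apply]
  have hinv : A⁻¹ = Q'.transpose * Q' := by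
    apply Matrix.inv_eq_left_inv
    have h3 : Q' * Q = 1 := by
      have hc : Fintype.card (Fin (finrank ℝ E)) = Fintype.card ι := by
        rw [Fintype.card_fin, finrank_eq_card_basis e]
      exact (Matrix.mul_eq_one_comm_of_card_eq _ _ _ hc).1 hQQ'
    rw [hAQ, Matrix.mul_assoc, ← Matrix.mul_assoc Q', h3, Matrix.one_mul, ← Matrix.transpose_mul,
      hQQ', Matrix.transpose_one]
  unfold metricTrace
  change ∑ i, ∑ j, A⁻¹ i j • B (d i) (d j) = _
  rw [hinv]
  have : ∀ a, B (e a) (e a) = ∑ i, ∑ j, (Q' a i * Q' a j) • B (d i) (d j) := by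
    intro a
    rw [he' a]
    simp only [map_sum, LinearMap.sum_apply, map_smul, LinearMap.smul_apply, smul_smul,
      Finset.smul_sum]
    rw [Finset.sum_comm]
    exact Finset.sum_congr rfl fun i _ => Finset.sum_congr rfl fun j _ => by rw [mul_comm]
  simp only [this, Matrix.mul_apply, Matrix.transpose_apply, Finset.sum_smul]
  conv_rhs => rw [Finset.sum_comm]
  exact Finset.sum_congr rfl fun i _ => Finset.sum_comm

theorem exists_orthonormal_basis {b : E →L[ℝ] E →L[ℝ] ℝ} (hs : ∀ u v, b u v = b v u)
    (hb : ∀ u, u ≠ 0 → 0 < b u u) :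
    ∃ e : Basis (Fin (finrank ℝ E)) ℝ E, ∀ i j, b (e i) (e j) = if i = j then 1 else 0 := by
  set B : LinearMap.BilinForm ℝ E := ContinuousLinearMap.coeLM ℝ ∘ₗ b.toLinearMap with hB
  have hB' : ∀ u v, B u v = b u v := fun _ _ => rfl
  obtain ⟨v, hv⟩ := LinearMap.BilinForm.exists_orthogonal_basis (B := B) ⟨fun u v => hs u v⟩
  have hpos : ∀ i, 0 < b (v i) (v i) := fun i => hb _ (v.ne_zero i)
  have hne : ∀ i, (Real.sqrt (b (v i) (v i)))⁻¹ ≠ 0 := fun i =>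
    inv_ne_zero (Real.sqrt_ne_zero'.2 (hpos i))
  refine ⟨v.isUnitSMul (fun i => (hne i).isUnit), fun i j => ?_⟩
  simp only [Basis.isUnitSMul_apply, map_smul, smul_apply, smul_eq_mul]
  split_ifs with h
  · subst h
    have h2 := Real.mul_self_sqrt (hpos i).le
    have h3 := Real.sqrt_ne_zero'.2 (hpos i)
    field_simp
    nlinarith
  · have h2 : b (v i) (v j) = 0 := hv h
    simp [h2]

end Trace

/-! ### Tensor fields in the preferred charts -/

section Charts

variable {E : Type*} [NormedAddCommGroup E] [NormedSpace ℝ E]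
  {H : Type*} [TopologicalSpace H] {I : ModelWithCorners ℝ E H}
  {M : Type*} [TopologicalSpace M] [ChartedSpace H M]

/-- The derivative of the inverse of the preferred chart at `p`, as an endomorphism of `E`. -/
def chartSymmDeriv (I : ModelWithCorners ℝ E H) {M : Type*} [TopologicalSpace M] [ChartedSpace H M]
    (p : M) (y : E) : E →L[ℝ] E := mfderiv 𝓘(ℝ, E) I (extChartAt I p).symm y

theorem chartMetric_apply (g : ∀ x : M, TangentSpace I x →L[ℝ] TangentSpace I x →L[ℝ] ℝ) (p : M)
    (y u v : E) : chartMetric I g p y u v =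
      g ((extChartAt I p).symm y) (chartSymmDeriv I p y u) (chartSymmDeriv I p y v) := rfl

theorem chartEnd_apply (T : ∀ x : M, TangentSpace I x →L[ℝ] TangentSpace I x) (p : M)
    (y u : E) : chartEnd I T p y u =
      mfderiv I 𝓘(ℝ, E) (extChartAt I p) ((extChartAt I p).symm y)
        (T ((extChartAt I p).symm y) (chartSymmDeriv I p y u)) := rfl

variable [IsManifold I ∞ M]

theorem chartMetric_symm
    (g : ContMDiffRiemannianMetric I ∞ E (fun x : M => TangentSpace I x)) (p : M) (y u v : E) :
    chartMetric I g.inner p y u v = chartMetric I g.inner p y v u := by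
  rw [chartMetric_apply, chartMetric_apply]
  exact g.symm ((extChartAt I p).symm y) (chartSymmDeriv I p y u) (chartSymmDeriv I p y v)

variable [I.Boundaryless]

theorem mdifferentiableAt_extChartAt_symm' {p : M} {y : E} (hy : y ∈ (extChartAt I p).target) :
    MDifferentiableAt 𝓘(ℝ, E) I (extChartAt I p).symm y := by
  have h := mdifferentiableWithinAt_extChartAt_symm (I := I) hy
  rwa [I.range_eq_univ, mdifferentiableWithinAt_univ] at h

theorem contMDiffAt_extChartAt_symm' {p : M} {y : E} (hy : y ∈ (extChartAt I p).target) :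
    ContMDiffAt 𝓘(ℝ, E) I ∞ (extChartAt I p).symm y :=
  ((contMDiffOn_extChartAt_symm p) y hy).contMDiffAt ((isOpen_extChartAt_target p).mem_nhds hy)

theorem injective_chartSymmDeriv {p : M} {y : E} (hy : y ∈ (extChartAt I p).target) :
    Function.Injective (chartSymmDeriv I p y) := by
  have h := mfderiv_extChartAt_comp_mfderivWithin_extChartAt_symm (I := I) hy
  rw [I.range_eq_univ, mfderivWithin_univ] at h
  intro u v huv
  have hu := congrArg (fun T : E →L[ℝ] E => T u) h
  have hv := congrArg (fun T : E →L[ℝ] E => T v) h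
  exact hu.symm.trans ((congrArg (mfderiv I 𝓘(ℝ, E) (extChartAt I p) ((extChartAt I p).symm y))
    huv).trans hv)

theorem chartSymmDeriv_self (p : M) :
    chartSymmDeriv I p (extChartAt I p p) = ContinuousLinearMap.id ℝ E := by
  have h := mfderivWithin_range_extChartAt_symm (I := I) (x := p)
  rw [I.range_eq_univ, mfderivWithin_univ] at h
  exact h

theorem contMDiffAt_chartSymmDeriv {p : M} {y : E} (hy : y ∈ (extChartAt I p).target) (u : E) :
    ContMDiffAt 𝓘(ℝ, E) (I.prod 𝓘(ℝ, E)) ∞ (fun z => TotalSpace.mk' E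
      (E := fun x : M => TangentSpace I x) ((extChartAt I p).symm z) (chartSymmDeriv I p z u)) y := by
  have hopen := isOpen_extChartAt_target (I := I) p
  have h := (contMDiffOn_extChartAt_symm (I := I) (n := ∞) p).contMDiffOn_tangentMapWithin
    (m := ∞) (by norm_num) hopen.uniqueMDiffOn
  have hs : ContMDiff 𝓘(ℝ, E) (𝓘(ℝ, E).prod 𝓘(ℝ, E)) ∞
      (fun z : E => (⟨z, u⟩ : TangentBundle 𝓘(ℝ, E) E)) :=
    contMDiff_vectorSpace_iff_contDiff.2 contDiff_const
  have h2 := h.comp (s := (extChartAt I p).target) hs.contMDiffOn (fun z hz => hz)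
  refine (h2.congr ?_).contMDiffAt (hopen.mem_nhds hy)
  intro z hz
  simp only [Function.comp, tangentMapWithin]
  rw [mfderivWithin_of_isOpen hopen hz]
  rfl

theorem chartMetric_self (g : ∀ x : M, TangentSpace I x →L[ℝ] TangentSpace I x →L[ℝ] ℝ) (p : M)
    (u v : E) : chartMetric I g p (extChartAt I p p) u v = g p u v := by
  rw [chartMetric_apply, chartSymmDeriv_self]
  have : ∀ q, q = p → (g q : E →L[ℝ] E →L[ℝ] ℝ) u v = g p u v := by rintro _ rfl; rfl
  exact this _ (extChartAt_to_inv p)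

theorem chartEnd_self (T : ∀ x : M, TangentSpace I x →L[ℝ] TangentSpace I x) (p : M)
    (u : E) : chartEnd I T p (extChartAt I p p) u = T p u := by
  rw [chartEnd_apply, chartSymmDeriv_self]
  have : ∀ q, q = p → (mfderiv I 𝓘(ℝ, E) (extChartAt I p) q : E →L[ℝ] E) ((T q : E →L[ℝ] E) u)
      = T p u := by
    rintro _ rfl
    rw [mfderiv_extChartAt_self]
    rfl
  exact this _ (extChartAt_to_inv p)

theorem contMDiffAt_chartMetric_apply
    (g : ContMDiffRiemannianMetric I ∞ E (fun x : M => TangentSpace I x)) (p : M) {y : E}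
    (hy : y ∈ (extChartAt I p).target) (u v : E) :
    ContMDiffAt 𝓘(ℝ, E) 𝓘(ℝ) ∞ (fun z => g.inner ((extChartAt I p).symm z)
      (chartSymmDeriv I p z u) (chartSymmDeriv I p z v)) y := by
  have h : ContMDiffAt 𝓘(ℝ, E) (I.prod 𝓘(ℝ)) ∞ (fun z => TotalSpace.mk' ℝ
      (E := Bundle.Trivial M ℝ) ((extChartAt I p).symm z)
      (g.inner ((extChartAt I p).symm z) (chartSymmDeriv I p z u) (chartSymmDeriv I p z v))) y := by
    apply ContMDiffAt.clm_bundle_apply₂ (F₁ := E) (F₂ := E)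
    · exact (g.contMDiff _).comp y (contMDiffAt_extChartAt_symm' hy)
    · exact contMDiffAt_chartSymmDeriv hy u
    · exact contMDiffAt_chartSymmDeriv hy v
  rw [contMDiffAt_totalSpace] at h
  exact h.2

theorem chartMetric_pos
    (g : ContMDiffRiemannianMetric I ∞ E (fun x : M => TangentSpace I x)) (p : M) {y : E}
    (hy : y ∈ (extChartAt I p).target) {u : E} (hu : u ≠ 0) :
    0 < chartMetric I g.inner p y u u := by
  have h : chartSymmDeriv I p y u ≠ 0 := fun h => hu
    (injective_chartSymmDeriv hy (h.trans (map_zero (chartSymmDeriv I p y)).symm))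
  rw [chartMetric_apply]
  exact g.pos ((extChartAt I p).symm y) (chartSymmDeriv I p y u) h

variable [FiniteDimensional ℝ E]

theorem contDiffAt_chartMetric
    (g : ContMDiffRiemannianMetric I ∞ E (fun x : M => TangentSpace I x)) (p : M) {y : E}
    (hy : y ∈ (extChartAt I p).target) : ContDiffAt ℝ ∞ (chartMetric I g.inner p) y := by
  have hopen := isOpen_extChartAt_target (I := I) p
  have : ContDiffOn ℝ ∞ (chartMetric I g.inner p) (extChartAt I p).target := by
    rw [contDiffOn_clm_apply]
    intro u
    rw [contDiffOn_clm_apply]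
    intro v z hz
    exact (contMDiffAt_chartMetric_apply g p hz u v).contDiffAt.contDiffWithinAt
  exact this.contDiffAt (hopen.mem_nhds hy)

theorem isMetricOn_chartMetric
    (g : ContMDiffRiemannianMetric I ∞ E (fun x : M => TangentSpace I x)) (p : M) :
    IsMetricOn (chartMetric I g.inner p) (extChartAt I p).target where
  isOpen := isOpen_extChartAt_target p
  contDiffAt := fun _ hy => contDiffAt_chartMetric g p hy
  symm := fun y _ u v => chartMetric_symm g p y u v
  pos := fun _ hy _ hu => chartMetric_pos g p hy hu

theorem contDiffAt_chartEnd {T : ∀ x : M, TangentSpace I x →L[ℝ] TangentSpace I x}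
    (hT : ContMDiff I (I.prod 𝓘(ℝ, E →L[ℝ] E)) ∞
      (fun x => TotalSpace.mk' (E →L[ℝ] E)
        (E := fun x : M => TangentSpace I x →L[ℝ] TangentSpace I x) x (T x)))
    (p : M) {y : E} (hy : y ∈ (extChartAt I p).target) : ContDiffAt ℝ ∞ (chartEnd I T p) y := by
  have hopen := isOpen_extChartAt_target (I := I) p
  have : ContDiffOn ℝ ∞ (chartEnd I T p) (extChartAt I p).target := by
    rw [contDiffOn_clm_apply]
    intro u y hy
    apply ContDiffAt.contDiffWithinAt
    rw [← contMDiffAt_iff_contDiffAt]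
    have h : ContMDiffAt 𝓘(ℝ, E) (I.prod 𝓘(ℝ, E)) ∞ (fun z => TotalSpace.mk' E
        (E := fun x : M => TangentSpace I x) ((extChartAt I p).symm z)
        (T ((extChartAt I p).symm z) (chartSymmDeriv I p z u))) y :=
      ContMDiffAt.clm_bundle_apply (F₁ := E) (F₂ := E)
        ((hT _).comp y (contMDiffAt_extChartAt_symm' hy)) (contMDiffAt_chartSymmDeriv hy u)
    have h3 := (contMDiffOn_extChartAt (I := I) (n := ∞) (x := p)).contMDiffOn_tangentMapWithin
      (m := ∞) (by norm_num) (chartAt H p).open_source.uniqueMDiffOn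
    have hmem : (extChartAt I p).symm y ∈ (chartAt H p).source := by
      rw [← extChartAt_source (I := I)]
      exact (extChartAt I p).map_target hy
    have h4 := (h3.contMDiffAt (x := ⟨(extChartAt I p).symm y,
      T ((extChartAt I p).symm y) (chartSymmDeriv I p y u)⟩)
      (((chartAt H p).open_source.preimage (FiberBundle.continuous_proj E
        (TangentSpace I))).mem_nhds hmem)).comp y h
    have h5 := (contMDiff_snd_tangentBundle_modelSpace E 𝓘(ℝ, E) (n := ∞)).contMDiffAt.comp y h4
    refine h5.congr_of_eventuallyEq ?_
    filter_upwards [hopen.mem_nhds hy] with z hz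
    have hz' : (extChartAt I p).symm z ∈ (chartAt H p).source := by
      rw [← extChartAt_source (I := I)]
      exact (extChartAt I p).map_target hz
    simp only [Function.comp, tangentMapWithin]
    rw [mfderivWithin_of_isOpen (chartAt H p).open_source hz']
    rfl
  exact this.contDiffAt (hopen.mem_nhds hy)

end Charts

/-! ### Curvature of cosymplectic space forms -/

section AlmostContact

variable {E : Type*} [NormedAddCommGroup E] [NormedSpace ℝ E]
  {H : Type*} [TopologicalSpace H] {I : ModelWithCorners ℝ E H}
  {M : Type*} [TopologicalSpace M] [ChartedSpace H M] [IsManifold I ∞ M]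

theorem AlmostContactMetric.inner_ξ (S : AlmostContactMetric I M) (p : M) (u : TangentSpace I p) :
    S.g.inner p u (S.ξ p) = S.η p u := by
  have h := S.g_φ_φ p u (S.ξ p)
  rw [S.φ_ξ, S.η_ξ, map_zero] at h
  linarith

end AlmostContact

section AmbientCurvature

variable {E : Type*} [NormedAddCommGroup E] [NormedSpace ℝ E] [FiniteDimensional ℝ E]

theorem IsMetricOn.isCurvatureForm {G : E → E →L[ℝ] E →L[ℝ] ℝ} {U : Set E} (hG : IsMetricOn G U)
    {y : E} (hy : y ∈ U) :
    IsCurvatureForm fun u v w z => G y (coordCurvature G y u v w) z where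
  add_left u u' v w z := by
    simp only [hG.coordCurvature_eq hy, map_add, map_sub, add_apply, sub_apply]; ring
  smul_left t u v w z := by
    simp only [hG.coordCurvature_eq hy, map_add, map_sub, add_apply, sub_apply, map_smul,
      smul_apply, smul_eq_mul]
    ring
  swap_left u v w z := by
    simp only [hG.coordCurvature_eq hy, map_add, map_sub, add_apply, sub_apply]; ring
  swap_right u v w z := by
    have h := hG.coordCurvature_apply_self hy u v (w + z)
    have hadd : coordCurvature G y u v (w + z) =
        coordCurvature G y u v w + coordCurvature G y u v z := by
      simp only [hG.coordCurvature_eq hy, map_add]; abel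
    rw [hadd] at h
    simp only [map_add, add_apply, hG.coordCurvature_apply_self hy] at h
    linarith
  bianchi u v w z := by
    have h := congrArg (fun a => G y a z) (hG.coordCurvature_bianchi hy u v w)
    simpa using h

variable {H : Type*} [TopologicalSpace H] {I : ModelWithCorners ℝ E H} [I.Boundaryless]
  {M : Type*} [TopologicalSpace M] [ChartedSpace H M] [IsManifold I ∞ M]

/-- On a totally real pair orthogonal to `ξ` the sectional curvature is `c / 4`; a component of `u`
along `ξ` does not contribute. -/
theorem AlmostContactMetric.IsCosymplecticSpaceForm.curvature_eq {S : AlmostContactMetric I M}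
    {c : ℝ} (hS : S.IsCosymplecticSpaceForm c) (p : M) {u v : E} (hv : S.η p v = 0)
    (huv : S.g.inner p u v = 0) (hφ : S.g.inner p (S.φ p u) v = 0) :
    chartMetric I S.g.inner p (extChartAt I p p)
      (coordCurvature (chartMetric I S.g.inner p) (extChartAt I p p) u v v) u =
      c / 4 * ((S.g.inner p u u - S.η p u ^ 2) * S.g.inner p v v) := by
  have hG := isMetricOn_chartMetric S.g p
  have hy : extChartAt I p p ∈ (extChartAt I p).target := mem_extChartAt_target p
  have hR := hG.isCurvatureForm hy
  set G := chartMetric I S.g.inner p with hGdef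
  set y := extChartAt I p p with hydef
  have hGg : ∀ a b : E, G y a b = S.g.inner p a b := chartMetric_self S.g.inner p
  have hT : ∀ a : E, chartEnd I S.φ p y a = S.φ p a := chartEnd_self S.φ p
  let J : E →L[ℝ] E := S.φ p
  let η : E →L[ℝ] ℝ := S.η p
  let ξ : E := S.ξ p
  have hJ : ∀ a b w, coordCurvature G y a b (J w) = J (coordCurvature G y a b w) := by
    intro a b w
    have h := hG.coordCurvature_comm hy (fun z hz => contDiffAt_chartEnd S.contMDiff_φ p hz)
      (fun z hz => hS.isCosymplectic p z hz) a b w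
    rw [hT w, hT] at h
    exact h
  have hGξ : ∀ a, G y a ξ = η a := fun a => (hGg a ξ).trans (S.inner_ξ p a)
  have hJJ : ∀ a, J (J a) = -a + η a • ξ := fun a => S.φ_φ p a
  have hJξ : J ξ = 0 := S.φ_ξ p
  have hgJ : ∀ a b, G y (J a) (J b) = G y a b - η a * η b := fun a b => by
    rw [hGg, hGg]; exact S.g_φ_φ p a b
  -- `R(a, b)ξ` is in the kernel of `φ`, which is spanned by `ξ`, and is orthogonal to `ξ`
  have hRξ : ∀ a b, coordCurvature G y a b ξ = 0 := by
    intro a b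
    have h := hJ a b ξ
    have h0 : coordCurvature G y a b 0 = 0 := by
      simp [hG.coordCurvature_eq hy]
    rw [hJξ, h0] at h
    have h2 := hJJ (coordCurvature G y a b ξ)
    rw [← h, map_zero, ← hGξ, hG.coordCurvature_apply_self hy, zero_smul, add_zero] at h2
    exact neg_eq_zero.1 h2.symm
  have hηR : ∀ a b w, η (coordCurvature G y a b w) = 0 := by
    intro a b w
    rw [← hGξ]
    have h := hR.swap_right a b w ξ
    simp only [hRξ, map_zero, zero_apply, neg_zero] at h
    exact h
  have hc : ∀ a, η a = 0 → G y (coordCurvature G y a (J a) (J a)) a = c * G y a a ^ 2 := by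
    intro a ha
    by_cases ha0 : a = 0
    · subst ha0
      simp
    · have h := hS.sectionalCurvature_eq p a ha ha0
      have h1 : sectionalCurvature I S.g.inner p a (S.φ p a) =
          G y (coordCurvature G y a (J a) (J a)) a /
            (G y a a * G y (J a) (J a) - G y a (J a) ^ 2) := by
        rw [hGg, hGg, hGg, hGg]
        rfl
      have h2 : G y a (J a) = 0 := by
        have e₁ := hgJ a (J a)
        have e₂ : η (J a) = 0 := S.η_φ p a
        rw [hJJ, ha, zero_smul, add_zero, map_neg, e₂, hG.symm y hy (J a)] at e₁
        linarith
      have h3 := hG.pos y hy a ha0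
      rw [h1, hgJ, ha, h2] at h
      have h4 : G y a a * (G y a a - 0 * 0) - 0 ^ 2 = G y a a ^ 2 := by ring
      rw [h4, div_eq_iff (by positivity)] at h
      exact h
  let g : E →ₗ[ℝ] E →ₗ[ℝ] ℝ := ContinuousLinearMap.coeLM ℝ ∘ₗ (G y).toLinearMap
  have key := hR.eq_of_const_phi_sectional (g := g) (J := J.toLinearMap) (ξ := ξ)
    (η := η.toLinearMap) (c := c) (hG.symm y hy) hJJ (S.η_ξ p) hJξ (S.η_φ p) hgJ
    (fun a b w z => by
      change G y (coordCurvature G y a b (J w)) (J z) = G y (coordCurvature G y a b w) z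
      rw [hJ, hgJ, hηR, zero_mul, sub_zero])
    (fun a b z => by simp [hRξ]) hc (u := u) (v := v) hv ((hGg u v).trans huv)
    ((hGg (J u) v).trans hφ)
  rw [← hGg, ← hGg]
  exact key

end AmbientCurvature

/-! ### Maps in the preferred charts -/

section ChartMap

variable {E : Type*} [NormedAddCommGroup E] [NormedSpace ℝ E]
  {H : Type*} [TopologicalSpace H] {I : ModelWithCorners ℝ E H}
  {M : Type*} [TopologicalSpace M] [ChartedSpace H M]
  {E' : Type*} [NormedAddCommGroup E'] [NormedSpace ℝ E']
  {H' : Type*} [TopologicalSpace H'] {J : ModelWithCorners ℝ E' H'}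
  {M' : Type*} [TopologicalSpace M'] [ChartedSpace H' M']

/-- The map `F` in the preferred charts at `p` and `F p`. -/
def chartMap (I : ModelWithCorners ℝ E H) (J : ModelWithCorners ℝ E' H') (F : M → M') (p : M) :
    E → E' := fun z => extChartAt J (F p) (F ((extChartAt I p).symm z))

/-- The domain of `F` in the preferred charts at `p` and `F p`. -/
def chartMapDomain (I : ModelWithCorners ℝ E H) (J : ModelWithCorners ℝ E' H') (F : M → M')
    (p : M) : Set E :=
  (extChartAt I p).target ∩ (extChartAt I p).symm ⁻¹' (F ⁻¹' (extChartAt J (F p)).source)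

theorem chartMap_self (F : M → M') (p : M) :
    chartMap I J F p (extChartAt I p p) = extChartAt J (F p) (F p) := by
  rw [chartMap, extChartAt_to_inv]

theorem mem_chartMapDomain (F : M → M') (p : M) : extChartAt I p p ∈ chartMapDomain I J F p := by
  refine ⟨mem_extChartAt_target p, ?_⟩
  rw [mem_preimage, extChartAt_to_inv]
  exact mem_extChartAt_source (F p)

theorem secondFundForm_eq (g : ∀ x : M, TangentSpace I x →L[ℝ] TangentSpace I x →L[ℝ] ℝ)
    (g' : ∀ x : M', TangentSpace J x →L[ℝ] TangentSpace J x →L[ℝ] ℝ) (F : M → M') (p : M)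
    (u v : E) : secondFundForm g g' F p u v =
      coordSecondFundForm (chartMetric I g p) (chartMetric J g' (F p)) (chartMap I J F p)
        (extChartAt I p p) u v := rfl

variable [I.Boundaryless]

theorem mfderiv_eq_fderiv_chartMap {F : M → M'} {p : M} (hF : MDifferentiableAt I J F p) (u : E) :
    mfderiv I J F p u = fderiv ℝ (chartMap I J F p) (extChartAt I p p) u := by
  have h := hF.mfderiv
  rw [I.range_eq_univ, fderivWithin_univ] at h
  exact congrArg (fun T : E →L[ℝ] E' => T u) h

variable [IsManifold I ∞ M] [IsManifold J ∞ M']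

theorem isSmoothMapOn_chartMap {F : M → M'} (hF : ContMDiff I J ∞ F) (p : M) :
    IsSmoothMapOn (chartMap I J F p) (chartMapDomain I J F p) (extChartAt J (F p)).target where
  isOpen := (continuousOn_extChartAt_symm p).isOpen_inter_preimage (isOpen_extChartAt_target p)
    ((isOpen_extChartAt_source (F p)).preimage hF.continuous)
  contDiffAt := by
    intro y hy
    rw [← contMDiffAt_iff_contDiffAt]
    have h₁ := contMDiffAt_extChartAt_symm' (I := I) hy.1
    have h₂ : ContMDiffAt J 𝓘(ℝ, E') ∞ (extChartAt J (F p)) (F ((extChartAt I p).symm y)) := by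
      apply contMDiffAt_extChartAt'
      rw [← extChartAt_source (I := J)]
      exact hy.2
    exact h₂.comp y ((hF _).comp y h₁)
  mapsTo := fun y hy => (extChartAt J (F p)).map_source hy.2

variable [J.Boundaryless]

/-- An isometric immersion is isometric in charts. -/
theorem chartMetric_chartMap {F : M → M'} (hF : ContMDiff I J ∞ F)
    {g : ∀ x : M, TangentSpace I x →L[ℝ] TangentSpace I x →L[ℝ] ℝ}
    {g' : ∀ x : M', TangentSpace J x →L[ℝ] TangentSpace J x →L[ℝ] ℝ}
    (hiso : ∀ (q : M) (u v : TangentSpace I q),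
      g' (F q) (mfderiv I J F q u) (mfderiv I J F q v) = g q u v)
    (p : M) {y : E} (hy : y ∈ chartMapDomain I J F p) (u v : E) :
    chartMetric J g' (F p) (chartMap I J F p y) (fderiv ℝ (chartMap I J F p) y u)
      (fderiv ℝ (chartMap I J F p) y v) = chartMetric I g p y u v := by
  have hP := isSmoothMapOn_chartMap hF p
  have hsymm := mdifferentiableAt_extChartAt_symm' (I := I) hy.1
  have hsymm' := mdifferentiableAt_extChartAt_symm' (I := J) (hP.mapsTo hy)
  have hFd : MDifferentiableAt I J F ((extChartAt I p).symm y) :=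
    (hF _).mdifferentiableAt (by norm_num)
  have hPd : MDifferentiableAt 𝓘(ℝ, E) 𝓘(ℝ, E') (chartMap I J F p) y :=
    ((hP.contDiffAt y hy).differentiableAt_infty).mdifferentiableAt
  have e : mfderiv 𝓘(ℝ, E) J ((extChartAt J (F p)).symm ∘ chartMap I J F p) y =
      mfderiv 𝓘(ℝ, E) J (F ∘ (extChartAt I p).symm) y := by
    apply Filter.EventuallyEq.mfderiv_eq
    filter_upwards [hP.mem_nhds hy] with z hz
    exact (extChartAt J (F p)).left_inv hz.2
  rw [mfderiv_comp y hsymm' hPd, mfderiv_comp y hFd hsymm, mfderiv_eq_fderiv] at e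
  have key : ∀ w : E, chartSymmDeriv J (F p) (chartMap I J F p y)
      (fderiv ℝ (chartMap I J F p) y w) =
      mfderiv I J F ((extChartAt I p).symm y) (chartSymmDeriv I p y w) := fun w =>
    congrArg (fun T : E →L[ℝ] E' => T w) e
  have hpt : (extChartAt J (F p)).symm (chartMap I J F p y) = F ((extChartAt I p).symm y) :=
    (extChartAt J (F p)).left_inv hy.2
  rw [chartMetric_apply, chartMetric_apply, key, key]
  refine Eq.trans ?_ (hiso _ _ _)
  have : ∀ q, q = F ((extChartAt I p).symm y) → ∀ a b : E',
      (g' q : E' →L[ℝ] E' →L[ℝ] ℝ) a b = g' (F ((extChartAt I p).symm y)) a b := by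
    rintro _ rfl a b; rfl
  exact this _ hpt _ _

end ChartMap

/-! ### Restriction and rescaling -/

section Congr

variable {E : Type*} [NormedAddCommGroup E] [NormedSpace ℝ E]
  {X : Type*} [NormedAddCommGroup X] [NormedSpace ℝ X]
  {Y : Type*} [NormedAddCommGroup Y] [NormedSpace ℝ Y]

theorem christoffel_congr {G G' : E → E →L[ℝ] E →L[ℝ] ℝ} {y : E} (h : G =ᶠ[𝓝 y] G') (u v : E) :
    christoffel G y u v = christoffel G' y u v := by
  unfold christoffel
  rw [h.fderiv_eq, h.eq_of_nhds]

theorem IsMetricOn.const_smul {G : E → E →L[ℝ] E →L[ℝ] ℝ} {U : Set E} (hG : IsMetricOn G U) {t : ℝ}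
    (ht : 0 < t) : IsMetricOn (fun y => t • G y) U where
  isOpen := hG.isOpen
  contDiffAt y hy := (hG.contDiffAt y hy).const_smul t
  symm y hy u v := by simp [hG.symm y hy u v]
  pos y hy u hu := by
    have := hG.pos y hy u hu
    simp only [smul_apply, smul_eq_mul]
    positivity

theorem IsMetricOn.christoffel_const_smul [FiniteDimensional ℝ E] {G : E → E →L[ℝ] E →L[ℝ] ℝ}
    {U : Set E} (hG : IsMetricOn G U) {t : ℝ} (ht : 0 < t) {y : E} (hy : y ∈ U) (u v : E) :
    christoffel (fun y => t • G y) y u v = christoffel G y u v := by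
  have hG' := hG.const_smul ht
  refine ext_of_pos (hG'.pos y hy) fun w => ?_
  rw [hG'.christoffel_spec hy, smul_apply, smul_apply, hG.christoffel_spec hy,
    fderiv_fun_const_smul (hG.differentiableAt hy)]
  simp only [smul_apply, smul_eq_mul]
  ring

/-- The connection along the restriction of a map to an affine subspace. -/
theorem IsSmoothMapOn.covDerivAlong_comp {P : X → E} {V : Set X} {U : Set E}
    (hP : IsSmoothMapOn P V U) (G : E → E →L[ℝ] E →L[ℝ] ℝ) {j : Y → X} {L : Y →L[ℝ] X}
    (hj : ∀ z, HasFDerivAt j L z) {z : Y} (hz : j z ∈ V) (u v : Y) :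
    fderiv ℝ (P ∘ j) z u = fderiv ℝ P (j z) (L u) ∧
    covDerivAlong G (P ∘ j) z u v = covDerivAlong G P (j z) (L u) (L v) := by
  have h1 : ∀ w, j w ∈ V → fderiv ℝ (P ∘ j) w = (fderiv ℝ P (j w)).comp L := fun w hw =>
    ((hP.contDiffAt _ hw).differentiableAt_infty.hasFDerivAt.comp w (hj w)).fderiv
  have h2 : fderiv ℝ (fderiv ℝ (P ∘ j)) z u v = fderiv ℝ (fderiv ℝ P) (j z) (L u) (L v) := by
    have e : fderiv ℝ (P ∘ j) =ᶠ[𝓝 z] fun w => (fderiv ℝ P (j w)).comp L := by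
      filter_upwards [(hj z).continuousAt.preimage_mem_nhds (hP.mem_nhds hz)] with w hw
        using h1 w hw
    have h3 := (hP.contDiffAt _ hz).fderiv_infty.differentiableAt_infty.hasFDerivAt.comp z (hj z)
    have h4 : HasFDerivAt (fun w => (fderiv ℝ P (j w)).comp L) _ z :=
      h3.clm_comp (hasFDerivAt_const L z)
    rw [e.fderiv_eq, h4.fderiv]
    simp
  refine ⟨by rw [h1 z hz]; rfl, ?_⟩
  unfold covDerivAlong
  rw [h2, h1 z hz]
  rfl

end Congr

/-! ### Product charts -/

section ProductCharts

variable {E₁ : Type*} [NormedAddCommGroup E₁] [NormedSpace ℝ E₁]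
  {H₁ : Type*} [TopologicalSpace H₁] {I₁ : ModelWithCorners ℝ E₁ H₁} [I₁.Boundaryless]
  {N₁ : Type*} [TopologicalSpace N₁] [ChartedSpace H₁ N₁] [IsManifold I₁ ∞ N₁]
  {E₂ : Type*} [NormedAddCommGroup E₂] [NormedSpace ℝ E₂]
  {H₂ : Type*} [TopologicalSpace H₂] {I₂ : ModelWithCorners ℝ E₂ H₂} [I₂.Boundaryless]
  {N₂ : Type*} [TopologicalSpace N₂] [ChartedSpace H₂ N₂] [IsManifold I₂ ∞ N₂]

theorem chartSymmDeriv_prod (x : N₁ × N₂) {y : E₁ × E₂}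
    (hy : y ∈ (extChartAt (I₁.prod I₂) x).target) (u : E₁ × E₂) :
    chartSymmDeriv (I₁.prod I₂) x y u =
      (chartSymmDeriv I₁ x.1 y.1 u.1, chartSymmDeriv I₂ x.2 y.2 u.2) := by
  rw [extChartAt_prod] at hy
  have h₁ : HasMFDerivAt 𝓘(ℝ, E₁ × E₂) I₁ (fun z : E₁ × E₂ => (extChartAt I₁ x.1).symm z.1) y _ :=
    (mdifferentiableAt_extChartAt_symm' (I := I₁) hy.1).hasMFDerivAt.comp y
      (hasFDerivAt_fst (𝕜 := ℝ) (p := y)).hasMFDerivAt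
  have h₂ : HasMFDerivAt 𝓘(ℝ, E₁ × E₂) I₂ (fun z : E₁ × E₂ => (extChartAt I₂ x.2).symm z.2) y _ :=
    (mdifferentiableAt_extChartAt_symm' (I := I₂) hy.2).hasMFDerivAt.comp y
      (hasFDerivAt_snd (𝕜 := ℝ) (p := y)).hasMFDerivAt
  have h := (h₁.prodMk h₂).congr_of_eventuallyEq (f₁ := (extChartAt (I₁.prod I₂) x).symm)
    (Filter.Eventually.of_forall fun z => by rw [extChartAt_prod]; rfl)
  exact congrArg (fun T : E₁ × E₂ →L[ℝ] E₁ × E₂ => T u) h.mfderiv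

/-- In charts, a warped product metric is a warped product metric. -/
theorem chartMetric_warpedMetric (g₁ : ∀ x : N₁, TangentSpace I₁ x →L[ℝ] TangentSpace I₁ x →L[ℝ] ℝ)
    (g₂ : ∀ x : N₂, TangentSpace I₂ x →L[ℝ] TangentSpace I₂ x →L[ℝ] ℝ) {f : N₁ → ℝ}
    (hf : ∀ p, 0 < f p) (x : N₁ × N₂) {y : E₁ × E₂}
    (hy : y ∈ (extChartAt (I₁.prod I₂) x).target) :
    chartMetric (I₁.prod I₂) (warpedMetric g₁ g₂ f) x y =
      warpedCoord (chartMetric I₁ g₁ x.1) (chartMetric I₂ g₂ x.2)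
        (fun z => Real.log (f ((extChartAt I₁ x.1).symm z))) y := by
  refine ContinuousLinearMap.ext fun u => ContinuousLinearMap.ext fun v => ?_
  rw [warpedCoord_apply, chartMetric_apply, chartSymmDeriv_prod x hy, chartSymmDeriv_prod x hy,
    chartMetric_apply, chartMetric_apply, two_mul, Real.exp_add, Real.exp_log (hf _), ← sq]
  rw [extChartAt_prod]
  rfl

end ProductCharts

/-! ### Traces on an orthogonal sum -/

section OrthonormalSums

variable {X : Type*} [NormedAddCommGroup X] [NormedSpace ℝ X]
  {E : Type*} [NormedAddCommGroup E] [NormedSpace ℝ E]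

theorem sum_sq_of_orthonormal {ι : Type*} [Fintype ι] [DecidableEq ι] {b : X →L[ℝ] X →L[ℝ] ℝ}
    {e : Basis ι ℝ X} (he : ∀ i j, b (e i) (e j) = if i = j then 1 else 0) (u : X) :
    ∑ i, b u (e i) ^ 2 = b u u := by
  have h : ∀ i, b u (e i) = e.repr u i := by
    intro i
    conv_lhs => rw [← e.sum_repr u]
    simp only [map_sum, map_smul, sum_apply, smul_apply, he, smul_eq_mul]
    simp
  conv_rhs => rw [← e.sum_repr u]
  simp only [map_sum, map_smul, smul_apply, smul_eq_mul, sum_apply]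
  simp [he, h, sq]

theorem eq_zero_of_sum_eq_zero {ι : Type*} [Fintype ι] {g : E →L[ℝ] E →L[ℝ] ℝ}
    (hg : ∀ u, u ≠ 0 → 0 < g u u)
    {e : Basis ι ℝ X} {h : X →ₗ[ℝ] X →ₗ[ℝ] E}
    (h0 : ∑ i, ∑ j, g (h (e i) (e j)) (h (e i) (e j)) = 0) (u v : X) : h u v = 0 := by
  have nn : ∀ w, 0 ≤ g w w := fun w => by
    by_cases hw : w = 0
    · simp [hw]
    · exact (hg w hw).le
  have key : ∀ i j, h (e i) (e j) = 0 := by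
    intro i j
    have h1 := (Finset.sum_eq_zero_iff_of_nonneg
      (fun i _ => Finset.sum_nonneg fun j _ => nn _)).1 h0 i (Finset.mem_univ i)
    have h2 := (Finset.sum_eq_zero_iff_of_nonneg (fun j _ => nn _)).1 h1 j (Finset.mem_univ j)
    by_contra hne
    exact (hg _ hne).ne' h2
  have : h = 0 := e.ext fun i => e.ext fun j => key i j
  rw [this]
  rfl

/-- The second fundamental form in coordinates, bundled as a bilinear map. -/
def coordSecondFundFormLM (W : X → X →L[ℝ] X →L[ℝ] ℝ) (G : E → E →L[ℝ] E →L[ℝ] ℝ) (P : X → E)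
    (y : X) : X →ₗ[ℝ] X →ₗ[ℝ] E :=
  LinearMap.mk₂ ℝ (coordSecondFundForm W G P y)
    (fun u u' v => by
      simp only [coordSecondFundForm, covDerivAlong, christoffel_eq_christoffelCLM, map_add,
        add_apply]
      abel)
    (fun t u v => by
      simp only [coordSecondFundForm, covDerivAlong, christoffel_eq_christoffelCLM, map_smul,
        smul_apply, smul_sub, smul_add])
    (fun u v v' => by
      simp only [coordSecondFundForm, covDerivAlong, christoffel_eq_christoffelCLM, map_add]
      abel)
    (fun t u v => by
      simp only [coordSecondFundForm, covDerivAlong, christoffel_eq_christoffelCLM, map_smul,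
        smul_sub, smul_add])

theorem coordSecondFundFormLM_apply (W : X → X →L[ℝ] X →L[ℝ] ℝ) (G : E → E →L[ℝ] E →L[ℝ] ℝ)
    (P : X → E) (y u v : X) :
    coordSecondFundFormLM W G P y u v = coordSecondFundForm W G P y u v := rfl

theorem metricTrace_metricTrace [FiniteDimensional ℝ X] {ι : Type*} [Fintype ι] [DecidableEq ι]
    {b : X →L[ℝ] X →L[ℝ] ℝ} {e : Basis ι ℝ X}
    (he : ∀ i j, b (e i) (e j) = if i = j then 1 else 0) (g : E →L[ℝ] E →L[ℝ] ℝ)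
    (h : X →ₗ[ℝ] X →ₗ[ℝ] E) :
    metricTrace b (fun u u' => metricTrace b fun v v' => g (h u v) (h u' v')) =
      ∑ i, ∑ j, g (h (e i) (e j)) (h (e i) (e j)) := by
  let g' : E →ₗ[ℝ] E →ₗ[ℝ] ℝ := ContinuousLinearMap.coeLM ℝ ∘ₗ g.toLinearMap
  have h₁ : ∀ u u', metricTrace b (fun v v' => g (h u v) (h u' v')) =
      (∑ j, g'.compl₁₂ (h.flip (e j)) (h.flip (e j))) u u' := fun u u' =>
    (metricTrace_eq_sum b e he (g'.compl₁₂ (h u) (h u'))).trans (by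
      simp [LinearMap.sum_apply])
  simp only [h₁]
  rw [metricTrace_eq_sum b e he]
  simp only [LinearMap.sum_apply]
  rfl

variable {X₁ : Type*} [NormedAddCommGroup X₁] [NormedSpace ℝ X₁]
  {X₂ : Type*} [NormedAddCommGroup X₂] [NormedSpace ℝ X₂]
  {ι κ : Type*} [DecidableEq ι] [DecidableEq κ]

theorem orthonormal_prod {b : X₁ × X₂ →L[ℝ] X₁ × X₂ →L[ℝ] ℝ} {b₁ : X₁ →L[ℝ] X₁ →L[ℝ] ℝ}
    {b₂ : X₂ →L[ℝ] X₂ →L[ℝ] ℝ} (hb : ∀ u v, b u v = b₁ u.1 v.1 + b₂ u.2 v.2)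
    {e : Basis ι ℝ X₁} (he : ∀ i j, b₁ (e i) (e j) = if i = j then 1 else 0)
    {d : Basis κ ℝ X₂} (hd : ∀ i j, b₂ (d i) (d j) = if i = j then 1 else 0) (s t : ι ⊕ κ) :
    b (e.prod d s) (e.prod d t) = if s = t then 1 else 0 := by
  rw [hb]
  rcases s with i | a <;> rcases t with j | c <;> simp [he, hd]

variable [FiniteDimensional ℝ X₁] [FiniteDimensional ℝ X₂] [Fintype ι] [Fintype κ]

/-- The squared norm of a symmetric bilinear map on an orthogonal sum. -/
theorem metricTrace_metricTrace_prod {b : X₁ × X₂ →L[ℝ] X₁ × X₂ →L[ℝ] ℝ}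
    {b₁ : X₁ →L[ℝ] X₁ →L[ℝ] ℝ}
    {b₂ : X₂ →L[ℝ] X₂ →L[ℝ] ℝ} (hb : ∀ u v, b u v = b₁ u.1 v.1 + b₂ u.2 v.2)
    {e : Basis ι ℝ X₁} (he : ∀ i j, b₁ (e i) (e j) = if i = j then 1 else 0)
    {d : Basis κ ℝ X₂} (hd : ∀ i j, b₂ (d i) (d j) = if i = j then 1 else 0)
    (g : E →L[ℝ] E →L[ℝ] ℝ) (h : X₁ × X₂ →ₗ[ℝ] X₁ × X₂ →ₗ[ℝ] E) (hs : ∀ u v, h u v = h v u) :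
    metricTrace b (fun u u' => metricTrace b fun v v' => g (h u v) (h u' v')) =
      ∑ i, ∑ j, g (h (e i, 0) (e j, 0)) (h (e i, 0) (e j, 0))
      + 2 * ∑ a, ∑ i, g (h (e i, 0) (0, d a)) (h (e i, 0) (0, d a))
      + ∑ a, ∑ a', g (h (0, d a) (0, d a')) (h (0, d a) (0, d a')) := by
  rw [metricTrace_metricTrace (orthonormal_prod hb he hd)]
  have hl : ∀ i, e.prod d (Sum.inl i) = (e i, 0) := fun i => by ext <;> simp
  have hr : ∀ a, e.prod d (Sum.inr a) = (0, d a) := fun a => by ext <;> simp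
  simp only [Fintype.sum_sum_type, hl, hr, Finset.sum_add_distrib]
  rw [Finset.sum_comm (s := (Finset.univ : Finset ι)) (t := (Finset.univ : Finset κ))]
  simp only [fun a i => hs (0, d a) (e i, 0)]
  ring

theorem metricTrace_prod {b : X₁ × X₂ →L[ℝ] X₁ × X₂ →L[ℝ] ℝ}
    {b₁ : X₁ →L[ℝ] X₁ →L[ℝ] ℝ}
    {b₂ : X₂ →L[ℝ] X₂ →L[ℝ] ℝ} (hb : ∀ u v, b u v = b₁ u.1 v.1 + b₂ u.2 v.2)
    {e : Basis ι ℝ X₁} (he : ∀ i j, b₁ (e i) (e j) = if i = j then 1 else 0)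
    {d : Basis κ ℝ X₂} (hd : ∀ i j, b₂ (d i) (d j) = if i = j then 1 else 0)
    (h : X₁ × X₂ →ₗ[ℝ] X₁ × X₂ →ₗ[ℝ] E) :
    metricTrace b (fun u v => h u v) =
      ∑ i, h (e i, 0) (e i, 0) + ∑ a, h (0, d a) (0, d a) := by
  rw [metricTrace_eq_sum b _ (orthonormal_prod hb he hd)]
  have hl : ∀ i, e.prod d (Sum.inl i) = (e i, 0) := fun i => by ext <;> simp
  have hr : ∀ a, e.prod d (Sum.inr a) = (0, d a) := fun a => by ext <;> simp
  simp only [Fintype.sum_sum_type, hl, hr]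

end OrthonormalSums

/-! ### The Gauss equation traced over the first factor -/

section WarpedSums

variable {X₁ : Type*} [NormedAddCommGroup X₁] [NormedSpace ℝ X₁] [FiniteDimensional ℝ X₁]
  {X₂ : Type*} [NormedAddCommGroup X₂] [NormedSpace ℝ X₂] [FiniteDimensional ℝ X₂]
  {E : Type*} [NormedAddCommGroup E] [NormedSpace ℝ E] [FiniteDimensional ℝ E]
  {G₁ : X₁ → X₁ →L[ℝ] X₁ →L[ℝ] ℝ} {G₂ : X₂ → X₂ →L[ℝ] X₂ →L[ℝ] ℝ} {ψ : X₁ → ℝ}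
  {V₁ : Set X₁} {V₂ : Set X₂}
  {G : E → E →L[ℝ] E →L[ℝ] ℝ} {P : X₁ × X₂ → E} {V : Set (X₁ × X₂)} {U : Set E}
  {ι : Type*} [Fintype ι] [DecidableEq ι]

/-- The mixed part of the second fundamental form of a warped product that is minimal along the
first factor: the trace of the Gauss equation over the first factor. The vector `u₀` stands for the
Reeb field `ξ`. -/
theorem sum_mixed_sq (h₁ : IsMetricOn G₁ V₁) (h₂ : IsMetricOn G₂ V₂)
    (hψ : ∀ a ∈ V₁, ContDiffAt ℝ ∞ ψ a) (hG : IsMetricOn G U) (hP : IsSmoothMapOn P V U)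
    (hV : V ⊆ V₁ ×ˢ V₂)
    (hiso : ∀ z ∈ V, ∀ u v, G (P z) (fderiv ℝ P z u) (fderiv ℝ P z v) =
      warpedCoord G₁ G₂ ψ z u v)
    {y : X₁ × X₂} (hy : y ∈ V) {e : Basis ι ℝ X₁}
    (he : ∀ i j, G₁ y.1 (e i) (e j) = if i = j then 1 else 0) {u₀ : X₁} (hu₀ : G₁ y.1 u₀ u₀ = 1)
    {v : X₂} (hv : Real.exp (2 * ψ y.1) * G₂ y.2 v v = 1) {c : ℝ}
    (hc : ∀ u, G (P y) (coordCurvature G (P y) (fderiv ℝ P y (u, 0)) (fderiv ℝ P y (0, v))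
        (fderiv ℝ P y (0, v))) (fderiv ℝ P y (u, 0)) =
      c / 4 * (G₁ y.1 u u - G₁ y.1 u₀ u ^ 2))
    (hmin : ∑ i, coordSecondFundForm (warpedCoord G₁ G₂ ψ) G P y (e i, 0) (e i, 0) = 0) :
    ∑ i, G (P y) (coordSecondFundForm (warpedCoord G₁ G₂ ψ) G P y (e i, 0) (0, v))
        (coordSecondFundForm (warpedCoord G₁ G₂ ψ) G P y (e i, 0) (0, v)) =
      ∑ i, fderiv ℝ ψ y.1 (e i) ^ 2
      - ∑ i, (fderiv ℝ ψ y.1 (christoffel G₁ y.1 (e i) (e i))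
        - fderiv ℝ (fderiv ℝ ψ) y.1 (e i) (e i))
      + ((Fintype.card ι : ℝ) - 1) * (c / 4) := by
  have key : ∀ i, G (P y) (coordSecondFundForm (warpedCoord G₁ G₂ ψ) G P y (e i, 0) (0, v))
        (coordSecondFundForm (warpedCoord G₁ G₂ ψ) G P y (e i, 0) (0, v)) =
      G (P y) (coordSecondFundForm (warpedCoord G₁ G₂ ψ) G P y (0, v) (0, v))
        (coordSecondFundForm (warpedCoord G₁ G₂ ψ) G P y (e i, 0) (e i, 0))
      + (fderiv ℝ ψ y.1 (e i) ^ 2 - (fderiv ℝ ψ y.1 (christoffel G₁ y.1 (e i) (e i))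
        - fderiv ℝ (fderiv ℝ ψ) y.1 (e i) (e i))
      + c / 4 * (1 - G₁ y.1 u₀ (e i) ^ 2)) := by
    intro i
    have h := gauss_equation_warpedCoord h₁ h₂ hψ hG hP hV hiso hy (e i) v
    rw [hc, hv, he, if_pos rfl] at h
    linarith
  simp only [key, Finset.sum_add_distrib, Finset.sum_sub_distrib, ← Finset.mul_sum]
  -- the cross term vanishes by minimality, and `∑ i, G₁ (u₀, e i) ^ 2 = 1`
  rw [← map_sum, hmin, map_zero, sum_sq_of_orthonormal he, hu₀]
  simp
  ring

end WarpedSums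

/-! ### Immersed warped products in charts -/

section WarpedImmersion

set_option linter.unusedSectionVars false

variable {E₁ : Type*} [NormedAddCommGroup E₁] [NormedSpace ℝ E₁] [FiniteDimensional ℝ E₁]
  {N₁ : Type*} [TopologicalSpace N₁] [ChartedSpace E₁ N₁] [IsManifold 𝓘(ℝ, E₁) ∞ N₁]
  {E₂ : Type*} [NormedAddCommGroup E₂] [NormedSpace ℝ E₂] [FiniteDimensional ℝ E₂]
  {N₂ : Type*} [TopologicalSpace N₂] [ChartedSpace E₂ N₂] [IsManifold 𝓘(ℝ, E₂) ∞ N₂]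
  {E : Type*} [NormedAddCommGroup E] [NormedSpace ℝ E] [FiniteDimensional ℝ E]
  {M : Type*} [TopologicalSpace M] [ChartedSpace E M] [IsManifold 𝓘(ℝ, E) ∞ M]
  {g : ContMDiffRiemannianMetric 𝓘(ℝ, E) ∞ E (fun x : M => TangentSpace 𝓘(ℝ, E) x)}
  {g₁ : ContMDiffRiemannianMetric 𝓘(ℝ, E₁) ∞ E₁ (fun x : N₁ => TangentSpace 𝓘(ℝ, E₁) x)}
  {g₂ : ContMDiffRiemannianMetric 𝓘(ℝ, E₂) ∞ E₂ (fun x : N₂ => TangentSpace 𝓘(ℝ, E₂) x)}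
  {f : N₁ → ℝ} {F : N₁ × N₂ → M}

theorem contDiffAt_log_chart (hf : ContMDiff 𝓘(ℝ, E₁) 𝓘(ℝ, ℝ) ∞ f) (hf_pos : ∀ p, 0 < f p)
    (p : N₁) {y : E₁} (hy : y ∈ (extChartAt 𝓘(ℝ, E₁) p).target) :
    ContDiffAt ℝ ∞ (fun z => Real.log (f ((extChartAt 𝓘(ℝ, E₁) p).symm z))) y := by
  have h : ContDiffAt ℝ ∞ (f ∘ (extChartAt 𝓘(ℝ, E₁) p).symm) y := by
    rw [← contMDiffAt_iff_contDiffAt]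
    exact (hf _).comp y (contMDiffAt_extChartAt_symm' hy)
  exact h.log (hf_pos _).ne'

theorem gradNormSq_eq_sum {ι : Type*} [Fintype ι] [DecidableEq ι] {ψ : N₁ → ℝ}
    {p : N₁} (hψ : MDifferentiableAt 𝓘(ℝ, E₁) 𝓘(ℝ, ℝ) ψ p)
    {e : Basis ι ℝ E₁} (he : ∀ i j, g₁.inner p (e i) (e j) = if i = j then 1 else 0) :
    gradNormSq 𝓘(ℝ, E₁) g₁.inner ψ p =
      ∑ i, fderiv ℝ (fun z => ψ ((extChartAt 𝓘(ℝ, E₁) p).symm z)) (extChartAt 𝓘(ℝ, E₁) p p)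
        (e i) ^ 2 := by
  let b : E₁ →L[ℝ] E₁ →L[ℝ] ℝ := g₁.inner p
  let l : E₁ →L[ℝ] ℝ := mfderiv 𝓘(ℝ, E₁) 𝓘(ℝ, ℝ) ψ p
  have hl : ∀ u, l u =
      fderiv ℝ (fun z => ψ ((extChartAt 𝓘(ℝ, E₁) p).symm z)) (extChartAt 𝓘(ℝ, E₁) p p) u :=
    fun u => mfderiv_eq_fderiv_chartMap hψ u
  have hb : ∀ u, u ≠ 0 → 0 < b u u := fun u hu => g₁.pos p u hu
  change b (b.inverse l) (b.inverse l) = _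
  rw [← sum_sq_of_orthonormal (b := b) he, apply_inverse_of_pos hb]
  simp only [hl]

theorem laplacian_eq_sum {ι : Type*} [Fintype ι] [DecidableEq ι] {ψ : N₁ → ℝ}
    {p : N₁} {e : Basis ι ℝ E₁} (he : ∀ i j, g₁.inner p (e i) (e j) = if i = j then 1 else 0) :
    laplacian 𝓘(ℝ, E₁) g₁.inner ψ p =
      ∑ i, (fderiv ℝ (fun z => ψ ((extChartAt 𝓘(ℝ, E₁) p).symm z)) (extChartAt 𝓘(ℝ, E₁) p p)
          (christoffel (chartMetric 𝓘(ℝ, E₁) g₁.inner p) (extChartAt 𝓘(ℝ, E₁) p p) (e i) (e i))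
        - fderiv ℝ (fderiv ℝ (fun z => ψ ((extChartAt 𝓘(ℝ, E₁) p).symm z)))
          (extChartAt 𝓘(ℝ, E₁) p p) (e i) (e i)) := by
  set ψ' := fun z => ψ ((extChartAt 𝓘(ℝ, E₁) p).symm z)
  set y := extChartAt 𝓘(ℝ, E₁) p p
  let B : E₁ →L[ℝ] E₁ →L[ℝ] ℝ :=
    (ContinuousLinearMap.compL ℝ E₁ E₁ ℝ (fderiv ℝ ψ' y)).comp
      (christoffelCLM (chartMetric 𝓘(ℝ, E₁) g₁.inner p) y) - fderiv ℝ (fderiv ℝ ψ') y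
  let b : E₁ →L[ℝ] E₁ →L[ℝ] ℝ := g₁.inner p
  exact metricTrace_eq_sum b e he (ContinuousLinearMap.coeLM ℝ ∘ₗ B.toLinearMap)

theorem chartMapDomain_subset (x : N₁ × N₂) :
    chartMapDomain (𝓘(ℝ, E₁).prod 𝓘(ℝ, E₂)) 𝓘(ℝ, E) F x ⊆
      (extChartAt 𝓘(ℝ, E₁) x.1).target ×ˢ (extChartAt 𝓘(ℝ, E₂) x.2).target := by
  intro y hy
  have := hy.1
  rwa [extChartAt_prod] at this

theorem extChartAt_prod_apply (x : N₁ × N₂) :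
    extChartAt (𝓘(ℝ, E₁).prod 𝓘(ℝ, E₂)) x x =
      (extChartAt 𝓘(ℝ, E₁) x.1 x.1, extChartAt 𝓘(ℝ, E₂) x.2 x.2) := by
  rw [extChartAt_prod]
  rfl

theorem chartMetric_chartMap_warped
    (hF : IsIsometricImmersion 𝓘(ℝ, E) (warpedMetric g₁.inner g₂.inner f) g.inner F)
    (hf_pos : ∀ p, 0 < f p) (x : N₁ × N₂) :
    ∀ z ∈ chartMapDomain (𝓘(ℝ, E₁).prod 𝓘(ℝ, E₂)) 𝓘(ℝ, E) F x, ∀ u v,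
      chartMetric 𝓘(ℝ, E) g.inner (F x) (chartMap (𝓘(ℝ, E₁).prod 𝓘(ℝ, E₂)) 𝓘(ℝ, E) F x z)
        (fderiv ℝ (chartMap (𝓘(ℝ, E₁).prod 𝓘(ℝ, E₂)) 𝓘(ℝ, E) F x) z u)
        (fderiv ℝ (chartMap (𝓘(ℝ, E₁).prod 𝓘(ℝ, E₂)) 𝓘(ℝ, E) F x) z v) =
      warpedCoord (chartMetric 𝓘(ℝ, E₁) g₁.inner x.1) (chartMetric 𝓘(ℝ, E₂) g₂.inner x.2)
        (fun z => Real.log (f ((extChartAt 𝓘(ℝ, E₁) x.1).symm z))) z u v := by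
  intro z hz u v
  rw [chartMetric_chartMap hF.contMDiff hF.isometric x hz,
    chartMetric_warpedMetric _ _ hf_pos x hz.1]

/-- The second fundamental form of the immersed warped product at `x`, as a bilinear map. -/
def warpedSecondFundForm (g : ContMDiffRiemannianMetric 𝓘(ℝ, E) ∞ E
      (fun x : M => TangentSpace 𝓘(ℝ, E) x))
    (g₁ : ContMDiffRiemannianMetric 𝓘(ℝ, E₁) ∞ E₁ (fun x : N₁ => TangentSpace 𝓘(ℝ, E₁) x))
    (g₂ : ContMDiffRiemannianMetric 𝓘(ℝ, E₂) ∞ E₂ (fun x : N₂ => TangentSpace 𝓘(ℝ, E₂) x))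
    (f : N₁ → ℝ) (F : N₁ × N₂ → M) (x : N₁ × N₂) : E₁ × E₂ →ₗ[ℝ] E₁ × E₂ →ₗ[ℝ] E :=
  coordSecondFundFormLM
    (warpedCoord (chartMetric 𝓘(ℝ, E₁) g₁.inner x.1) (chartMetric 𝓘(ℝ, E₂) g₂.inner x.2)
      (fun z => Real.log (f ((extChartAt 𝓘(ℝ, E₁) x.1).symm z))))
    (chartMetric 𝓘(ℝ, E) g.inner (F x)) (chartMap (𝓘(ℝ, E₁).prod 𝓘(ℝ, E₂)) 𝓘(ℝ, E) F x)
    (extChartAt 𝓘(ℝ, E₁) x.1 x.1, extChartAt 𝓘(ℝ, E₂) x.2 x.2)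

theorem secondFundForm_eq_warped (hf_pos : ∀ p, 0 < f p) (x : N₁ × N₂) (u v : E₁ × E₂) :
    secondFundForm (warpedMetric g₁.inner g₂.inner f) g.inner F x u v =
      warpedSecondFundForm g g₁ g₂ f F x u v := by
  rw [secondFundForm_eq, warpedSecondFundForm, coordSecondFundFormLM_apply, extChartAt_prod_apply,
    coordSecondFundForm, coordSecondFundForm]
  have h : chartMetric (𝓘(ℝ, E₁).prod 𝓘(ℝ, E₂)) (warpedMetric g₁.inner g₂.inner f) x
      =ᶠ[𝓝 (extChartAt 𝓘(ℝ, E₁) x.1 x.1, extChartAt 𝓘(ℝ, E₂) x.2 x.2)]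
      warpedCoord (chartMetric 𝓘(ℝ, E₁) g₁.inner x.1) (chartMetric 𝓘(ℝ, E₂) g₂.inner x.2)
        (fun z => Real.log (f ((extChartAt 𝓘(ℝ, E₁) x.1).symm z))) := by
    have hm := extChartAt_target_mem_nhds (I := 𝓘(ℝ, E₁).prod 𝓘(ℝ, E₂)) x
    rw [extChartAt_prod_apply] at hm
    filter_upwards [hm] with y hy using chartMetric_warpedMetric _ _ hf_pos x hy
  rw [christoffel_congr h]

theorem warpedMetric_apply (x : N₁ × N₂) (u v : E₁ × E₂) :
    warpedMetric g₁.inner g₂.inner f x u v =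
      g₁.inner x.1 u.1 v.1 + (f x.1 ^ 2 • (g₂.inner x.2 : E₂ →L[ℝ] E₂ →L[ℝ] ℝ)) u.2 v.2 := rfl

end WarpedImmersion

/-! ### The norm of the second fundamental form -/

section Inequality

set_option linter.unusedSectionVars false

variable {E₁ : Type*} [NormedAddCommGroup E₁] [NormedSpace ℝ E₁] [FiniteDimensional ℝ E₁]
  {N₁ : Type*} [TopologicalSpace N₁] [ChartedSpace E₁ N₁] [IsManifold 𝓘(ℝ, E₁) ∞ N₁]
  {E₂ : Type*} [NormedAddCommGroup E₂] [NormedSpace ℝ E₂] [FiniteDimensional ℝ E₂]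
  {N₂ : Type*} [TopologicalSpace N₂] [ChartedSpace E₂ N₂] [IsManifold 𝓘(ℝ, E₂) ∞ N₂]
  {E : Type*} [NormedAddCommGroup E] [NormedSpace ℝ E] [FiniteDimensional ℝ E]
  {M : Type*} [TopologicalSpace M] [ChartedSpace E M] [IsManifold 𝓘(ℝ, E) ∞ M]
  {S : AlmostContactMetric 𝓘(ℝ, E) M}
  {g₁ : ContMDiffRiemannianMetric 𝓘(ℝ, E₁) ∞ E₁ (fun x : N₁ => TangentSpace 𝓘(ℝ, E₁) x)}
  {g₂ : ContMDiffRiemannianMetric 𝓘(ℝ, E₂) ∞ E₂ (fun x : N₂ => TangentSpace 𝓘(ℝ, E₂) x)}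
  {f : N₁ → ℝ} {F : N₁ × N₂ → M}

/-- The metric `f² g₂` at `x` on the tangent space of the second factor. -/
def fiberMetric (g₂ : ContMDiffRiemannianMetric 𝓘(ℝ, E₂) ∞ E₂
      (fun x : N₂ => TangentSpace 𝓘(ℝ, E₂) x)) (f : N₁ → ℝ) (x : N₁ × N₂) :
    E₂ →L[ℝ] E₂ →L[ℝ] ℝ :=
  f x.1 ^ 2 • (g₂.inner x.2 : E₂ →L[ℝ] E₂ →L[ℝ] ℝ)

theorem fiberMetric_pos (hf_pos : ∀ p, 0 < f p) (x : N₁ × N₂) (u : E₂) (hu : u ≠ 0) :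
    0 < fiberMetric g₂ f x u u := by
  have h₁ := hf_pos x.1
  have h₂ : 0 < (g₂.inner x.2 : E₂ →L[ℝ] E₂ →L[ℝ] ℝ) u u := g₂.pos x.2 u hu
  exact mul_pos (pow_pos h₁ 2) h₂

theorem fiberMetric_symm (x : N₁ × N₂) (u v : E₂) :
    fiberMetric g₂ f x u v = fiberMetric g₂ f x v u :=
  congrArg (fun t => f x.1 ^ 2 * t) (g₂.symm x.2 u v)

theorem warpedSecondFundForm_symm (hF : ContMDiff (𝓘(ℝ, E₁).prod 𝓘(ℝ, E₂)) 𝓘(ℝ, E) ∞ F)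
    (hf : ContMDiff 𝓘(ℝ, E₁) 𝓘(ℝ, ℝ) ∞ f) (hf_pos : ∀ p, 0 < f p)
    (x : N₁ × N₂) (u v : E₁ × E₂) :
    warpedSecondFundForm S.g g₁ g₂ f F x u v = warpedSecondFundForm S.g g₁ g₂ f F x v u := by
  have hP := isSmoothMapOn_chartMap hF x
  have hy := mem_chartMapDomain (I := 𝓘(ℝ, E₁).prod 𝓘(ℝ, E₂)) (J := 𝓘(ℝ, E)) F x
  have hG := isMetricOn_chartMetric S.g (F x)
  have hW := isMetricOn_warpedCoord (isMetricOn_chartMetric g₁ x.1) (isMetricOn_chartMetric g₂ x.2)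
    (fun a ha => contDiffAt_log_chart hf hf_pos x.1 ha)
  rw [extChartAt_prod_apply] at hy
  rw [warpedSecondFundForm, coordSecondFundFormLM_apply, coordSecondFundFormLM_apply,
    coordSecondFundForm, coordSecondFundForm, hP.covDerivAlong_symm hG hy,
    hW.christoffel_symm (chartMapDomain_subset x hy)]

/-- `D₁`-minimality in terms of an orthonormal basis. -/
theorem sum_warpedSecondFundForm_left (hf_pos : ∀ p, 0 < f p)
    (hmin : IsD₁Minimal g₁.inner g₂.inner f S.g.inner F) (x : N₁ × N₂)
    {ι : Type*} [Fintype ι] [DecidableEq ι] {e : Basis ι ℝ E₁}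
    (he : ∀ i j, g₁.inner x.1 (e i) (e j) = if i = j then 1 else 0) :
    ∑ i, warpedSecondFundForm S.g g₁ g₂ f F x (e i, 0) (e i, 0) = 0 := by
  obtain ⟨b₁, hb₁⟩ : ∃ b₁ : E₁ →L[ℝ] E₁ →L[ℝ] ℝ, b₁ = g₁.inner x.1 := ⟨_, rfl⟩
  have h := metricTrace_eq_sum b₁ e (by rw [hb₁]; exact he)
    ((warpedSecondFundForm S.g g₁ g₂ f F x).compl₁₂ (LinearMap.inl ℝ E₁ E₂)
      (LinearMap.inl ℝ E₁ E₂))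
  refine h.symm.trans (Eq.trans ?_ (hmin x))
  rw [hb₁]
  exact congrArg _ (funext fun u => funext fun v =>
    (secondFundForm_eq_warped hf_pos x (u, 0) (v, 0)).symm)

/-- The mixed part of the second fundamental form is determined by the warping function and by the
ambient curvature. -/
theorem sum_warpedSecondFundForm_mixed {c : ℝ} (hS : S.IsCosymplecticSpaceForm c)
    (hf : ContMDiff 𝓘(ℝ, E₁) 𝓘(ℝ, ℝ) ∞ f) (hf_pos : ∀ p, 0 < f p)
    (hF : IsIsometricImmersion 𝓘(ℝ, E) (warpedMetric g₁.inner g₂.inner f) S.g.inner F)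
    (hcontact : IsContactSplitting 𝓘(ℝ, E₁) 𝓘(ℝ, E₂) S F)
    (hmin : IsD₁Minimal g₁.inner g₂.inner f S.g.inner F) (x : N₁ × N₂)
    {ι : Type*} [Fintype ι] [DecidableEq ι] {e : Basis ι ℝ E₁}
    (he : ∀ i j, g₁.inner x.1 (e i) (e j) = if i = j then 1 else 0) {v : E₂}
    (hv : fiberMetric g₂ f x v v = 1) :
    ∑ i, S.g.inner (F x) (warpedSecondFundForm S.g g₁ g₂ f F x (e i, 0) (0, v))
        (warpedSecondFundForm S.g g₁ g₂ f F x (e i, 0) (0, v)) =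
      gradNormSq 𝓘(ℝ, E₁) g₁.inner (fun p => Real.log (f p)) x.1
      - laplacian 𝓘(ℝ, E₁) g₁.inner (fun p => Real.log (f p)) x.1
      + ((Fintype.card ι : ℝ) - 1) * (c / 4) := by
  have hP := isSmoothMapOn_chartMap hF.contMDiff x
  have hy := mem_chartMapDomain (I := 𝓘(ℝ, E₁).prod 𝓘(ℝ, E₂)) (J := 𝓘(ℝ, E)) F x
  have hG := isMetricOn_chartMetric S.g (F x)
  have h₁ := isMetricOn_chartMetric g₁ x.1
  have h₂ := isMetricOn_chartMetric g₂ x.2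
  have hlog := fun a ha => contDiffAt_log_chart hf hf_pos x.1 (y := a) ha
  have hiso := chartMetric_chartMap_warped hF hf_pos x
  have hself := chartMap_self (I := 𝓘(ℝ, E₁).prod 𝓘(ℝ, E₂)) (J := 𝓘(ℝ, E)) F x
  have hFd : MDifferentiableAt (𝓘(ℝ, E₁).prod 𝓘(ℝ, E₂)) 𝓘(ℝ, E) F x :=
    (hF.contMDiff x).mdifferentiableAt (by norm_num)
  have hdF : ∀ u : E₁ × E₂, mfderiv (𝓘(ℝ, E₁).prod 𝓘(ℝ, E₂)) 𝓘(ℝ, E) F x u = _ :=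
    fun u => mfderiv_eq_fderiv_chartMap hFd u
  rw [extChartAt_prod_apply] at hy hself
  simp only [extChartAt_prod_apply] at hdF
  set P := chartMap (𝓘(ℝ, E₁).prod 𝓘(ℝ, E₂)) 𝓘(ℝ, E) F x with hPdef
  set y : E₁ × E₂ := (extChartAt 𝓘(ℝ, E₁) x.1 x.1, extChartAt 𝓘(ℝ, E₂) x.2 x.2) with hydef
  set G := chartMetric 𝓘(ℝ, E) S.g.inner (F x) with hGdef
  obtain ⟨b, hb⟩ : ∃ b : E →L[ℝ] E →L[ℝ] ℝ, b = S.g.inner (F x) := ⟨_, rfl⟩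
  obtain ⟨b₁, hb₁⟩ : ∃ b₁ : E₁ →L[ℝ] E₁ →L[ℝ] ℝ, b₁ = g₁.inner x.1 := ⟨_, rfl⟩
  have hb₁_symm : ∀ a a', b₁ a a' = b₁ a' a := by
    rw [hb₁]
    exact g₁.symm x.1
  obtain ⟨b₂, hb₂⟩ : ∃ b₂ : E₂ →L[ℝ] E₂ →L[ℝ] ℝ, b₂ = g₂.inner x.2 := ⟨_, rfl⟩
  obtain ⟨η, hη⟩ : ∃ η : E →L[ℝ] ℝ, η = S.η (F x) := ⟨_, rfl⟩
  have hGb : ∀ a b' : E, G (P y) a b' = b a b' := by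
    intro a b'
    rw [hself, hb]
    exact chartMetric_self S.g.inner (F x) a b'
  have hG₁ : ∀ a a' : E₁, chartMetric 𝓘(ℝ, E₁) g₁.inner x.1 y.1 a a' = b₁ a a' := by
    rw [hb₁]
    exact chartMetric_self g₁.inner x.1
  have hG₂ : ∀ a a' : E₂, chartMetric 𝓘(ℝ, E₂) g₂.inner x.2 y.2 a a' = b₂ a a' := by
    rw [hb₂]
    exact chartMetric_self g₂.inner x.2
  have hexp : Real.exp (2 * Real.log (f ((extChartAt 𝓘(ℝ, E₁) x.1).symm y.1))) = f x.1 ^ 2 := by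
    rw [hydef, extChartAt_to_inv, two_mul, Real.exp_add, Real.exp_log (hf_pos _), sq]
  have hv' : f x.1 ^ 2 * b₂ v v = 1 := by rw [hb₂]; exact hv
  obtain ⟨ξ, hξ⟩ : ∃ ξ : E, ξ = S.ξ (F x) := ⟨_, rfl⟩
  obtain ⟨u₀, hu₀⟩ : ∃ u₀ : E₁, fderiv ℝ P y (u₀, 0) = ξ := by
    obtain ⟨u₀, hu₀⟩ := hcontact.ξ_mem x
    exact ⟨u₀, (hdF (u₀, 0)).symm.trans (hu₀.trans hξ.symm)⟩
  have hW : ∀ u v : E₁ × E₂, b (fderiv ℝ P y u) (fderiv ℝ P y v) =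
      b₁ u.1 v.1 + f x.1 ^ 2 * b₂ u.2 v.2 := by
    intro u v
    rw [← hGb, hiso y hy, warpedCoord_apply, hexp, hG₁, hG₂]
  have hηb : ∀ a, b a ξ = η a := by
    rw [hb, hη, hξ]
    exact S.inner_ξ (F x)
  have hηξ : η ξ = 1 := by
    rw [hη, hξ]
    exact S.η_ξ (F x)
  have hη' : ∀ u : E₁ × E₂, η (fderiv ℝ P y u) = b₁ u₀ u.1 := by
    intro u
    rw [← hηb, ← hu₀, hW, hb₁_symm]
    simp
  have hu₀' : b₁ u₀ u₀ = 1 := by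
    rw [← hη' (u₀, 0), hu₀, hηξ]
  have hc : ∀ u, G (P y) (coordCurvature G (P y) (fderiv ℝ P y (u, 0)) (fderiv ℝ P y (0, v))
        (fderiv ℝ P y (0, v))) (fderiv ℝ P y (u, 0)) =
      c / 4 * (chartMetric 𝓘(ℝ, E₁) g₁.inner x.1 y.1 u u
        - chartMetric 𝓘(ℝ, E₁) g₁.inner x.1 y.1 u₀ u ^ 2) := by
    intro u
    have h₁ : η (fderiv ℝ P y (0, v)) = 0 := by rw [hη', map_zero]
    have h₂ : b (fderiv ℝ P y (u, 0)) (fderiv ℝ P y (0, v)) = 0 := by rw [hW]; simp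
    have h : G (P y) (coordCurvature G (P y) (fderiv ℝ P y (u, 0)) (fderiv ℝ P y (0, v))
        (fderiv ℝ P y (0, v))) (fderiv ℝ P y (u, 0)) =
        c / 4 * ((b (fderiv ℝ P y (u, 0)) (fderiv ℝ P y (u, 0)) - η (fderiv ℝ P y (u, 0)) ^ 2)
          * b (fderiv ℝ P y (0, v)) (fderiv ℝ P y (0, v))) := by
      rw [hη] at h₁ ⊢
      rw [hb] at h₂ ⊢
      rw [hself]
      exact hS.curvature_eq (F x) (u := fderiv ℝ P y (u, 0)) (v := fderiv ℝ P y (0, v)) h₁ h₂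
        (by rw [← hdF, ← hdF]; exact hcontact.φ_orthogonal x u v)
    rw [h, hW, hW, hη', hG₁, hG₁]
    simp [hv']
  have hmin' := sum_warpedSecondFundForm_left hf_pos hmin x he
  have key := sum_mixed_sq h₁ h₂ hlog hG hP (chartMapDomain_subset x) hiso hy (e := e)
    (fun i j => (hG₁ _ _).trans (by rw [hb₁]; exact he i j)) (u₀ := u₀) ((hG₁ _ _).trans hu₀')
    (v := v) (by rw [hexp, hG₂]; exact hv') hc hmin'
  have hfd : MDifferentiableAt 𝓘(ℝ, E₁) 𝓘(ℝ, ℝ) (fun p => Real.log (f p)) x.1 :=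
    (Real.differentiableAt_log (hf_pos x.1).ne').mdifferentiableAt.comp x.1
      ((hf x.1).mdifferentiableAt (by norm_num))
  rw [gradNormSq_eq_sum hfd he, laplacian_eq_sum he, ← key, ← hb]
  exact Finset.sum_congr rfl fun i _ => (hGb _ _).symm

theorem secondFundFormNormSq_warped (hF : ContMDiff (𝓘(ℝ, E₁).prod 𝓘(ℝ, E₂)) 𝓘(ℝ, E) ∞ F)
    (hf : ContMDiff 𝓘(ℝ, E₁) 𝓘(ℝ, ℝ) ∞ f) (hf_pos : ∀ p, 0 < f p) (x : N₁ × N₂)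
    {ι κ : Type*} [Fintype ι] [DecidableEq ι] [Fintype κ] [DecidableEq κ]
    {e : Basis ι ℝ E₁} (he : ∀ i j, g₁.inner x.1 (e i) (e j) = if i = j then 1 else 0)
    {d : Basis κ ℝ E₂} (hd : ∀ i j, fiberMetric g₂ f x (d i) (d j) = if i = j then 1 else 0) :
    secondFundFormNormSq (warpedMetric g₁.inner g₂.inner f) S.g.inner F x =
      ∑ i, ∑ j, S.g.inner (F x) (warpedSecondFundForm S.g g₁ g₂ f F x (e i, 0) (e j, 0))
        (warpedSecondFundForm S.g g₁ g₂ f F x (e i, 0) (e j, 0))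
      + 2 * ∑ a, ∑ i, S.g.inner (F x) (warpedSecondFundForm S.g g₁ g₂ f F x (e i, 0) (0, d a))
        (warpedSecondFundForm S.g g₁ g₂ f F x (e i, 0) (0, d a))
      + ∑ a, ∑ a', S.g.inner (F x) (warpedSecondFundForm S.g g₁ g₂ f F x (0, d a) (0, d a'))
        (warpedSecondFundForm S.g g₁ g₂ f F x (0, d a) (0, d a')) := by
  let b : E₁ × E₂ →L[ℝ] E₁ × E₂ →L[ℝ] ℝ := warpedMetric g₁.inner g₂.inner f x
  let b₁ : E₁ →L[ℝ] E₁ →L[ℝ] ℝ := g₁.inner x.1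
  let g : E →L[ℝ] E →L[ℝ] ℝ := S.g.inner (F x)
  refine Eq.trans ?_ (metricTrace_metricTrace_prod (b := b) (b₁ := b₁) (b₂ := fiberMetric g₂ f x)
    (warpedMetric_apply x) he hd g (warpedSecondFundForm S.g g₁ g₂ f F x)
    (warpedSecondFundForm_symm hF hf hf_pos x))
  have h : ∀ u v : E₁ × E₂, secondFundForm (warpedMetric g₁.inner g₂.inner f) S.g.inner F x u v =
      warpedSecondFundForm S.g g₁ g₂ f F x u v := secondFundForm_eq_warped hf_pos x
  change metricTrace b (fun u u' => metricTrace b fun v v' =>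
    g (secondFundForm (warpedMetric g₁.inner g₂.inner f) S.g.inner F x u v)
      (secondFundForm (warpedMetric g₁.inner g₂.inner f) S.g.inner F x u' v')) = _
  refine congrArg _ (funext fun u => funext fun u' => congrArg _ (funext fun v => funext fun v' => ?_))
  exact congrArg₂ (fun a a' => g a a') (h u v) (h u' v')

/-- The squared norm of the second fundamental form exceeds the bound by the squared norms of its
restrictions to the two factors. -/
theorem secondFundFormNormSq_eq {c : ℝ} (hS : S.IsCosymplecticSpaceForm c)
    (hf : ContMDiff 𝓘(ℝ, E₁) 𝓘(ℝ, ℝ) ∞ f) (hf_pos : ∀ p, 0 < f p)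
    (hF : IsIsometricImmersion 𝓘(ℝ, E) (warpedMetric g₁.inner g₂.inner f) S.g.inner F)
    (hcontact : IsContactSplitting 𝓘(ℝ, E₁) 𝓘(ℝ, E₂) S F)
    (hmin : IsD₁Minimal g₁.inner g₂.inner f S.g.inner F) (x : N₁ × N₂)
    {ι κ : Type*} [Fintype ι] [DecidableEq ι] [Fintype κ] [DecidableEq κ]
    {e : Basis ι ℝ E₁} (he : ∀ i j, g₁.inner x.1 (e i) (e j) = if i = j then 1 else 0)
    {d : Basis κ ℝ E₂} (hd : ∀ i j, fiberMetric g₂ f x (d i) (d j) = if i = j then 1 else 0) :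
    secondFundFormNormSq (warpedMetric g₁.inner g₂.inner f) S.g.inner F x =
      2 * (finrank ℝ E₂ : ℝ) * (gradNormSq 𝓘(ℝ, E₁) g₁.inner (fun p => Real.log (f p)) x.1
          - laplacian 𝓘(ℝ, E₁) g₁.inner (fun p => Real.log (f p)) x.1
          + ((finrank ℝ E₁ : ℝ) - 1) * (c / 4))
      + ∑ i, ∑ j, S.g.inner (F x) (warpedSecondFundForm S.g g₁ g₂ f F x (e i, 0) (e j, 0))
        (warpedSecondFundForm S.g g₁ g₂ f F x (e i, 0) (e j, 0))
      + ∑ a, ∑ a', S.g.inner (F x) (warpedSecondFundForm S.g g₁ g₂ f F x (0, d a) (0, d a'))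
        (warpedSecondFundForm S.g g₁ g₂ f F x (0, d a) (0, d a')) := by
  rw [secondFundFormNormSq_warped hF.contMDiff hf hf_pos x he hd]
  have key : ∀ a, _ = _ := fun a =>
    sum_warpedSecondFundForm_mixed hS hf hf_pos hF hcontact hmin x he (v := d a)
      (by rw [hd, if_pos rfl])
  simp only [key, Finset.sum_const, Finset.card_univ, finrank_eq_card_basis e,
    finrank_eq_card_basis d, nsmul_eq_mul]
  ring

end Inequality

/-! ### The leaves of the product -/

section Leaves

set_option linter.unusedSectionVars false

variable {E₁ : Type*} [NormedAddCommGroup E₁] [NormedSpace ℝ E₁] [FiniteDimensional ℝ E₁]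
  {N₁ : Type*} [TopologicalSpace N₁] [ChartedSpace E₁ N₁] [IsManifold 𝓘(ℝ, E₁) ∞ N₁]
  {E₂ : Type*} [NormedAddCommGroup E₂] [NormedSpace ℝ E₂] [FiniteDimensional ℝ E₂]
  {N₂ : Type*} [TopologicalSpace N₂] [ChartedSpace E₂ N₂] [IsManifold 𝓘(ℝ, E₂) ∞ N₂]
  {E : Type*} [NormedAddCommGroup E] [NormedSpace ℝ E] [FiniteDimensional ℝ E]
  {M : Type*} [TopologicalSpace M] [ChartedSpace E M] [IsManifold 𝓘(ℝ, E) ∞ M]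
  {S : AlmostContactMetric 𝓘(ℝ, E) M}
  {g₁ : ContMDiffRiemannianMetric 𝓘(ℝ, E₁) ∞ E₁ (fun x : N₁ => TangentSpace 𝓘(ℝ, E₁) x)}
  {g₂ : ContMDiffRiemannianMetric 𝓘(ℝ, E₂) ∞ E₂ (fun x : N₂ => TangentSpace 𝓘(ℝ, E₂) x)}
  {f : N₁ → ℝ} {F : N₁ × N₂ → M}

theorem inducedMetric_eq_warpedMetric
    (hF : IsIsometricImmersion 𝓘(ℝ, E) (warpedMetric g₁.inner g₂.inner f) S.g.inner F) :
    inducedMetric (𝓘(ℝ, E₁).prod 𝓘(ℝ, E₂)) S.g.inner F = warpedMetric g₁.inner g₂.inner f :=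
  funext fun x => ContinuousLinearMap.ext fun u => ContinuousLinearMap.ext fun v =>
    hF.isometric x u v

theorem mfderiv_slice_left (hF : ContMDiff (𝓘(ℝ, E₁).prod 𝓘(ℝ, E₂)) 𝓘(ℝ, E) ∞ F) (x : N₁ × N₂)
    (u : E₁) : mfderiv 𝓘(ℝ, E₁) 𝓘(ℝ, E) (fun p => F (p, x.2)) x.1 u =
      mfderiv (𝓘(ℝ, E₁).prod 𝓘(ℝ, E₂)) 𝓘(ℝ, E) F x ((u, 0) : E₁ × E₂) := by
  have h := mfderiv_comp x.1 (g := F) (f := fun p => (p, x.2))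
    ((hF x).mdifferentiableAt (by norm_num))
    (mdifferentiableAt_id.prodMk (mdifferentiableAt_const (I' := 𝓘(ℝ, E₂))))
  rw [mfderiv_prod_left] at h
  exact congrArg (fun T : E₁ →L[ℝ] E => T u) h

theorem mfderiv_slice_right (hF : ContMDiff (𝓘(ℝ, E₁).prod 𝓘(ℝ, E₂)) 𝓘(ℝ, E) ∞ F) (x : N₁ × N₂)
    (u : E₂) : mfderiv 𝓘(ℝ, E₂) 𝓘(ℝ, E) (fun q => F (x.1, q)) x.2 u =
      mfderiv (𝓘(ℝ, E₁).prod 𝓘(ℝ, E₂)) 𝓘(ℝ, E) F x ((0, u) : E₁ × E₂) := by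
  have h := mfderiv_comp x.2 (g := F) (f := fun q => (x.1, q))
    ((hF x).mdifferentiableAt (by norm_num))
    ((mdifferentiableAt_const (I' := 𝓘(ℝ, E₁))).prodMk mdifferentiableAt_id)
  rw [mfderiv_prod_right] at h
  exact congrArg (fun T : E₂ →L[ℝ] E => T u) h

theorem inducedMetric_slice_left
    (hF : IsIsometricImmersion 𝓘(ℝ, E) (warpedMetric g₁.inner g₂.inner f) S.g.inner F) (q : N₂) :
    inducedMetric 𝓘(ℝ, E₁) S.g.inner (fun p => F (p, q)) = g₁.inner := by
  refine funext fun p => ContinuousLinearMap.ext fun u => ContinuousLinearMap.ext fun v => ?_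
  let b : E →L[ℝ] E →L[ℝ] ℝ := S.g.inner (F (p, q))
  have h := hF.isometric (p, q) ((u, 0) : E₁ × E₂) ((v, 0) : E₁ × E₂)
  refine (congrArg₂ (fun s t => b s t) (mfderiv_slice_left hF.contMDiff (p, q) u)
    (mfderiv_slice_left hF.contMDiff (p, q) v)).trans (h.trans ?_)
  have key : ∀ (b₁ : E₁ →L[ℝ] E₁ →L[ℝ] ℝ) (b₂ : E₂ →L[ℝ] E₂ →L[ℝ] ℝ) (w w' : E₁),
      b₁ w w' + b₂ 0 0 = b₁ w w' := by simp
  exact (warpedMetric_apply (E₁ := E₁) (E₂ := E₂) (p, q) (u, 0) (v, 0)).trans (key _ _ u v)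

theorem inducedMetric_slice_right
    (hF : IsIsometricImmersion 𝓘(ℝ, E) (warpedMetric g₁.inner g₂.inner f) S.g.inner F) (p : N₁) :
    inducedMetric 𝓘(ℝ, E₂) S.g.inner (fun q => F (p, q)) =
      fun q => fiberMetric (E₂ := E₂) g₂ f (p, q) := by
  refine funext fun q => ContinuousLinearMap.ext fun u => ContinuousLinearMap.ext fun v => ?_
  let b : E →L[ℝ] E →L[ℝ] ℝ := S.g.inner (F (p, q))
  have h := hF.isometric (p, q) ((0, u) : E₁ × E₂) ((0, v) : E₁ × E₂)
  refine (congrArg₂ (fun s t => b s t) (mfderiv_slice_right hF.contMDiff (p, q) u)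
    (mfderiv_slice_right hF.contMDiff (p, q) v)).trans (h.trans ?_)
  have key : ∀ (b₁ : E₁ →L[ℝ] E₁ →L[ℝ] ℝ) (b₂ : E₂ →L[ℝ] E₂ →L[ℝ] ℝ) (w w' : E₂),
      b₁ 0 0 + b₂ w w' = b₂ w w' := by simp
  exact (warpedMetric_apply (E₁ := E₁) (E₂ := E₂) (p, q) (0, u) (0, v)).trans (key _ _ u v)

theorem chartMap_slice_left (x : N₁ × N₂) :
    chartMap 𝓘(ℝ, E₁) 𝓘(ℝ, E) (fun p => F (p, x.2)) x.1 =
      chartMap (𝓘(ℝ, E₁).prod 𝓘(ℝ, E₂)) 𝓘(ℝ, E) F x ∘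
        fun z => (z, extChartAt 𝓘(ℝ, E₂) x.2 x.2) := by
  funext z
  have h := extChartAt_to_inv (I := 𝓘(ℝ, E₂)) x.2
  simp only [chartMap, Function.comp_apply, extChartAt_prod, PartialEquiv.prod_symm,
    PartialEquiv.prod_coe, h]

theorem chartMap_slice_right (x : N₁ × N₂) :
    chartMap 𝓘(ℝ, E₂) 𝓘(ℝ, E) (fun q => F (x.1, q)) x.2 =
      chartMap (𝓘(ℝ, E₁).prod 𝓘(ℝ, E₂)) 𝓘(ℝ, E) F x ∘
        fun z => (extChartAt 𝓘(ℝ, E₁) x.1 x.1, z) := by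
  funext z
  have h := extChartAt_to_inv (I := 𝓘(ℝ, E₁)) x.1
  simp only [chartMap, Function.comp_apply, extChartAt_prod, PartialEquiv.prod_symm,
    PartialEquiv.prod_coe, h]

/-- The leaves `N₁ × {q}` are totally geodesic in the warped product, so that their second
fundamental form in the ambient space is the restriction of that of the warped product. -/
theorem secondFundForm_slice_left
    (hf : ContMDiff 𝓘(ℝ, E₁) 𝓘(ℝ, ℝ) ∞ f) (hf_pos : ∀ p, 0 < f p)
    (hF : IsIsometricImmersion 𝓘(ℝ, E) (warpedMetric g₁.inner g₂.inner f) S.g.inner F)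
    (x : N₁ × N₂) (u v : E₁) :
    secondFundForm (inducedMetric 𝓘(ℝ, E₁) S.g.inner (fun p => F (p, x.2))) S.g.inner
      (fun p => F (p, x.2)) x.1 u v = warpedSecondFundForm S.g g₁ g₂ f F x (u, 0) (v, 0) := by
  have hy := mem_chartMapDomain (I := 𝓘(ℝ, E₁).prod 𝓘(ℝ, E₂)) (J := 𝓘(ℝ, E)) F x
  rw [extChartAt_prod_apply] at hy
  have h := fun a b => (isSmoothMapOn_chartMap hF.contMDiff x).covDerivAlong_comp
    (chartMetric 𝓘(ℝ, E) S.g.inner (F x))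
    (j := fun z => (z, extChartAt 𝓘(ℝ, E₂) x.2 x.2)) (L := ContinuousLinearMap.inl ℝ E₁ E₂)
    (fun z => hasFDerivAt_prodMk_left z _) hy a b
  rw [inducedMetric_slice_left hF, secondFundForm_eq, chartMap_slice_left (E₁ := E₁) (E₂ := E₂) x, warpedSecondFundForm,
    coordSecondFundFormLM_apply, coordSecondFundForm, coordSecondFundForm,
    christoffel_warpedCoord (isMetricOn_chartMetric g₁ x.1) (isMetricOn_chartMetric g₂ x.2)
      (fun a ha => contDiffAt_log_chart hf hf_pos x.1 ha) (chartMapDomain_subset x hy),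
    (h _ v).1, (h u v).2]
  congr 2
  ext <;> simp [christoffel_eq_christoffelCLM]

/-- The leaves `{p} × N₂` are totally umbilical in the warped product. -/
theorem exists_secondFundForm_slice_right
    (hf : ContMDiff 𝓘(ℝ, E₁) 𝓘(ℝ, ℝ) ∞ f) (hf_pos : ∀ p, 0 < f p)
    (hF : IsIsometricImmersion 𝓘(ℝ, E) (warpedMetric g₁.inner g₂.inner f) S.g.inner F)
    (x : N₁ × N₂) : ∃ N : E, ∀ u v : E₂,
    secondFundForm (inducedMetric 𝓘(ℝ, E₂) S.g.inner (fun q => F (x.1, q))) S.g.inner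
      (fun q => F (x.1, q)) x.2 u v =
      warpedSecondFundForm S.g g₁ g₂ f F x (0, u) (0, v) - fiberMetric g₂ f x u v • N := by
  have hy := mem_chartMapDomain (I := 𝓘(ℝ, E₁).prod 𝓘(ℝ, E₂)) (J := 𝓘(ℝ, E)) F x
  rw [extChartAt_prod_apply] at hy
  have h := fun a b => (isSmoothMapOn_chartMap hF.contMDiff x).covDerivAlong_comp
    (chartMetric 𝓘(ℝ, E) S.g.inner (F x))
    (j := fun z => (extChartAt 𝓘(ℝ, E₁) x.1 x.1, z)) (L := ContinuousLinearMap.inr ℝ E₁ E₂)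
    (fun z => hasFDerivAt_prodMk_right _ z) hy a b
  have hc : ∀ u v, christoffel (chartMetric 𝓘(ℝ, E₂)
        (inducedMetric 𝓘(ℝ, E₂) S.g.inner (fun q => F (x.1, q))) x.2)
      (extChartAt 𝓘(ℝ, E₂) x.2 x.2) u v =
      christoffel (chartMetric 𝓘(ℝ, E₂) g₂.inner x.2) (extChartAt 𝓘(ℝ, E₂) x.2 x.2) u v := by
    intro u v
    refine (congrArg (fun k => christoffel (chartMetric 𝓘(ℝ, E₂) k x.2) _ u v)
      (inducedMetric_slice_right hF x.1)).trans ?_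
    exact (isMetricOn_chartMetric g₂ x.2).christoffel_const_smul (pow_pos (hf_pos x.1) 2)
      (mem_extChartAt_target x.2) u v
  have hg : ∀ a a' : E₂, chartMetric 𝓘(ℝ, E₂) g₂.inner x.2 (extChartAt 𝓘(ℝ, E₂) x.2 x.2) a a' =
      g₂.inner x.2 a a' := chartMetric_self g₂.inner x.2
  have hexp : Real.exp (2 * Real.log (f ((extChartAt 𝓘(ℝ, E₁) x.1).symm
      (extChartAt 𝓘(ℝ, E₁) x.1 x.1)))) = f x.1 ^ 2 := by
    rw [extChartAt_to_inv, two_mul, Real.exp_add, Real.exp_log (hf_pos _), sq]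
  refine ⟨fderiv ℝ (chartMap (𝓘(ℝ, E₁).prod 𝓘(ℝ, E₂)) 𝓘(ℝ, E) F x)
    (extChartAt 𝓘(ℝ, E₁) x.1 x.1, extChartAt 𝓘(ℝ, E₂) x.2 x.2)
    ((chartMetric 𝓘(ℝ, E₁) g₁.inner x.1 (extChartAt 𝓘(ℝ, E₁) x.1 x.1)).inverse (fderiv ℝ
      (fun z => Real.log (f ((extChartAt 𝓘(ℝ, E₁) x.1).symm z)))
      (extChartAt 𝓘(ℝ, E₁) x.1 x.1)), 0), fun u v => ?_⟩
  have hfib : fiberMetric g₂ f x u v = f x.1 ^ 2 * chartMetric 𝓘(ℝ, E₂) g₂.inner x.2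
      (extChartAt 𝓘(ℝ, E₂) x.2 x.2) u v := by
    rw [hg]
    rfl
  rw [secondFundForm_eq, chartMap_slice_right (E₁ := E₁) (E₂ := E₂) x, warpedSecondFundForm,
    coordSecondFundFormLM_apply, coordSecondFundForm, coordSecondFundForm,
    christoffel_warpedCoord (isMetricOn_chartMetric g₁ x.1) (isMetricOn_chartMetric g₂ x.2)
      (fun a ha => contDiffAt_log_chart hf hf_pos x.1 ha) (chartMapDomain_subset x hy),
    (h _ v).1, (h u v).2, hc, hexp, hfib, sub_sub]
  have key : ∀ (T : E₁ × E₂ →L[ℝ] E) (w w' n : E₁ × E₂) (t : ℝ), w = w' + t • n →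
      T w = T w' + t • T n := by
    rintro T w w' n t rfl
    rw [map_add, map_smul]
  refine congrArg (fun w : E => _ - w) (key _ _ _ _ _ ?_)
  ext <;> simp [christoffel_eq_christoffelCLM]

end Leaves

/-! ### The equality case -/

section Umbilical

variable {X : Type*} [NormedAddCommGroup X] [NormedSpace ℝ X] [FiniteDimensional ℝ X]
  {E : Type*} [NormedAddCommGroup E] [NormedSpace ℝ E]

/-- Subtracting a pure trace part `b ⊗ N` from a trace-free form `B` gives an umbilical form if and
only if `B` vanishes. -/
theorem umbilical_iff_eq_zero {ι : Type*} [Fintype ι] [DecidableEq ι] {b : X →L[ℝ] X →L[ℝ] ℝ}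
    {d : Basis ι ℝ X} (hd : ∀ i j, b (d i) (d j) = if i = j then 1 else 0)
    (B : X →ₗ[ℝ] X →ₗ[ℝ] E) (hB : ∑ i, B (d i) (d i) = 0) (N : E) :
    (∀ u v, B u v - b u v • N =
      b u v • ((finrank ℝ X : ℝ)⁻¹ • metricTrace b fun u v => B u v - b u v • N)) ↔
    ∀ u v, B u v = 0 := by
  let B' : X →ₗ[ℝ] X →ₗ[ℝ] E := LinearMap.mk₂ ℝ (fun u v => B u v - b u v • N)
    (fun u u' v => by simp only [map_add, add_apply, LinearMap.add_apply, add_smul]; abel)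
    (fun t u v => by simp only [map_smul, smul_apply, LinearMap.smul_apply, smul_sub, smul_assoc])
    (fun u v v' => by simp only [map_add, add_smul]; abel)
    (fun t u v => by simp only [map_smul, smul_sub, smul_assoc])
  have htr : (metricTrace b fun u v => B u v - b u v • N) = -((finrank ℝ X : ℝ) • N) := by
    refine (metricTrace_eq_sum b d hd B').trans ?_
    change ∑ i, (B (d i) (d i) - b (d i) (d i) • N) = _
    rw [Finset.sum_sub_distrib, hB, zero_sub, finrank_eq_card_basis d, Nat.cast_smul_eq_nsmul]
    simp [hd]
  rw [htr]
  rcases eq_or_ne (finrank ℝ X) 0 with h0 | h0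
  · have := finrank_zero_iff.1 h0
    refine iff_of_true (fun u v => ?_) (fun u v => ?_) <;> simp [Subsingleton.elim u 0]
  · have h0' : (finrank ℝ X : ℝ) ≠ 0 := Nat.cast_ne_zero.2 h0
    refine forall₂_congr fun u v => ?_
    rw [smul_neg, inv_smul_smul₀ h0', smul_neg, sub_eq_add_neg, add_eq_right]

end Umbilical

section Equality

set_option linter.unusedSectionVars false

variable {E₁ : Type*} [NormedAddCommGroup E₁] [NormedSpace ℝ E₁] [FiniteDimensional ℝ E₁]
  {N₁ : Type*} [TopologicalSpace N₁] [ChartedSpace E₁ N₁] [IsManifold 𝓘(ℝ, E₁) ∞ N₁]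
  {E₂ : Type*} [NormedAddCommGroup E₂] [NormedSpace ℝ E₂] [FiniteDimensional ℝ E₂]
  {N₂ : Type*} [TopologicalSpace N₂] [ChartedSpace E₂ N₂] [IsManifold 𝓘(ℝ, E₂) ∞ N₂]
  {E : Type*} [NormedAddCommGroup E] [NormedSpace ℝ E] [FiniteDimensional ℝ E]
  {M : Type*} [TopologicalSpace M] [ChartedSpace E M] [IsManifold 𝓘(ℝ, E) ∞ M]
  {S : AlmostContactMetric 𝓘(ℝ, E) M}
  {g₁ : ContMDiffRiemannianMetric 𝓘(ℝ, E₁) ∞ E₁ (fun x : N₁ => TangentSpace 𝓘(ℝ, E₁) x)}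
  {g₂ : ContMDiffRiemannianMetric 𝓘(ℝ, E₂) ∞ E₂ (fun x : N₂ => TangentSpace 𝓘(ℝ, E₂) x)}
  {f : N₁ → ℝ} {F : N₁ × N₂ → M}

theorem isTotallyGeodesic_slice_iff
    (hf : ContMDiff 𝓘(ℝ, E₁) 𝓘(ℝ, ℝ) ∞ f) (hf_pos : ∀ p, 0 < f p)
    (hF : IsIsometricImmersion 𝓘(ℝ, E) (warpedMetric g₁.inner g₂.inner f) S.g.inner F) :
    (∀ q : N₂, IsTotallyGeodesic 𝓘(ℝ, E₁) S.g.inner (fun p : N₁ => F (p, q))) ↔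
      ∀ (x : N₁ × N₂) (u v : E₁), warpedSecondFundForm S.g g₁ g₂ f F x (u, 0) (v, 0) = 0 :=
  ⟨fun h x u v => (secondFundForm_slice_left hf hf_pos hF x u v).symm.trans (h x.2 x.1 u v),
    fun h q p u v => (secondFundForm_slice_left hf hf_pos hF (p, q) u v).trans (h (p, q) u v)⟩

/-- A leaf `{p} × N₂` along which the second fundamental form of the warped product is trace-free
is totally umbilical if and only if this form vanishes on it. -/
theorem isTotallyUmbilical_slice_iff
    (hf : ContMDiff 𝓘(ℝ, E₁) 𝓘(ℝ, ℝ) ∞ f) (hf_pos : ∀ p, 0 < f p)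
    (hF : IsIsometricImmersion 𝓘(ℝ, E) (warpedMetric g₁.inner g₂.inner f) S.g.inner F)
    {ι : Type*} [Fintype ι] [DecidableEq ι] {d : N₁ × N₂ → Basis ι ℝ E₂}
    (hd : ∀ x i j, fiberMetric g₂ f x (d x i) (d x j) = if i = j then 1 else 0)
    (htr : ∀ x, ∑ a, warpedSecondFundForm S.g g₁ g₂ f F x (0, d x a) (0, d x a) = 0) :
    (∀ p : N₁, IsTotallyUmbilical 𝓘(ℝ, E₂) S.g.inner (fun q : N₂ => F (p, q))) ↔
      ∀ (x : N₁ × N₂) (u v : E₂), warpedSecondFundForm S.g g₁ g₂ f F x (0, u) (0, v) = 0 := by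
  have key : ∀ x : N₁ × N₂,
      (∀ u v : E₂, secondFundForm (inducedMetric 𝓘(ℝ, E₂) S.g.inner (fun q => F (x.1, q)))
        S.g.inner (fun q => F (x.1, q)) x.2 u v =
        inducedMetric 𝓘(ℝ, E₂) S.g.inner (fun q => F (x.1, q)) x.2 u v •
          meanCurvature (inducedMetric 𝓘(ℝ, E₂) S.g.inner (fun q => F (x.1, q)))
            S.g.inner (fun q => F (x.1, q)) x.2) ↔
      ∀ u v : E₂, warpedSecondFundForm S.g g₁ g₂ f F x (0, u) (0, v) = 0 := by
    intro x
    obtain ⟨N, hN⟩ := exists_secondFundForm_slice_right hf hf_pos hF x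
    refine Iff.trans ?_ (umbilical_iff_eq_zero (hd x)
      ((warpedSecondFundForm S.g g₁ g₂ f F x).compl₁₂ (LinearMap.inr ℝ E₁ E₂)
        (LinearMap.inr ℝ E₁ E₂)) (htr x) N)
    have hg : (inducedMetric 𝓘(ℝ, E₂) S.g.inner (fun q => F (x.1, q)) x.2 :
        E₂ →L[ℝ] E₂ →L[ℝ] ℝ) = fiberMetric g₂ f x :=
      congrFun (inducedMetric_slice_right hF x.1) x.2
    obtain ⟨k, hk⟩ : ∃ k : E₂ → E₂ → E, k =
      secondFundForm (inducedMetric 𝓘(ℝ, E₂) S.g.inner (fun q => F (x.1, q)))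
        S.g.inner (fun q => F (x.1, q)) x.2 := ⟨_, rfl⟩
    obtain ⟨b, hb⟩ : ∃ b : E₂ →L[ℝ] E₂ →L[ℝ] ℝ, b =
      inducedMetric 𝓘(ℝ, E₂) S.g.inner (fun q => F (x.1, q)) x.2 := ⟨_, rfl⟩
    have hk' : k = fun u v =>
        warpedSecondFundForm S.g g₁ g₂ f F x (0, u) (0, v) - fiberMetric g₂ f x u v • N := by
      rw [hk]
      exact funext fun u => funext fun v => hN u v
    have hb' : b = fiberMetric g₂ f x := hb.trans hg
    have main : (∀ u v : E₂, k u v = b u v • ((finrank ℝ E₂ : ℝ)⁻¹ • metricTrace b k)) ↔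
        ∀ u v, warpedSecondFundForm S.g g₁ g₂ f F x (0, u) (0, v) - fiberMetric g₂ f x u v • N =
          fiberMetric g₂ f x u v • ((finrank ℝ E₂ : ℝ)⁻¹ • metricTrace (fiberMetric g₂ f x)
            fun u v => warpedSecondFundForm S.g g₁ g₂ f F x (0, u) (0, v)
              - fiberMetric g₂ f x u v • N) := by
      rw [hb', hk']
    rw [hk, hb] at main
    exact main
  exact ⟨fun h x => (key x).1 (h x.1 x.2), fun h p q => (key (p, q)).2 (h (p, q))⟩

/-- A `D₁`-minimal immersion is minimal if and only if its trace over `D₂` vanishes. -/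
theorem isMinimal_iff (hf_pos : ∀ p, 0 < f p)
    (hF : IsIsometricImmersion 𝓘(ℝ, E) (warpedMetric g₁.inner g₂.inner f) S.g.inner F)
    (hmin : IsD₁Minimal g₁.inner g₂.inner f S.g.inner F)
    {ι κ : Type*} [Fintype ι] [DecidableEq ι] [Fintype κ] [DecidableEq κ]
    {e : N₁ × N₂ → Basis ι ℝ E₁}
    (he : ∀ x i j, g₁.inner x.1 (e x i) (e x j) = if i = j then 1 else 0)
    {d : N₁ × N₂ → Basis κ ℝ E₂}
    (hd : ∀ x i j, fiberMetric g₂ f x (d x i) (d x j) = if i = j then 1 else 0) :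
    IsMinimal (𝓘(ℝ, E₁).prod 𝓘(ℝ, E₂)) S.g.inner F ↔
      ∀ x, ∑ a, warpedSecondFundForm S.g g₁ g₂ f F x (0, d x a) (0, d x a) = 0 := by
  have htr : ∀ x, meanCurvature (warpedMetric g₁.inner g₂.inner f) S.g.inner F x =
      (finrank ℝ (E₁ × E₂) : ℝ)⁻¹ •
        ∑ a, warpedSecondFundForm S.g g₁ g₂ f F x (0, d x a) (0, d x a) := by
    intro x
    let b : E₁ × E₂ →L[ℝ] E₁ × E₂ →L[ℝ] ℝ := warpedMetric g₁.inner g₂.inner f x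
    let b₁ : E₁ →L[ℝ] E₁ →L[ℝ] ℝ := g₁.inner x.1
    have h := metricTrace_prod (b := b) (b₁ := b₁) (b₂ := fiberMetric g₂ f x)
      (warpedMetric_apply x) (he x) (hd x) (warpedSecondFundForm S.g g₁ g₂ f F x)
    rw [sum_warpedSecondFundForm_left hf_pos hmin x (he x), zero_add] at h
    rw [← h]
    exact congrArg (fun k : E₁ × E₂ → E₁ × E₂ → E =>
      (finrank ℝ (E₁ × E₂) : ℝ)⁻¹ • metricTrace b k)
      (funext fun u => funext fun v => secondFundForm_eq_warped hf_pos x u v)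
  rw [IsMinimal, inducedMetric_eq_warpedMetric hF]
  refine forall_congr' fun x => ?_
  have hx : (finrank ℝ (E₁ × E₂) : ℝ)⁻¹ •
      ∑ a, warpedSecondFundForm S.g g₁ g₂ f F x (0, d x a) (0, d x a) = 0 ↔
      ∑ a, warpedSecondFundForm S.g g₁ g₂ f F x (0, d x a) (0, d x a) = 0 := by
    rw [smul_eq_zero, inv_eq_zero, Nat.cast_eq_zero, or_iff_right_iff_imp]
    intro h0
    -- in dimension zero all vectors vanish
    have := finrank_zero_iff.1 h0
    simp [Subsingleton.elim (α := E₁ × E₂) (0, _) 0]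
  rw [← hx, ← htr x]
  rfl

end Equality

theorem theorem4p1
    {E₁ : Type*} [NormedAddCommGroup E₁] [NormedSpace ℝ E₁] [FiniteDimensional ℝ E₁]
    {N₁ : Type*} [TopologicalSpace N₁] [ChartedSpace E₁ N₁] [IsManifold 𝓘(ℝ, E₁) ∞ N₁]
    {E₂ : Type*} [NormedAddCommGroup E₂] [NormedSpace ℝ E₂] [FiniteDimensional ℝ E₂]
    {N₂ : Type*} [TopologicalSpace N₂] [ChartedSpace E₂ N₂] [IsManifold 𝓘(ℝ, E₂) ∞ N₂]
    {E : Type*} [NormedAddCommGroup E] [NormedSpace ℝ E] [FiniteDimensional ℝ E]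
    {M : Type*} [TopologicalSpace M] [ChartedSpace E M] [IsManifold 𝓘(ℝ, E) ∞ M]
    (n₁ n₂ m : ℕ) (hn₁ : finrank ℝ E₁ = n₁) (hn₂ : finrank ℝ E₂ = n₂)
    (hm : finrank ℝ E = 2 * m + 1)
    -- the ambient cosymplectic space form of constant `φ`-sectional curvature `c`
    (c : ℝ) (S : AlmostContactMetric 𝓘(ℝ, E) M) (hS : S.IsCosymplecticSpaceForm c)
    -- the warped product of `N₁` and `N₂` with warping function `f`
    (g₁ : ContMDiffRiemannianMetric 𝓘(ℝ, E₁) ∞ E₁ (fun x : N₁ => TangentSpace 𝓘(ℝ, E₁) x))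
    (g₂ : ContMDiffRiemannianMetric 𝓘(ℝ, E₂) ∞ E₂ (fun x : N₂ => TangentSpace 𝓘(ℝ, E₂) x))
    (f : N₁ → ℝ) (hf : ContMDiff 𝓘(ℝ, E₁) 𝓘(ℝ, ℝ) ∞ f) (hf_pos : ∀ p, 0 < f p)
    -- the isometric immersion
    (F : N₁ × N₂ → M)
    (hF : IsIsometricImmersion 𝓘(ℝ, E) (warpedMetric g₁.inner g₂.inner f) S.g.inner F)
    (hcontact : IsContactSplitting 𝓘(ℝ, E₁) 𝓘(ℝ, E₂) S F)
    (hmin : IsD₁Minimal g₁.inner g₂.inner f S.g.inner F) :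
    (∀ x : N₁ × N₂,
      2 * (n₂ : ℝ) * (gradNormSq 𝓘(ℝ, E₁) g₁.inner (fun p => Real.log (f p)) x.1
          - laplacian 𝓘(ℝ, E₁) g₁.inner (fun p => Real.log (f p)) x.1
          + ((n₁ : ℝ) - 1) * (c / 4))
        ≤ secondFundFormNormSq (warpedMetric g₁.inner g₂.inner f) S.g.inner F x) ∧
    ((∀ x : N₁ × N₂,
      secondFundFormNormSq (warpedMetric g₁.inner g₂.inner f) S.g.inner F x =
        2 * (n₂ : ℝ) * (gradNormSq 𝓘(ℝ, E₁) g₁.inner (fun p => Real.log (f p)) x.1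
          - laplacian 𝓘(ℝ, E₁) g₁.inner (fun p => Real.log (f p)) x.1
          + ((n₁ : ℝ) - 1) * (c / 4))) ↔
      (∀ q : N₂, IsTotallyGeodesic 𝓘(ℝ, E₁) S.g.inner (fun p : N₁ => F (p, q))) ∧
      (∀ p : N₁, IsTotallyUmbilical 𝓘(ℝ, E₂) S.g.inner (fun q : N₂ => F (p, q))) ∧
      IsMinimal (𝓘(ℝ, E₁).prod 𝓘(ℝ, E₂)) S.g.inner F) := by

  subst hn₁ hn₂
  have hg : ∀ x (w : E), w ≠ 0 → 0 < (S.g.inner (F x) : E →L[ℝ] E →L[ℝ] ℝ) w w :=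
    fun x w hw => S.g.pos (F x) w hw
  have hz : ∀ x (w : E), w = 0 → (S.g.inner (F x) : E →L[ℝ] E →L[ℝ] ℝ) w w = 0 := by
    rintro x w rfl
    exact map_zero _
  have nn : ∀ x (w : E), 0 ≤ (S.g.inner (F x) : E →L[ℝ] E →L[ℝ] ℝ) w w := fun x w => by
    rcases eq_or_ne w 0 with hw | hw
    · exact (hz x w hw).ge
    · exact (hg x w hw).le
  have h₁ : ∀ x : N₁ × N₂, ∃ e : Basis (Fin (finrank ℝ E₁)) ℝ E₁,
      ∀ i j, (g₁.inner x.1 : E₁ →L[ℝ] E₁ →L[ℝ] ℝ) (e i) (e j) = if i = j then 1 else 0 :=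
    fun x => exists_orthonormal_basis (g₁.symm x.1) (g₁.pos x.1)
  choose e he using h₁
  choose d hd using fun x : N₁ × N₂ =>
    exists_orthonormal_basis (fiberMetric_symm (g₂ := g₂) (f := f) x) (fiberMetric_pos hf_pos x)
  have hnorm := fun x => secondFundFormNormSq_eq hS hf hf_pos hF hcontact hmin x (he x) (hd x)
  have hA : ∀ x, 0 ≤ ∑ i, ∑ j, (S.g.inner (F x) : E →L[ℝ] E →L[ℝ] ℝ)
      (warpedSecondFundForm S.g g₁ g₂ f F x (e x i, 0) (e x j, 0))
      (warpedSecondFundForm S.g g₁ g₂ f F x (e x i, 0) (e x j, 0)) := fun x =>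
    Finset.sum_nonneg fun i _ => Finset.sum_nonneg fun j _ => nn x _
  have hD : ∀ x, 0 ≤ ∑ a, ∑ a', (S.g.inner (F x) : E →L[ℝ] E →L[ℝ] ℝ)
      (warpedSecondFundForm S.g g₁ g₂ f F x (0, d x a) (0, d x a'))
      (warpedSecondFundForm S.g g₁ g₂ f F x (0, d x a) (0, d x a')) := fun x =>
    Finset.sum_nonneg fun i _ => Finset.sum_nonneg fun j _ => nn x _
  refine ⟨fun x => ?_, ?_⟩
  · rw [hnorm x, add_assoc]
    exact le_add_of_nonneg_right (add_nonneg (hA x) (hD x))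
  rw [isTotallyGeodesic_slice_iff hf hf_pos hF, isMinimal_iff hf_pos hF hmin he hd]
  constructor
  · intro h
    have h0 := fun x => (add_eq_zero_iff_of_nonneg (hA x) (hD x)).1
      (by have := (hnorm x).symm.trans (h x); rwa [add_assoc, add_eq_left] at this)
    have h₂₂ : ∀ (x : N₁ × N₂) (u v : E₂),
        warpedSecondFundForm S.g g₁ g₂ f F x (0, u) (0, v) = 0 := fun x =>
      eq_zero_of_sum_eq_zero (hg x) (e := d x)
        (h := (warpedSecondFundForm S.g g₁ g₂ f F x).compl₁₂ (LinearMap.inr ℝ E₁ E₂)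
          (LinearMap.inr ℝ E₁ E₂)) (h0 x).2
    have htr : ∀ x, ∑ a, warpedSecondFundForm S.g g₁ g₂ f F x (0, d x a) (0, d x a) = 0 :=
      fun x => Finset.sum_eq_zero fun a _ => h₂₂ x _ _
    exact ⟨fun x => eq_zero_of_sum_eq_zero (hg x) (e := e x)
        (h := (warpedSecondFundForm S.g g₁ g₂ f F x).compl₁₂ (LinearMap.inl ℝ E₁ E₂)
          (LinearMap.inl ℝ E₁ E₂)) (h0 x).1,
      (isTotallyUmbilical_slice_iff hf hf_pos hF hd htr).2 h₂₂, htr⟩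
  · rintro ⟨h₁₁, humb, htr⟩ x
    have h₂₂ := (isTotallyUmbilical_slice_iff hf hf_pos hF hd htr).1 humb
    rw [hnorm x]
    rw [Finset.sum_eq_zero fun i _ => Finset.sum_eq_zero fun j _ => hz x _ (h₁₁ x _ _),
      Finset.sum_eq_zero fun i _ => Finset.sum_eq_zero fun j _ => hz x _ (h₂₂ x _ _),
      add_zero, add_zero]

end
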